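/- Let $d\ge 3$, $r\ge 2$ and $n_1,\dots,n_d\ge r^2$; site indices are cyclic modulo $d$. For cores $Q=(Q_1,\dots,Q_d)$, $Q_k=(Q_k^{(\alpha)})_{\alpha\in[n_k]}$ with $Q_k^{(\alpha)}\in\mathbb C^{r\times r}$, let $T_Q(\alpha_1,\dots,\alpha_d)=\operatorname{tr}(Q_1^{(\alpha_1)}\cdots Q_d^{(\alpha_d)})$ and let $|\psi_Q\rangle=T_Q/\|T_Q\|$ be the matrix product state (MPS) of bond dimension $r$. For $S\subseteq[d]$ the marginal $\rho^S=\operatorname{tr}_{S^c}|\psi\rangle\langle\psi|$ has entries $\rho^S(\alpha,\beta)=\sum_{\gamma}\psi_{\alpha\gamma}\overline{\psi_{\beta\gamma}}$. Matrix rows and columns in $[r]\times[r]$ are listed with the first index slow; the unfoldings of a core $C$ are $C_{\langle 1\rangle}(\alpha,(a,b))=C^{(\alpha)}_{ab}$ and $C_{[1]}(\alpha,(b,a))=C^{(\alpha)}_{ab}$; $\dagger$ is the Moore–Penrose inverse. Probes. For each pair $(j,k)$ with $k=j+1$ fix $(h_\iota,v_\iota)$, $\iota=1,\dots,4$ (they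 may depend on the pair), with $h_\iota\in[d]\setminus\{j,k\}$ and unit vectors $v_\iota\in\mathbb C^{n_{h_\iota}}$, such that, with $w_\iota$ the vector of $\bigoplus_h\mathbb C^{n_h}$ equal to $v_\iota$ in the summand $h_\iota$ and $0$ elsewhere, $w_1,w_2$ are linearly independent, $w_3,w_4$ are linearly independent, and $\operatorname{span}(w_1,w_2)\ne\operatorname{span}(w_3,w_4)$. From the 3-body marginals define the $n_k\times n_j$ matrix $$M^{h,v}_{j,k}(\alpha_k,\alpha_j)=\sum_{\alpha_h,\alpha_h'}v_{\alpha_h}\overline{v_{\alpha'_h}}\;\rho^{\{h,j,k\}}\big((\alpha_k,\alpha_h,\alpha_j),(1,\alpha_h',1)\big).$$ Algorithm (input: the 3-body marginals). For each pair $(j,k)$, $k=j+1$: (1) choose $E_k\in\mathbb C^{n_k\times r^2}$ whose columns $(a,b)$, $a\in[r]$, form a basis of the eigenspace of the $b$-th nonzero eigenvalue of $M^{h_1,v_1}_{j,k}(M^{h_2,v_2}_{j,k})^\dagger$ (the nonzero eigenvalues being $r$ distinct ones of multiplicity $r$, in any order), and likewise $E_k'$ for $M^{h_3,v_3}_{j,k}(M^{h_4,v_4}_{j,k})^\dagger$;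 (2) with $F=E_k^\dagger E_k'$ and blocks $(F^{(b,c)})_{a,a'}=F_{(a,b),(a',c)}$, set $\hat K_1=I$ and $\hat K_\ell=F^{(1,1)}(F^{(\ell,1)})^{-1}$ for $\ell\ge2$; (3) define $\hat Q_k$ by $\hat Q_{k\langle1\rangle}=E_k\,\Pi(\hat K)^{-1}$, where $\Pi(\hat K)_{(a,b),(a',b')}=\delta_{bb'}(\hat K_b)_{aa'}$; (4) define $\tilde Q_j$ by $\tilde Q_{j[1]}=(\hat Q_{k\langle1\rangle}^\dagger M^{h_1,v_1}_{j,k})^{\top}$. Then for each $k\in[d]$ let $N_k$ be the top-left $r\times r$ block of $\tilde Q_{k[1]}^\dagger\hat Q_{k[1]}$ and output $\check Q_k^{(\alpha)}=\det(N_k^{-1})\,N_k^{\top}\tilde Q_k^{(\alpha)}$. Theorem. Let the cores $Q$ be random with a joint law that is absolutely continuous with respect to Lebesgue measure on $\prod_k\mathbb C^{n_k\times r\times r}$, and let the algorithm be given the 3-body marginals of $|\psi_Q\rangle$. Then with probability one: $T_Q\neq0$ (so that $|\psi_Q\rangle$ is a unit vector); eigenbases as in (1) exist; and for every choice of such eigenbases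 (i) all matrices inverted in (2) and (3) are invertible; (ii) after replacing the basis of the $b$-th eigenspace in $E_k$ by its image under $G_{k,b}\in\mathbb C^{r\times r}$, for Lebesgue-almost every $(G_{k,b})_{k\in[d],b\in[r]}$ the new $E_k$ are again admissible in (1) and all the resulting $N_k$ are invertible; (iii) whenever all $N_k$ are invertible, the output recovers the cores up to gauge and a global scalar: there are $c\in\mathbb C\setminus\{0\}$ and $L_1,\dots,L_d\in GL(r,\mathbb C)$ (indices cyclic) such that, after multiplying $\check Q_1$ by $c$, $\check Q_k^{(\alpha)}=L_k^{-1}Q_k^{(\alpha)}L_{k+1}$ for all $k$ and $\alpha$; and $|\psi_{\check Q}\rangle$ equals $|\psi_Q\rangle$ up to a global phase. -/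

import Mathlib

open MeasureTheory Matrix
open scoped Kronecker ComplexConjugate

noncomputable section

namespace BlostrMPS

/-! ### Moore-Penrose inverse -/

/-- The four Penrose equations: `B` is a Moore-Penrose inverse of `A`. -/
structure IsPinv {p q : Type*} [Fintype p] [Fintype q]
    (A : Matrix p q ℂ) (B : Matrix q p ℂ) : Prop where
  aba : A * B * A = A
  bab : B * A * B = B
  herm_ab : (A * B)ᴴ = A * B
  herm_ba : (B * A)ᴴ = B * A

theorem IsPinv.unique {p q : Type*} [Fintype p] [Fintype q]
    {A : Matrix p q ℂ} {B C : Matrix q p ℂ} (hB : IsPinv A B) (hC : IsPinv A C) : B = C := by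
  have h1 : A * B = A * C := by
    have e : (A * C) * (A * B) = A * B := by
      rw [← Matrix.mul_assoc, hC.aba]
    have e2 := congrArg conjTranspose e
    rw [conjTranspose_mul, hB.herm_ab, hC.herm_ab, ← Matrix.mul_assoc, hB.aba] at e2
    exact e2.symm
  have h2 : B * A = C * A := by
    have e : (B * A) * (C * A) = B * A := by
      rw [Matrix.mul_assoc, ← Matrix.mul_assoc A, hC.aba]
    have e2 := congrArg conjTranspose e
    rw [conjTranspose_mul, hB.herm_ba, hC.herm_ba, Matrix.mul_assoc, ← Matrix.mul_assoc A,
      hB.aba] at e2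
    exact e2.symm
  rw [← hB.bab, Matrix.mul_assoc, h1, ← Matrix.mul_assoc, h2, hC.bab]

open scoped ComplexOrder in
theorem exists_isPinv {p q : Type*} [Fintype p] [Fintype q] [DecidableEq q]
    (A : Matrix p q ℂ) : ∃ B, IsPinv A B := by
  have hH : (Aᴴ * A).IsHermitian := isHermitian_conjTranspose_mul_self A
  obtain ⟨G, hG, hcomm, hHGH, hGHG⟩ : ∃ G : Matrix q q ℂ, Gᴴ = G ∧
      (Aᴴ * A) * G = G * (Aᴴ * A) ∧ (Aᴴ * A) * G * (Aᴴ * A) = Aᴴ * A ∧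
      G * (Aᴴ * A) * G = G := by
    set U : Matrix q q ℂ := (hH.eigenvectorUnitary : Matrix q q ℂ) with hU
    have hUU : Uᴴ * U = 1 := by
      rw [hU, ← star_eq_conjTranspose]; exact Unitary.coe_star_mul_self _
    set D : Matrix q q ℂ := diagonal (fun i => (hH.eigenvalues i : ℂ)) with hD
    set D' : Matrix q q ℂ := diagonal (fun i => ((hH.eigenvalues i : ℂ))⁻¹) with hD'
    have hspec : Aᴴ * A = U * D * Uᴴ := by
      have := hH.spectral_theorem
      rw [Unitary.conjStarAlgAut_apply] at this
      exact this
    have key : ∀ X Y : Matrix q q ℂ, (U * X * Uᴴ) * (U * Y * Uᴴ) = U * (X * Y) * Uᴴ := by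
      intro X Y
      calc (U * X * Uᴴ) * (U * Y * Uᴴ) = U * X * (Uᴴ * U) * Y * Uᴴ := by
            simp only [Matrix.mul_assoc]
        _ = U * (X * Y) * Uᴴ := by rw [hUU]; simp only [Matrix.mul_assoc, Matrix.mul_one]
    refine ⟨U * D' * Uᴴ, ?_, ?_, ?_, ?_⟩
    · have : D'ᴴ = D' := by
        rw [hD', diagonal_conjTranspose]
        congr 1
        funext i
        simp
      rw [conjTranspose_mul, conjTranspose_mul, conjTranspose_conjTranspose, this,
        Matrix.mul_assoc]
    · rw [hspec, key, key]
      congr 2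
      simp [hD, hD', diagonal_mul_diagonal, mul_comm]
    · rw [hspec, key, key]
      congr 2
      simp [hD, hD', diagonal_mul_diagonal]
    · rw [hspec, key, key]
      congr 2
      simp only [hD, hD', diagonal_mul_diagonal]
      congr 1
      funext i
      by_cases h : (hH.eigenvalues i : ℂ) = 0 <;> simp [h]
  have hA : A * G * (Aᴴ * A) = A := by
    have : (A * G * (Aᴴ * A) - A)ᴴ * (A * G * (Aᴴ * A) - A) = 0 := by
      have e1 : (A * G * (Aᴴ * A) - A)ᴴ = ((Aᴴ * A) * G - 1) * Aᴴ := by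
        rw [conjTranspose_sub, conjTranspose_mul (A * G), hH.eq, conjTranspose_mul A, hG,
          Matrix.sub_mul, Matrix.one_mul, Matrix.mul_assoc (Aᴴ * A)]
      have e2 : Aᴴ * (A * G * (Aᴴ * A) - A) = 0 := by
        rw [Matrix.mul_sub, ← Matrix.mul_assoc, ← Matrix.mul_assoc Aᴴ A G, hHGH, sub_self]
      rw [e1, Matrix.mul_assoc, e2, Matrix.mul_zero]
    exact sub_eq_zero.mp (conjTranspose_mul_self_eq_zero.mp this)
  refine ⟨G * Aᴴ, ?_, ?_, ?_, ?_⟩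
  · rw [← Matrix.mul_assoc, Matrix.mul_assoc (A * G), hA]
  · calc G * Aᴴ * A * (G * Aᴴ) = G * (Aᴴ * A) * G * Aᴴ := by simp only [Matrix.mul_assoc]
      _ = G * Aᴴ := by rw [hGHG]
  · simp only [conjTranspose_mul, conjTranspose_conjTranspose, hG, Matrix.mul_assoc]
  · rw [Matrix.mul_assoc, conjTranspose_mul, hG, hH.eq, hcomm]

/-- The Moore-Penrose inverse (it exists and is unique). -/
def pinv {p q : Type*} [Fintype p] [Fintype q] [DecidableEq q] (A : Matrix p q ℂ) :
    Matrix q p ℂ := (exists_isPinv A).choose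

/-! ### Cores, matrix product states, gauge, marginals

Sites are `Fin d`, so that `k + 1` and `k - 1` are cyclic. -/

section Model

variable {d : ℕ} (n : Fin d → ℕ) (r : ℕ)

/-- A family of cores; `Q k α` is the `r × r` slice of the `k`-th core at index `α`. -/
abbrev Cores : Type := (k : Fin d) → Fin (n k) → Fin r → Fin r → ℂ

/-- Multi-indices of the tensor. -/
abbrev Idx : Type := (k : Fin d) → Fin (n k)

/-- Access to the marginals on subsystems of at most three sites, and to nothing else. -/
abbrev ThreeBody : Type :=
  (S : Finset (Fin d)) → S.card ≤ 3 →
    Matrix ((k : S) → Fin (n k)) ((k : S) → Fin (n k)) ℂ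

variable {n r}

/-- The slice as a matrix. -/
def slice (Q : Cores n r) (k : Fin d) (α : Fin (n k)) : Matrix (Fin r) (Fin r) ℂ :=
  Matrix.of (Q k α)

/-- The tensor ring: trace of the product of the slices in the order of the sites. -/
def ringTensor (Q : Cores n r) (α : Idx n) : ℂ :=
  ((List.ofFn fun k => slice Q k (α k)).prod).trace

/-- The matrix product state of the cores: the tensor ring, normalized to a unit vector. -/
def mpsState (Q : Cores n r) (α : Idx n) : ℂ :=
  ((Real.sqrt (∑ β, ‖ringTensor Q β‖ ^ 2) : ℝ) : ℂ)⁻¹ * ringTensor Q α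

/-- The multi-index equal to `a` on `S` and to `c` off `S`. -/
def glue (S : Finset (Fin d)) (a : (k : S) → Fin (n k))
    (c : (k : {k : Fin d // k ∉ S}) → Fin (n k)) : Idx n :=
  fun k => if h : k ∈ S then a ⟨k, h⟩ else c ⟨k, h⟩

/-- The marginal of `ψ` on `S`: partial trace of `|ψ⟩⟨ψ|` over the complement of `S`. -/
def marginal (ψ : Idx n → ℂ) (S : Finset (Fin d)) :
    Matrix ((k : S) → Fin (n k)) ((k : S) → Fin (n k)) ℂ :=
  Matrix.of fun a b => ∑ c : (k : {k : Fin d // k ∉ S}) → Fin (n k),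
    ψ (glue S a c) * conj (ψ (glue S b c))

/-- The marginals of `ψ` on at most three sites. -/
def threeBody (ψ : Idx n → ℂ) : ThreeBody n := fun S _ => marginal ψ S

/-- Gauge equivalence: `Q' k α = L k⁻¹ * Q k α * L (k+1)` with invertible `L k`. -/
def GaugeEquiv [NeZero d] (Q Q' : Cores n r) : Prop :=
  ∃ L : Fin d → GL (Fin r) ℂ, ∀ (k : Fin d) (α : Fin (n k)),
    slice Q' k α = ((L k)⁻¹ : GL (Fin r) ℂ).val * slice Q k α * (L (k + 1)).val

/-- Multiply the core of the first site by `c`. -/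
def scaleFirst [NeZero d] (c : ℂ) (Q : Cores n r) : Cores n r :=
  fun k α a b => (if k = 0 then c else 1) * Q k α a b

end Model

/-! ### One pair of neighbouring sites -/

section Pair

variable {r m : ℕ}

/-- `E` is a full eigenbasis of `A` for its nonzero spectrum, which consists of `r` distinct
eigenvalues of multiplicity `r`. The column `(a, b)` (in position `a * r + b`) is the `a`-th
basis vector of the eigenspace of the `b`-th eigenvalue; order and bases are free. -/
def IsEigenbasis (A : Matrix (Fin m) (Fin m) ℂ) (E : Matrix (Fin m) (Fin r × Fin r) ℂ) : Prop :=
  ∃ lam : Fin r → ℂ, Function.Injective lam ∧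
    (∀ z : ℂ, z ∈ Set.range lam ↔ z ≠ 0 ∧ Module.End.HasEigenvalue (Matrix.toLin' A) z) ∧
    ∀ b : Fin r,
      LinearIndependent ℂ (fun a : Fin r => fun i : Fin m => E i (a, b)) ∧
      Submodule.span ℂ (Set.range fun a : Fin r => fun i : Fin m => E i (a, b)) =
        Module.End.eigenspace (Matrix.toLin' A) (lam b)

/-- The block `F^{(j,k)}` of `F = E† E'`. -/
def blockF (E E' : Matrix (Fin m) (Fin r × Fin r) ℂ) (j k : Fin r) : Matrix (Fin r) (Fin r) ℂ :=
  Matrix.of fun a c => (pinv E * E') (a, j) (c, k)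

/-- `K̂_1 = I` and `K̂_ℓ = F^{(1,1)} (F^{(ℓ,1)})⁻¹`. -/
def hatK [NeZero r] (E E' : Matrix (Fin m) (Fin r × Fin r) ℂ) (l : Fin r) :
    Matrix (Fin r) (Fin r) ℂ :=
  if l = 0 then 1 else blockF E E' 0 0 * (blockF E E' l 0)⁻¹

/-- The unfolding `⟨1⟩` of the recovered core, `E (Π(K̂))⁻¹`. Mathlib's `blockDiagonal` has the
block number as the second (fast) index, so `blockDiagonal K̂` is the permuted matrix `Π(K̂)`. -/
def hatUnfold [NeZero r] (E E' : Matrix (Fin m) (Fin r × Fin r) ℂ) :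
    Matrix (Fin m) (Fin r × Fin r) ℂ :=
  E * (Matrix.blockDiagonal (hatK E E'))⁻¹

/-- Change of basis by `G b` within the `b`-th eigenspace. -/
def rotate (G : Fin r → Fin r → Fin r → ℂ) (E : Matrix (Fin m) (Fin r × Fin r) ℂ) :
    Matrix (Fin m) (Fin r × Fin r) ℂ :=
  E * Matrix.blockDiagonal fun b => Matrix.of (G b)

end Pair

/-! ### The algorithm -/

section Algorithm

variable {d : ℕ} [NeZero d] (n : Fin d → ℕ)

/-- For the pair `(k - 1, k)`, four sites and four vectors on these sites. -/
structure Probes where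
  site : Fin d → Fin 4 → Fin d
  vec : (k : Fin d) → (i : Fin 4) → Fin (n (site k i)) → ℂ

variable {n}

/-- The probe `(h, v)` as a vector of the direct sum of all the local spaces. -/
def Probes.embed (p : Probes n) (k : Fin d) (i : Fin 4) : (l : Fin d) → Fin (n l) → ℂ :=
  Pi.single (p.site k i) (p.vec k i)

/-- Unit probe vectors on sites other than `k - 1` and `k`; the first two probes differ, the last
two probes differ, and the two pairs differ, all of it up to linear combination. For standard
basis vectors on one site this says `α ≠ β`, `α' ≠ β'`, `{α, β} ≠ {α', β'}`. -/
structure Probes.Admissible (p : Probes n) : Prop where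
  ne_left : ∀ k i, p.site k i ≠ k - 1
  ne_right : ∀ k i, p.site k i ≠ k
  unit : ∀ k i, ∑ a, ‖p.vec k i a‖ ^ 2 = 1
  first : ∀ k, LinearIndependent ℂ ![p.embed k 0, p.embed k 1]
  second : ∀ k, LinearIndependent ℂ ![p.embed k 2, p.embed k 3]
  pairs : ∀ k, Submodule.span ℂ {p.embed k 0, p.embed k 1} ≠
    Submodule.span ℂ {p.embed k 2, p.embed k 3}

variable [∀ k, NeZero (n k)]

/-- The multi-index with `x` at `k`, `y` at `j`, `s` at `h` and the first index elsewhere. -/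
def idx3 (j k h : Fin d) (x : Fin (n k)) (y : Fin (n j)) (s : Fin (n h)) : Idx n :=
  Function.update (Function.update (Function.update (fun _ => 0) k x) j y) h s

/-- The matrix `M^{h,v}_{j,k}`: contract the marginal on `{h, j, k}` with `v` in the mode `h`, and
take the entries with row index `(x, y)` at `(k, j)` and column index `(1, 1)` at `(k, j)`. -/
def probeMatrix (ρ : ThreeBody n) (j k h : Fin d) (v : Fin (n h) → ℂ) :
    Matrix (Fin (n k)) (Fin (n j)) ℂ :=
  Matrix.of fun x y => ∑ s, ∑ t, v s * conj (v t) *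
    ρ {h, j, k} Finset.card_le_three (fun l => idx3 j k h x y s l) (fun l => idx3 j k h 0 0 t l)

variable {r : ℕ}

/-- A choice of `n_k × r²` matrices, one for each pair `(k - 1, k)`. -/
abbrev Bases (n : Fin d → ℕ) (r : ℕ) : Type :=
  (k : Fin d) → Matrix (Fin (n k)) (Fin r × Fin r) ℂ

/-- `E k`, `E' k` are eigenbases for the nonzero spectra of the two products
`M^{h₁,v₁} (M^{h₂,v₂})†` and `M^{h₃,v₃} (M^{h₄,v₄})†` of the pair `(k - 1, k)`. -/
def IsEigenChoice (ρ : ThreeBody n) (p : Probes n) (E E' : Bases n r) : Prop :=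
  ∀ k : Fin d,
    IsEigenbasis (probeMatrix ρ (k - 1) k (p.site k 0) (p.vec k 0) *
      pinv (probeMatrix ρ (k - 1) k (p.site k 1) (p.vec k 1))) (E k) ∧
    IsEigenbasis (probeMatrix ρ (k - 1) k (p.site k 2) (p.vec k 2) *
      pinv (probeMatrix ρ (k - 1) k (p.site k 3) (p.vec k 3))) (E' k)

variable [NeZero r]

/-- The core `Q̂_k`, obtained from the pair `(k - 1, k)`: the column `(a, b)` of the unfolding
`⟨1⟩` holds the entries `(a, b)` of the slices. -/
def hatCore (E E' : Bases n r) : Cores n r :=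
  fun k α a b => hatUnfold (E k) (E' k) α (a, b)

/-- The core `Q̃_j`, obtained from the pair `(j, j + 1)`: its unfolding `[1]`, whose column `(b, a)`
holds the entries `(a, b)` of the slices, is the transpose of `Q̂_{j+1⟨1⟩}† M^{h₁,v₁}_{j,j+1}`. -/
def tildeCore (ρ : ThreeBody n) (p : Probes n) (E E' : Bases n r) : Cores n r :=
  fun j α a b => (pinv (hatUnfold (E (j + 1)) (E' (j + 1))) *
    probeMatrix ρ j (j + 1) (p.site (j + 1) 0) (p.vec (j + 1) 0))ᵀ α (b, a)

/-- The unfolding `[1]` of the `k`-th core. -/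
def unfoldSq (Q : Cores n r) (k : Fin d) : Matrix (Fin (n k)) (Fin r × Fin r) ℂ :=
  Matrix.of fun α ba => Q k α ba.2 ba.1

/-- `N_k`, the top-left `r × r` block of `Q̃_{k[1]}† Q̂_{k[1]}`. -/
def matN (ρ : ThreeBody n) (p : Probes n) (E E' : Bases n r) (k : Fin d) :
    Matrix (Fin r) (Fin r) ℂ :=
  Matrix.of fun a b =>
    (pinv (unfoldSq (tildeCore ρ p E E') k) * unfoldSq (hatCore E E') k) (0, a) (0, b)

/-- The output `Q̌_k = det(N_k⁻¹) • (Q̃_k ×₂ N_kᵀ)`, with slices `det(N_k⁻¹) • N_kᵀ Q̃_k^{(α)}`. -/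
def output (ρ : ThreeBody n) (p : Probes n) (E E' : Bases n r) : Cores n r :=
  fun k α => (((matN ρ p E E' k)⁻¹).det •
    ((matN ρ p E E' k)ᵀ * slice (tildeCore ρ p E E') k α) : Matrix (Fin r) (Fin r) ℂ)

/-- All the matrices that the algorithm inverts in the computation of `K̂` and of `Q̂` are
invertible. -/
def HatDefined (E E' : Bases n r) : Prop :=
  ∀ k : Fin d, (∀ l : Fin r, IsUnit (blockF (E k) (E' k) l 0).det) ∧
    IsUnit (Matrix.blockDiagonal (hatK (E k) (E' k))).det

/-- All the matrices `N_k` that the algorithm inverts are invertible. -/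
def GaugeDefined (ρ : ThreeBody n) (p : Probes n) (E E' : Bases n r) : Prop :=
  ∀ k : Fin d, IsUnit (matN ρ p E E' k).det

end Algorithm

end BlostrMPS

end

/-! Cyclicity of the trace isolates two neighbouring sites `j`, `k = j + 1`: the tensor is `tr(Q_j
Q_k R)`, with `R` the product of the other slices. Fixing the column of the marginal at `(1, 1)`
therefore gives `M^{h,v} = U (1 ⊗ X) Wᵀ`, where `U`, `W` are the unfoldings `⟨1⟩` of `Q_k` and `[1]`
of `Q_j`, and `X` is an `r × r` matrix depending on the probe (`probeMatrix_eq`). If `U`, `W` have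
full column rank and the `X` are invertible, then `M M'† = U (1 ⊗ X X'⁻¹) U†`. Its eigenbases are
exactly `E = U (1 ⊗ V) blockDiagonal K`, with `V` diagonalizing `X X'⁻¹` and the `K b` arbitrary
invertible matrices.

The second pair of probes removes the arbitrariness in `K`. The blocks of `E† E'` are `(V⁻¹ V')_{bc}
• K_b⁻¹ K'_c`, so the quotients forming `K̂` give every `K_l` relative to `K_0`, up to a scalar
which is absorbed into the columns of `V` (`hatUnfold_eq`). Hence `Q̂_k = A_k Q_k B_k` and `Q̃_k =
B_{k+1}⁻¹ X_{k+1} Q_k A_{k+1}⁻¹`. Up to a scalar, `N_kᵀ` exchanges the left factor of `Q̃_k` for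
`A_k`; the output is `σ_k A_k Q_k A_{k+1}⁻¹`, a gauge transform up to scalars that can be collected
on the first core.

The genericity needed is: full rank of `U`, invertible `X`, simple spectra, and no zero entry in
`V⁻¹ V'`. Sufficient conditions for these are non-vanishing determinants, real-analytic in the
cores: for spectra the Hankel matrix of power traces, for `V⁻¹ V'` the linear independence of the
words `A^j A'^i`. A real-analytic function that is non-zero at one point is non-zero almost
everywhere (`ae_ne_zero_of_analytic`), so one witness per condition is enough.

The witnesses are close to product states: the slices off the pair are `f • 1 + ε • (g • B + g' •
C)`. The quotients `X X'⁻¹` are scalar at `ε = 0`; their trace-free parts are of order `ε`. The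
local functionals `f`, `g`, `g'` are chosen (`exists_separating_functionals`) so that, to first
order, the first quotient sees only `B` and the second only `C`. A diagonal matrix with distinct
entries and the cyclic shift then satisfy the conditions, and homogeneity of the determinants
removes the factor `ε`. -/

namespace BlostrMPS
/-! ### Real-analytic functions vanish on null sets -/

/-- By the identity theorem every point has a neighbourhood containing no zero other than possibly
itself; countably many such neighbourhoods cover the line. -/
theorem countable_zeros_of_analytic {f : ℝ → ℂ} (hf : AnalyticOnNhd ℝ f Set.univ)
    {a : ℝ} (ha : f a ≠ 0) : {t | f t = 0}.Countable := by
  have hU : ∀ x : ℝ, {y | y = x ∨ f y ≠ 0} ∈ nhds x := by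
    intro x
    rcases (hf x (Set.mem_univ x)).eventually_eq_zero_or_eventually_ne_zero with h | h
    · exact absurd (hf.eqOn_zero_of_preconnected_of_eventuallyEq_zero isPreconnected_univ
        (Set.mem_univ x) h (Set.mem_univ a)) ha
    · rw [eventually_nhdsWithin_iff] at h
      filter_upwards [h] with y hy
      exact or_iff_not_imp_left.2 hy
  obtain ⟨s, hs, hsU⟩ := TopologicalSpace.countable_cover_nhds hU
  refine hs.mono fun t ht => ?_
  obtain ⟨x, hx, hxt⟩ := Set.mem_iUnion₂.1 (hsU ▸ Set.mem_univ t : t ∈ ⋃ x ∈ s, _)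
  rcases hxt with rfl | h
  · exact hx
  · exact absurd ht h

-- Every line through `x₀` meets the zero set in a countable set. By Fubini on `[1, 2] × E` some
-- dilate of the zero set centred at `x₀` is null, and dilations scale Haar measure by a non-zero
-- factor.
open scoped Pointwise in
theorem ae_ne_zero_of_analytic {E : Type*} [NormedAddCommGroup E] [NormedSpace ℝ E]
    [FiniteDimensional ℝ E] [MeasurableSpace E] [BorelSpace E] (ν : Measure E)
    [ν.IsAddHaarMeasure] {f : E → ℂ} (hf : AnalyticOnNhd ℝ f Set.univ) {x₀ : E}
    (h₀ : f x₀ ≠ 0) : ∀ᵐ x ∂ν, f x ≠ 0 := by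
  have hcont : Continuous f := hf.continuous
  set g : E → ℂ := fun x => f (x₀ + x) with hg
  have hgc : Continuous g := hcont.comp (by fun_prop)
  have hline : ∀ x : E, {t : ℝ | g (t • x) = 0}.Countable := by
    intro x
    refine countable_zeros_of_analytic (f := fun t => g (t • x)) (a := 0) ?_ (by simpa [hg] using h₀)
    intro t _
    have h1 : AnalyticAt ℝ (fun t : ℝ => x₀ + t • x) t := by fun_prop
    exact (hf _ (Set.mem_univ _)).fun_comp h1
  set Z : Set E := {x | g x = 0} with hZ
  have hZm : MeasurableSet Z := (isClosed_eq hgc continuous_const).measurableSet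
  have hprod : ((volume.restrict (Set.Icc (1:ℝ) 2)).prod ν) {q : ℝ × E | g (q.1 • q.2) = 0} = 0 := by
    have hm : MeasurableSet {q : ℝ × E | g (q.1 • q.2) = 0} :=
      (isClosed_eq (hgc.comp (by fun_prop)) continuous_const).measurableSet
    rw [Measure.prod_apply_symm hm, lintegral_eq_zero_iff (measurable_measure_prodMk_right hm)]
    refine Filter.Eventually.of_forall fun x => ?_
    exact ((hline x).measure_zero _)
  have hm : MeasurableSet {q : ℝ × E | g (q.1 • q.2) = 0} :=
    (isClosed_eq (hgc.comp (by fun_prop)) continuous_const).measurableSet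
  have h2 := (Measure.measure_prod_null hm).1 hprod
  have h3 : ∃ t ∈ Set.Icc (1:ℝ) 2, ν {x | g (t • x) = 0} = 0 := by
    by_contra hcon
    push Not at hcon
    have h4 : ∀ᵐ t ∂(volume.restrict (Set.Icc (1:ℝ) 2)), t ∈ Set.Icc (1:ℝ) 2 :=
      ae_restrict_mem measurableSet_Icc
    have h5 : ∀ᵐ t ∂(volume.restrict (Set.Icc (1:ℝ) 2)), False := by
      filter_upwards [h2, h4] with t ht ht'
      exact hcon t ht' ht
    rw [Filter.eventually_false_iff_eq_bot, ae_eq_bot, Measure.restrict_eq_zero] at h5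
    norm_num at h5
  obtain ⟨t, ht, h4⟩ := h3
  have ht0 : t ≠ 0 := by linarith [ht.1]
  have h5 : ν Z = 0 := by
    have h6 : {x | g (t • x) = 0} = t⁻¹ • Z := by
      ext x
      rw [Set.mem_smul_set_iff_inv_smul_mem₀ (inv_ne_zero ht0), inv_inv]
      rfl
    rw [h6, Measure.addHaar_smul] at h4
    rcases mul_eq_zero.1 h4 with h | h
    · exfalso
      rw [ENNReal.ofReal_eq_zero] at h
      exact absurd h (not_le.2 (abs_pos.2 (pow_ne_zero _ (inv_ne_zero ht0))))
    · exact h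
  have h6 : {x | ¬ f x ≠ 0} = (fun x => -x₀ + x) ⁻¹' Z := by
    ext x; simp [hZ, hg]
  rw [ae_iff, h6, measure_preimage_add]
  exact h5

/-! ### Matrices with analytic entries -/

section AnalyticMat
variable {E : Type*} [NormedAddCommGroup E] [NormedSpace ℝ E]

/-- All entries are real-analytic functions of the parameter. -/
def AnalyticMat {p q : Type*} (A : E → Matrix p q ℂ) : Prop :=
  ∀ i j, AnalyticOnNhd ℝ (fun x => A x i j) Set.univ

theorem analytic_sum {ι : Type*} (s : Finset ι) {f : ι → E → ℂ}
    (h : ∀ i ∈ s, AnalyticOnNhd ℝ (f i) Set.univ) :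
    AnalyticOnNhd ℝ (fun x => ∑ i ∈ s, f i x) Set.univ :=
  Finset.analyticOnNhd_fun_sum s h

theorem analytic_conj {f : E → ℂ} (h : AnalyticOnNhd ℝ f Set.univ) :
    AnalyticOnNhd ℝ (fun x => conj (f x)) Set.univ := by
  intro x hx
  exact (Complex.conjCLE.toContinuousLinearMap.analyticAt _).fun_comp (h x hx)

variable {p q s : Type*}

theorem AnalyticMat.const (A : Matrix p q ℂ) : AnalyticMat fun _ : E => A :=
  fun _ _ => analyticOnNhd_const

theorem AnalyticMat.mul [Fintype q] {A : E → Matrix p q ℂ} {B : E → Matrix q s ℂ}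
    (hA : AnalyticMat A) (hB : AnalyticMat B) : AnalyticMat fun x => A x * B x := by
  intro i j
  simp only [Matrix.mul_apply]
  exact analytic_sum _ fun k _ => (hA i k).mul (hB k j)

theorem AnalyticMat.sub {A B : E → Matrix p q ℂ}
    (hA : AnalyticMat A) (hB : AnalyticMat B) : AnalyticMat fun x => A x - B x :=
  fun i j => (hA i j).sub (hB i j)

theorem AnalyticMat.sum {ι : Type*} (t : Finset ι) {A : ι → E → Matrix p q ℂ}
    (hA : ∀ i ∈ t, AnalyticMat (A i)) : AnalyticMat fun x => ∑ i ∈ t, A i x := by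
  intro i j
  simp only [Matrix.sum_apply]
  exact analytic_sum _ fun k hk => hA k hk i j

theorem AnalyticMat.smul {f : E → ℂ} {A : E → Matrix p q ℂ}
    (hf : AnalyticOnNhd ℝ f Set.univ) (hA : AnalyticMat A) : AnalyticMat fun x => f x • A x :=
  fun i j => hf.mul (hA i j)

theorem AnalyticMat.conjTranspose {A : E → Matrix p q ℂ} (hA : AnalyticMat A) :
    AnalyticMat fun x => (A x)ᴴ :=
  fun i j => analytic_conj (hA j i)

theorem AnalyticMat.trace [Fintype p] {A : E → Matrix p p ℂ} (hA : AnalyticMat A) :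
    AnalyticOnNhd ℝ (fun x => (A x).trace) Set.univ :=
  analytic_sum _ fun i _ => hA i i

theorem AnalyticMat.pow [Fintype p] [DecidableEq p] {A : E → Matrix p p ℂ} (hA : AnalyticMat A)
    (m : ℕ) : AnalyticMat fun x => A x ^ m := by
  induction m with
  | zero => simpa using AnalyticMat.const (1 : Matrix p p ℂ)
  | succ m ih => simpa only [pow_succ] using ih.mul hA

theorem AnalyticMat.det [Fintype p] [DecidableEq p] {A : E → Matrix p p ℂ} (hA : AnalyticMat A) :
    AnalyticOnNhd ℝ (fun x => (A x).det) Set.univ := by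
  simp only [Matrix.det_apply]
  refine analytic_sum _ fun σ _ => ?_
  simp only [Units.smul_def, zsmul_eq_mul]
  exact analyticOnNhd_const.mul (Finset.analyticOnNhd_fun_prod _ fun i _ => hA _ _)

/-- The adjugate replaces the inverse in the genericity conditions because it is analytic
everywhere, also where the determinant vanishes. -/
theorem AnalyticMat.adjugate [Fintype p] [DecidableEq p] {A : E → Matrix p p ℂ}
    (hA : AnalyticMat A) : AnalyticMat fun x => (A x).adjugate := by
  intro i j
  simp only [Matrix.adjugate_apply]
  refine AnalyticMat.det fun k l => ?_
  by_cases hk : k = j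
  · subst hk; simpa using analyticOnNhd_const
  · simpa [Matrix.updateRow_ne hk] using hA k l

theorem AnalyticMat.list_prod [Fintype p] [DecidableEq p] {ι : Type*} (L : List ι)
    {A : ι → E → Matrix p p ℂ} (hA : ∀ i, AnalyticMat (A i)) :
    AnalyticMat fun x => (L.map fun i => A i x).prod := by
  induction L with
  | nil => simpa using AnalyticMat.const (1 : Matrix p p ℂ)
  | cons a L ih => simpa only [List.map_cons, List.prod_cons] using (hA a).mul ih

end AnalyticMat

/-! ### The Moore-Penrose inverse of products -/

section Pinv
variable {p q s : Type*} [Fintype p] [Fintype q] [Fintype s] [DecidableEq q]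

theorem isPinv_pinv (A : Matrix p q ℂ) : IsPinv A (pinv A) := (exists_isPinv A).choose_spec

theorem IsPinv.pinv_eq {A : Matrix p q ℂ} {B : Matrix q p ℂ} (h : IsPinv A B) : pinv A = B :=
  (isPinv_pinv A).unique h

theorem pinv_mul_self {U : Matrix p q ℂ} (hU : IsUnit (Uᴴ * U).det) : pinv U * U = 1 := by
  have h1 : Uᴴ * U * (pinv U * U) = Uᴴ * U * 1 := by
    rw [Matrix.mul_one, Matrix.mul_assoc, ← Matrix.mul_assoc U, (isPinv_pinv U).aba]
  exact (Matrix.isUnit_iff_isUnit_det _).2 hU |>.mul_left_cancel h1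

/-- The reversed-order law fails for general pseudoinverses. Here a left inverse of `U` makes one of
the two products `1` and the other the Hermitian projection `U * pinv U`. -/
theorem pinv_mul_right {U : Matrix p q ℂ} (hU : pinv U * U = 1) {G : Matrix q q ℂ}
    (hG : IsUnit G.det) : pinv (U * G) = G⁻¹ * pinv U := by
  have e1 : U * G * (G⁻¹ * pinv U) = U * pinv U := by
    rw [Matrix.mul_assoc, ← Matrix.mul_assoc G, Matrix.mul_nonsing_inv _ hG, Matrix.one_mul]
  have e2 : G⁻¹ * pinv U * (U * G) = 1 := by
    rw [Matrix.mul_assoc, ← Matrix.mul_assoc (pinv U), hU, Matrix.one_mul,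
      Matrix.nonsing_inv_mul _ hG]
  refine IsPinv.pinv_eq ⟨?_, ?_, ?_, ?_⟩
  · rw [Matrix.mul_assoc, e2, Matrix.mul_one]
  · rw [e2, Matrix.one_mul]
  · rw [e1]; exact (isPinv_pinv U).herm_ab
  · rw [e2, conjTranspose_one]

/-- With full column rank on both sides the two Penrose products collapse to `U * pinv U` and `(W *
pinv W)ᵀ`, both Hermitian. -/
theorem pinv_mul_mul_transpose [DecidableEq s] {U : Matrix p q ℂ} {W : Matrix s q ℂ} (hU : pinv U * U = 1)
    (hW : pinv W * W = 1) {G : Matrix q q ℂ} (hG : IsUnit G.det) :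
    pinv (U * G * Wᵀ) = (pinv W)ᵀ * G⁻¹ * pinv U := by
  have hW' : Wᵀ * (pinv W)ᵀ = 1 := by rw [← transpose_mul, hW, transpose_one]
  have e1 : U * G * Wᵀ * ((pinv W)ᵀ * G⁻¹ * pinv U) = U * pinv U := by
    calc U * G * Wᵀ * ((pinv W)ᵀ * G⁻¹ * pinv U)
        = U * (G * ((Wᵀ * (pinv W)ᵀ) * G⁻¹)) * pinv U := by simp only [Matrix.mul_assoc]
      _ = U * pinv U := by
        rw [hW', Matrix.one_mul, Matrix.mul_nonsing_inv _ hG, Matrix.mul_one]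
  have e2 : (pinv W)ᵀ * G⁻¹ * pinv U * (U * G * Wᵀ) = (W * pinv W)ᵀ := by
    calc (pinv W)ᵀ * G⁻¹ * pinv U * (U * G * Wᵀ)
        = (pinv W)ᵀ * (G⁻¹ * ((pinv U * U) * G)) * Wᵀ := by simp only [Matrix.mul_assoc]
      _ = (W * pinv W)ᵀ := by
        rw [hU, Matrix.one_mul, Matrix.nonsing_inv_mul _ hG, Matrix.mul_one, transpose_mul]
  refine IsPinv.pinv_eq ⟨?_, ?_, ?_, ?_⟩
  · rw [e1, Matrix.mul_assoc U G, ← Matrix.mul_assoc (U * pinv U), (isPinv_pinv U).aba]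
  · rw [Matrix.mul_assoc _ _ (_ * _ * pinv U), e1, Matrix.mul_assoc, ← Matrix.mul_assoc (pinv U),
      (isPinv_pinv U).bab]
  · rw [e1]; exact (isPinv_pinv U).herm_ab
  · rw [e2]
    ext i j
    exact congrFun (congrFun (isPinv_pinv W).herm_ab j) i
end Pinv

/-! ### Eigenbases of `U (1 ⊗ Y) U†` -/

section Eigen
variable {r m : ℕ}

/-- The matrix `1 ⊗ V`. -/
abbrev idKron (V : Matrix (Fin r) (Fin r) ℂ) : Matrix (Fin r × Fin r) (Fin r × Fin r) ℂ := 1 ⊗ₖ V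

/-- `V` diagonalizes `Y` with eigenvalues `lam`. -/
structure Diagonalizes (V Y : Matrix (Fin r) (Fin r) ℂ) (lam : Fin r → ℂ) : Prop where
  isUnit : IsUnit V.det
  inj : Function.Injective lam
  mul_eq : Y * V = V * diagonal lam

theorem Diagonalizes.mulVec_col {V Y : Matrix (Fin r) (Fin r) ℂ} {lam : Fin r → ℂ}
    (h : Diagonalizes V Y lam) (b : Fin r) : Y *ᵥ V.col b = lam b • V.col b := by
  funext i
  have := congrFun (congrFun h.mul_eq i) b
  rw [Matrix.mul_diagonal] at this
  simpa [mulVec, dotProduct, Matrix.mul_apply, mul_comm] using this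

theorem Diagonalizes.inv_mul {V Y : Matrix (Fin r) (Fin r) ℂ} {lam : Fin r → ℂ}
    (h : Diagonalizes V Y lam) : V⁻¹ * Y = diagonal lam * V⁻¹ := by
  have h1 : V⁻¹ * (Y * V) * V⁻¹ = V⁻¹ * (V * diagonal lam) * V⁻¹ := by rw [h.mul_eq]
  rwa [Matrix.mul_assoc, Matrix.mul_assoc Y, Matrix.mul_nonsing_inv _ h.isUnit, Matrix.mul_one,
    ← Matrix.mul_assoc V⁻¹ V, Matrix.nonsing_inv_mul _ h.isUnit, Matrix.one_mul] at h1

/-- Eigenvectors of `Y` have a single non-zero coordinate in the eigenbasis. -/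
theorem Diagonalizes.coord_eq_zero {V Y : Matrix (Fin r) (Fin r) ℂ} {lam : Fin r → ℂ}
    (h : Diagonalizes V Y lam) {x : Fin r → ℂ} {z : ℂ} (hx : Y *ᵥ x = z • x) {c : Fin r}
    (hc : lam c ≠ z) : (V⁻¹ *ᵥ x) c = 0 := by
  have h1 : V⁻¹ *ᵥ (Y *ᵥ x) = z • (V⁻¹ *ᵥ x) := by rw [hx, mulVec_smul]
  rw [mulVec_mulVec, h.inv_mul, ← mulVec_mulVec] at h1
  have h2 := congrFun h1 c
  rw [mulVec_diagonal, Pi.smul_apply, smul_eq_mul] at h2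
  have h3 : (lam c - z) * (V⁻¹ *ᵥ x) c = 0 := by linear_combination h2
  exact (mul_eq_zero.1 h3).resolve_left (sub_ne_zero.2 hc)

/-- Distinct eigenvalues give a diagonalization. -/
theorem exists_diagonalizes {Y : Matrix (Fin r) (Fin r) ℂ} {lam : Fin r → ℂ}
    (hinj : Function.Injective lam)
    (hlam : ∀ b, Module.End.HasEigenvalue (Matrix.toLin' Y) (lam b)) :
    ∃ V, Diagonalizes V Y lam := by
  choose v hv using fun b => (hlam b).exists_hasEigenvector
  refine ⟨(Matrix.of v)ᵀ, ?_, hinj, ?_⟩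
  · have hli := Module.End.eigenvectors_linearIndependent' (Matrix.toLin' Y) lam hinj v hv
    rw [det_transpose, ← Matrix.isUnit_iff_isUnit_det]
    exact Matrix.linearIndependent_rows_iff_isUnit.1 hli
  · ext i b
    have := congrFun (hv b).apply_eq_smul i
    rw [Matrix.mul_diagonal]
    simpa [mulVec, dotProduct, Matrix.mul_apply, mul_comm] using this

theorem one_kronecker_mulVec (Y : Matrix (Fin r) (Fin r) ℂ) (y : Fin r × Fin r → ℂ) (a b : Fin r) :
    (idKron Y *ᵥ y) (a, b) = (Y *ᵥ fun c => y (a, c)) b := by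
  simp [mulVec, dotProduct, Fintype.sum_prod_type, Matrix.one_apply]

/-- The column `(c, e)` is column `c` of `K e` tensored with column `e` of `V`, which is the general
shape of an eigenvector of `1 ⊗ Y`. -/
theorem one_kronecker_mul_blockDiagonal (V : Matrix (Fin r) (Fin r) ℂ)
    (K : Fin r → Matrix (Fin r) (Fin r) ℂ) (a b c e : Fin r) :
    (idKron V * blockDiagonal K) (a, b) (c, e) = V b e * K e a c := by
  rw [Matrix.mul_apply, Fintype.sum_prod_type]
  simp [Matrix.one_apply, blockDiagonal_apply]

theorem isUnit_det_one_kronecker {V : Matrix (Fin r) (Fin r) ℂ} (hV : IsUnit V.det) :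
    IsUnit (idKron V).det := by
  rw [det_kronecker]; simpa using hV.pow _

theorem isUnit_det_blockDiagonal {K : Fin r → Matrix (Fin r) (Fin r) ℂ}
    (hK : ∀ b, IsUnit (K b).det) : IsUnit (blockDiagonal K).det := by
  rw [det_blockDiagonal]
  exact isUnit_iff_ne_zero.2 (Finset.prod_ne_zero_iff.2 fun b _ => (hK b).ne_zero)

/-- Full eigenbases in terms of the eigenvectors of the small matrix. -/
theorem isEigenbasis_of_diagonalizes {U : Matrix (Fin m) (Fin r × Fin r) ℂ} (hU : pinv U * U = 1)
    {V Y : Matrix (Fin r) (Fin r) ℂ} {lam : Fin r → ℂ} (h : Diagonalizes V Y lam)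
    (hlam : ∀ b, lam b ≠ 0) {K : Fin r → Matrix (Fin r) (Fin r) ℂ} (hK : ∀ b, IsUnit (K b).det) :
    IsEigenbasis (U * idKron Y * pinv U) (U * idKron V * blockDiagonal K) := by
  set P := U * idKron Y * pinv U with hP
  set E := U * idKron V * blockDiagonal K with hE
  have hE_col : ∀ a b, (fun i => E i (a, b)) = U *ᵥ fun q => V q.2 b * K b q.1 a := by
    intro a b
    funext i
    rw [hE, Matrix.mul_assoc, Matrix.mul_apply]
    refine Finset.sum_congr rfl fun q _ => ?_
    obtain ⟨c, e⟩ := q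
    rw [one_kronecker_mul_blockDiagonal]
  have hPU : ∀ y, P *ᵥ (U *ᵥ y) = U *ᵥ (idKron Y *ᵥ y) := by
    intro y
    rw [mulVec_mulVec, hP, Matrix.mul_assoc, hU, Matrix.mul_one, mulVec_mulVec]
  have hUinj : ∀ y, U *ᵥ y = 0 → y = 0 := by
    intro y hy
    rw [← one_mulVec y, ← hU, ← mulVec_mulVec, hy, mulVec_zero]
  have heig : ∀ a b, P *ᵥ (fun i => E i (a, b)) = lam b • fun i => E i (a, b) := by
    intro a b
    rw [hE_col, hPU, ← mulVec_smul]
    congr 1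
    funext q
    obtain ⟨c, e⟩ := q
    rw [one_kronecker_mulVec]
    have h1 := congrFun (h.mulVec_col b) e
    simp only [mulVec, dotProduct, col_apply, Pi.smul_apply, smul_eq_mul] at h1 ⊢
    rw [← mul_assoc, ← h1, Finset.sum_mul]
    exact Finset.sum_congr rfl fun _ _ => by ring
  -- For `z ≠ 0` an eigenvector equals `z⁻¹ • P x`, so it lies in the range of `U`, and injectivity
  -- of `U` transfers the eigenvalue equation to its preimage.
  have hform : ∀ (x : Fin m → ℂ) (z : ℂ), z ≠ 0 → P *ᵥ x = z • x → ∃ y, x = U *ᵥ y ∧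
      ∀ a, Y *ᵥ (fun c => y (a, c)) = z • fun c => y (a, c) := by
    intro x z hz hx
    have h1 : x = U *ᵥ (z⁻¹ • (idKron Y *ᵥ (pinv U *ᵥ x))) := by
      rw [mulVec_smul, mulVec_mulVec, mulVec_mulVec, ← hP, hx, smul_smul,
        inv_mul_cancel₀ hz, one_smul]
    refine ⟨_, h1, ?_⟩
    generalize (z⁻¹ • (idKron Y *ᵥ (pinv U *ᵥ x))) = y at h1
    intro a
    have h2 : U *ᵥ (idKron Y *ᵥ y - z • y) = 0 := by
      rw [mulVec_sub, ← hPU, ← h1, hx, mulVec_smul, ← h1, sub_self]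
    have h3 := sub_eq_zero.1 (hUinj _ h2)
    funext b
    have h4 := congrFun h3 (a, b)
    rwa [one_kronecker_mulVec] at h4
  have hcoord : ∀ (y : Fin r → ℂ) , y = V *ᵥ (V⁻¹ *ᵥ y) := by
    intro y
    rw [mulVec_mulVec, Matrix.mul_nonsing_inv _ h.isUnit, one_mulVec]
  have hli : ∀ b, LinearIndependent ℂ (fun a : Fin r => fun i : Fin m => E i (a, b)) := by
    intro b
    rw [Fintype.linearIndependent_iff]
    intro ξ hξ
    have h1 : U *ᵥ (fun q => V q.2 b * (K b *ᵥ ξ) q.1) = 0 := by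
      rw [← hξ]
      simp only [hE_col]
      funext i
      simp only [mulVec, dotProduct, Finset.sum_apply, Pi.smul_apply, smul_eq_mul]
      simp only [Finset.mul_sum]
      rw [Finset.sum_comm]
      exact Finset.sum_congr rfl fun _ _ => Finset.sum_congr rfl fun _ _ => by ring
    have h2 := hUinj _ h1
    have hVb : ∃ e, V e b ≠ 0 := by
      by_contra hcon
      push Not at hcon
      exact h.isUnit.ne_zero (det_eq_zero_of_column_eq_zero b hcon)
    obtain ⟨e, he⟩ := hVb
    have h3 : K b *ᵥ ξ = 0 := by
      funext a
      exact (mul_eq_zero.1 (congrFun h2 (a, e))).resolve_left he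
    have h4 : ξ = 0 := by
      rw [← one_mulVec ξ, ← Matrix.nonsing_inv_mul _ (hK b), ← mulVec_mulVec, h3, mulVec_zero]
    exact fun i => congrFun h4 i
  refine ⟨lam, h.inj, fun z => ⟨?_, ?_⟩, fun b => ⟨hli b, ?_⟩⟩
  · rintro ⟨b, rfl⟩
    refine ⟨hlam b, ?_⟩
    -- Any column of the block would do; `b` serves as first index because it is an available
    -- element of `Fin r`.
    refine Module.End.hasEigenvalue_of_hasEigenvector (x := fun i => E i (b, b)) ?_
    refine Module.End.hasEigenvector_iff.2 ⟨?_, (hli b).ne_zero b⟩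
    rw [Module.End.mem_eigenspace_iff, Matrix.toLin'_apply]
    exact heig b b
  · rintro ⟨hz, hev⟩
    obtain ⟨x, hx⟩ := hev.exists_hasEigenvector
    have hx1 := hx.apply_eq_smul
    rw [Matrix.toLin'_apply] at hx1
    obtain ⟨y, hxy, hy⟩ := hform x z hz hx1
    by_contra hcon
    apply hx.2
    rw [hxy]
    have : y = 0 := by
      funext q
      obtain ⟨a, c⟩ := q
      have h0 : V⁻¹ *ᵥ (fun c => y (a, c)) = 0 := by
        funext c
        exact h.coord_eq_zero (hy a) fun hc => hcon ⟨c, hc⟩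
      have := congrFun (hcoord fun c => y (a, c)) c
      rw [h0, mulVec_zero] at this
      exact this
    rw [this, mulVec_zero]
  · apply le_antisymm
    · rw [Submodule.span_le]
      rintro _ ⟨a, rfl⟩
      rw [SetLike.mem_coe, Module.End.mem_eigenspace_iff, Matrix.toLin'_apply]
      exact heig a b
    · intro x hx
      rw [Module.End.mem_eigenspace_iff, Matrix.toLin'_apply] at hx
      obtain ⟨y, hxy, hy⟩ := hform x _ (hlam b) hx
      -- For each `a` the vector `y (a, ·)` is a multiple of column `b` of `V`; `η` collects these
      -- multiples.
      set η : Fin r → ℂ := fun a => (V⁻¹ *ᵥ fun c => y (a, c)) b with hη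
      set ξ := (K b)⁻¹ *ᵥ η with hξ
      have hKξ : K b *ᵥ ξ = η := by
        rw [hξ, mulVec_mulVec, Matrix.mul_nonsing_inv _ (hK b), one_mulVec]
      have hy' : y = fun q => V q.2 b * (K b *ᵥ ξ) q.1 := by
        funext q
        obtain ⟨a, c⟩ := q
        have h1 := congrFun (hcoord fun c => y (a, c)) c
        rw [mulVec, dotProduct] at h1
        rw [Finset.sum_eq_single b] at h1
        · rw [hKξ]; exact h1
        · intro e _ he
          rw [h.coord_eq_zero (hy a) fun hc => he (h.inj hc), mul_zero]
        · simp
      have : x = ∑ a, ξ a • fun i => E i (a, b) := by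
        rw [hxy, hy']
        simp only [hE_col]
        funext i
        simp only [mulVec, dotProduct, Finset.sum_apply, Pi.smul_apply, smul_eq_mul]
        simp only [Finset.mul_sum]
        rw [Finset.sum_comm]
        exact Finset.sum_congr rfl fun _ _ => Finset.sum_congr rfl fun _ _ => by ring
      rw [this]
      exact Submodule.sum_mem _ fun a _ => Submodule.smul_mem _ _ (Submodule.subset_span ⟨a, rfl⟩)

/-- Non-zero eigenvalues force the columns of `E` into the range of `U`. In the coordinates `pinv U
* E` each slice `(a', ·)` of a column is an eigenvector of `Y` or zero, so `Y` has `r` distinct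
eigenvalues, and the slices are multiples of single columns of `V`. These multiples form `K`. -/
theorem IsEigenbasis.exists_diagonalizes [NeZero r] {U : Matrix (Fin m) (Fin r × Fin r) ℂ}
    (hU : pinv U * U = 1) {Y : Matrix (Fin r) (Fin r) ℂ} {E : Matrix (Fin m) (Fin r × Fin r) ℂ}
    (hE : IsEigenbasis (U * idKron Y * pinv U) E) :
    ∃ V lam, ∃ K : Fin r → Matrix (Fin r) (Fin r) ℂ, Diagonalizes V Y lam ∧ (∀ b, lam b ≠ 0) ∧
      (∀ b, IsUnit (K b).det) ∧ E = U * idKron V * blockDiagonal K := by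
  obtain ⟨lam, hinj, hrange, hb⟩ := hE
  have hlam : ∀ b, lam b ≠ 0 := fun b => ((hrange _).1 ⟨b, rfl⟩).1
  set z := pinv U * E with hz
  have heig : ∀ a b, (U * idKron Y * pinv U) *ᵥ (fun i => E i (a, b)) =
      lam b • fun i => E i (a, b) := by
    intro a b
    have : (fun i => E i (a, b)) ∈ Module.End.eigenspace (Matrix.toLin' (U * idKron Y * pinv U))
        (lam b) := by
      rw [← (hb b).2]
      exact Submodule.subset_span ⟨a, rfl⟩
    rwa [Module.End.mem_eigenspace_iff, Matrix.toLin'_apply] at this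
  have hzcol : ∀ a b, (fun q => z q (a, b)) = pinv U *ᵥ fun i => E i (a, b) := by
    intro a b; rfl
  have hEz : E = U * z := by
    ext i q
    obtain ⟨a, b⟩ := q
    -- Applying the projection `U * pinv U` to the eigenvalue equation leaves its left side
    -- unchanged; cancelling the non-zero eigenvalue shows that the projection fixes the
    -- eigenvector.
    have h1 := congrArg (fun x => (U * pinv U) *ᵥ x) (heig a b)
    simp only [mulVec_mulVec, mulVec_smul] at h1
    rw [← Matrix.mul_assoc, ← Matrix.mul_assoc, (isPinv_pinv U).aba, heig] at h1
    have h2 := congrFun h1 i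
    simp only [Pi.smul_apply, smul_eq_mul] at h2
    rw [hz, ← Matrix.mul_assoc]
    exact mul_left_cancel₀ (hlam b) h2
  have hzeig : ∀ a' a b, Y *ᵥ (fun c => z (a', c) (a, b)) = lam b • fun c => z (a', c) (a, b) := by
    intro a' a b
    have h1 := congrArg (fun x => pinv U *ᵥ x) (heig a b)
    simp only [mulVec_smul] at h1
    rw [Matrix.mul_assoc, ← mulVec_mulVec, mulVec_mulVec, hU, one_mulVec, ← mulVec_mulVec,
      ← hzcol] at h1
    funext c
    have h2 := congrFun h1 (a', c)
    rwa [one_kronecker_mulVec] at h2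
  have hne : ∀ b, ∃ a' c, z (a', c) (0, b) ≠ 0 := by
    intro b
    by_contra hcon
    push Not at hcon
    apply (hb b).1.ne_zero 0
    funext i
    rw [hEz, Matrix.mul_apply]
    exact Finset.sum_eq_zero fun q _ => by rw [hcon, mul_zero]
  obtain ⟨V, hV⟩ := BlostrMPS.exists_diagonalizes (Y := Y) hinj fun b => by
    obtain ⟨a', c, hc⟩ := hne b
    refine Module.End.hasEigenvalue_of_hasEigenvector (x := fun c => z (a', c) (0, b)) ?_
    refine Module.End.hasEigenvector_iff.2 ⟨?_, fun h => hc (congrFun h c)⟩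
    rw [Module.End.mem_eigenspace_iff, Matrix.toLin'_apply]
    exact hzeig a' 0 b
  set K : Fin r → Matrix (Fin r) (Fin r) ℂ := fun b =>
    Matrix.of fun a' a => (V⁻¹ *ᵥ fun c => z (a', c) (a, b)) b with hK
  have hzVK : z = idKron V * blockDiagonal K := by
    ext q q'
    obtain ⟨a', c⟩ := q
    obtain ⟨a, b⟩ := q'
    rw [one_kronecker_mul_blockDiagonal]
    have h1 : (fun c => z (a', c) (a, b)) = V *ᵥ (V⁻¹ *ᵥ fun c => z (a', c) (a, b)) := by
      rw [mulVec_mulVec, Matrix.mul_nonsing_inv _ hV.isUnit, one_mulVec]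
    have h2 := congrFun h1 c
    rw [mulVec, dotProduct, Finset.sum_eq_single b] at h2
    · exact h2
    · intro e _ he
      rw [hV.coord_eq_zero (hzeig a' a b) fun hc => he (hinj hc), mul_zero]
    · simp
  have hEVK : E = U * idKron V * blockDiagonal K := by rw [hEz, hzVK, Matrix.mul_assoc]
  refine ⟨V, lam, K, hV, hlam, fun b => ?_, hEVK⟩
  rw [isUnit_iff_ne_zero]
  intro hdet
  -- A kernel vector of `K b` would be a linear relation between the basis vectors of the `b`-th
  -- eigenspace.
  obtain ⟨ξ, hξ0, hξ⟩ := Matrix.exists_mulVec_eq_zero_iff.2 hdet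
  apply hξ0
  have h1 := Fintype.linearIndependent_iff.1 (hb b).1 ξ
  funext a
  refine h1 ?_ a
  funext i
  have h2 : ∀ a, E i (a, b) = ∑ q : Fin r × Fin r, U i q * (V q.2 b * K b q.1 a) := by
    intro a
    rw [hEVK, Matrix.mul_assoc, Matrix.mul_apply]
    refine Finset.sum_congr rfl fun q _ => ?_
    obtain ⟨c, e⟩ := q
    rw [one_kronecker_mul_blockDiagonal]
  simp only [Finset.sum_apply, Pi.smul_apply, smul_eq_mul, h2, Pi.zero_apply]
  simp only [Finset.mul_sum]
  rw [Finset.sum_comm]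
  refine Finset.sum_eq_zero fun q _ => ?_
  have h3 := congrFun hξ q.1
  simp only [mulVec, dotProduct, Pi.zero_apply] at h3
  calc _ = U i q * V q.2 b * ∑ a, K b q.1 a * ξ a := by
        rw [Finset.mul_sum]
        exact Finset.sum_congr rfl fun _ _ => by ring
    _ = 0 := by rw [h3, mul_zero]
end Eigen

/-! ### The algorithm in terms of the eigenvectors of the small matrices -/

section PairStep
variable {r m : ℕ} {U : Matrix (Fin m) (Fin r × Fin r) ℂ}
  {V V' : Matrix (Fin r) (Fin r) ℂ} {K K' : Fin r → Matrix (Fin r) (Fin r) ℂ}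

theorem blockDiagonal_inv (hK : ∀ b, IsUnit (K b).det) :
    (blockDiagonal K)⁻¹ = blockDiagonal fun b => (K b)⁻¹ := by
  refine Matrix.inv_eq_left_inv ?_
  rw [← blockDiagonal_mul]
  simp only [fun b => Matrix.nonsing_inv_mul _ (hK b)]
  exact blockDiagonal_one

theorem idKron_inv (hV : IsUnit V.det) : (idKron V)⁻¹ = idKron V⁻¹ := by
  refine Matrix.inv_eq_left_inv ?_
  rw [← mul_kronecker_mul, Matrix.nonsing_inv_mul _ hV, Matrix.one_mul, one_kronecker_one]

/-- The relation `pinv U * U = 1` eliminates the unknown core. What remains are the coordinates of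
the second eigenvectors in the first eigenbasis and the two arbitrary basis changes. -/
theorem blockF_eq (hU : pinv U * U = 1) (hV : IsUnit V.det) (hK : ∀ b, IsUnit (K b).det)
    (b c : Fin r) :
    blockF (U * idKron V * blockDiagonal K) (U * idKron V' * blockDiagonal K') b c =
      (V⁻¹ * V') b c • ((K b)⁻¹ * K' c) := by
  have h1 : pinv (U * idKron V * blockDiagonal K) * (U * idKron V' * blockDiagonal K') =
      blockDiagonal (fun b => (K b)⁻¹) * (idKron (V⁻¹ * V') * blockDiagonal K') := by
    rw [Matrix.mul_assoc U, pinv_mul_right hU (by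
      rw [det_mul]; exact (isUnit_det_one_kronecker hV).mul (isUnit_det_blockDiagonal hK)),
      Matrix.mul_inv_rev, blockDiagonal_inv hK, idKron_inv hV]
    calc _ = blockDiagonal (fun b => (K b)⁻¹) * (idKron V⁻¹ * ((pinv U * U) * (idKron V' *
          blockDiagonal K'))) := by simp only [Matrix.mul_assoc]
      _ = _ := by
        rw [hU, Matrix.one_mul, ← Matrix.mul_assoc (idKron V⁻¹), ← mul_kronecker_mul,
          Matrix.one_mul]
  ext a a'
  rw [blockF, Matrix.of_apply, h1, Matrix.mul_apply, Fintype.sum_prod_type]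
  simp only [one_kronecker_mul_blockDiagonal, blockDiagonal_apply, ite_mul, zero_mul,
    Finset.sum_ite_eq, Finset.mem_univ, if_true, Matrix.smul_apply, smul_eq_mul]
  rw [Matrix.mul_apply (M := (K b)⁻¹), Finset.mul_sum]
  exact Finset.sum_congr rfl fun _ _ => by ring

variable [NeZero r]

/-- `K' 0` cancels in the quotient of two blocks of the same block column. This is the purpose of
the second eigenproblem: it compares the bases of different eigenspaces of the first one. -/
theorem hatK_eq (hU : pinv U * U = 1) (hV : IsUnit V.det) (hK : ∀ b, IsUnit (K b).det)
    (hK' : ∀ b, IsUnit (K' b).det) (hw : ∀ b c, (V⁻¹ * V') b c ≠ 0) (l : Fin r) :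
    hatK (U * idKron V * blockDiagonal K) (U * idKron V' * blockDiagonal K') l =
      ((V⁻¹ * V') 0 0 / (V⁻¹ * V') l 0) • ((K 0)⁻¹ * K l) := by
  rw [hatK]
  split_ifs with h
  · subst h
    rw [div_self (hw 0 0), one_smul, Matrix.nonsing_inv_mul _ (hK 0)]
  · rw [blockF_eq hU hV hK, blockF_eq hU hV hK]
    have h1 : ((V⁻¹ * V') l 0 • ((K l)⁻¹ * K' 0))⁻¹ =
        ((V⁻¹ * V') l 0)⁻¹ • ((K' 0)⁻¹ * K l) := by
      refine Matrix.inv_eq_right_inv ?_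
      rw [Matrix.smul_mul, Matrix.mul_smul, smul_smul, mul_inv_cancel₀ (hw l 0), one_smul,
        Matrix.mul_assoc, ← Matrix.mul_assoc (K' 0), Matrix.mul_nonsing_inv _ (hK' 0),
        Matrix.one_mul, Matrix.nonsing_inv_mul _ (hK l)]
    rw [h1, Matrix.smul_mul, Matrix.mul_smul, smul_smul, Matrix.mul_assoc,
      ← Matrix.mul_assoc (K' 0), Matrix.mul_nonsing_inv _ (hK' 0), Matrix.one_mul, div_eq_mul_inv]

omit [NeZero r] in
theorem isUnit_det_blockF (hU : pinv U * U = 1) (hV : IsUnit V.det) (hK : ∀ b, IsUnit (K b).det)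
    (hK' : ∀ b, IsUnit (K' b).det) (hw : ∀ b c, (V⁻¹ * V') b c ≠ 0) (b c : Fin r) :
    IsUnit (blockF (U * idKron V * blockDiagonal K) (U * idKron V' * blockDiagonal K') b c).det := by
  rw [blockF_eq hU hV hK, det_smul, det_mul]
  exact ((hw b c).isUnit.pow _).mul ((Matrix.isUnit_nonsing_inv_det _ (hK b)).mul (hK' c))

theorem isUnit_det_hatK (hU : pinv U * U = 1) (hV : IsUnit V.det) (hK : ∀ b, IsUnit (K b).det)
    (hK' : ∀ b, IsUnit (K' b).det) (hw : ∀ b c, (V⁻¹ * V') b c ≠ 0) (l : Fin r) :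
    IsUnit (hatK (U * idKron V * blockDiagonal K) (U * idKron V' * blockDiagonal K') l).det := by
  rw [hatK_eq hU hV hK hK' hw, det_smul, det_mul]
  exact ((div_ne_zero (hw 0 0) (hw l 0)).isUnit.pow _).mul
    ((Matrix.isUnit_nonsing_inv_det _ (hK 0)).mul (hK l))

/-- The right gauge factor of the recovered core. -/
noncomputable def rightFactor (V V' : Matrix (Fin r) (Fin r) ℂ) : Matrix (Fin r) (Fin r) ℂ :=
  V * diagonal fun l => (V⁻¹ * V') l 0 / (V⁻¹ * V') 0 0

theorem isUnit_det_rightFactor (hV : IsUnit V.det) (hw : ∀ b c, (V⁻¹ * V') b c ≠ 0) :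
    IsUnit (rightFactor V V').det := by
  rw [rightFactor, det_mul, det_diagonal]
  exact hV.mul (isUnit_iff_ne_zero.2 (Finset.prod_ne_zero_iff.2 fun l _ =>
    div_ne_zero (hw l 0) (hw 0 0)))

/-- Dividing block `l` by `hatK l` turns `K l` into a scalar multiple of `K 0`. With one matrix
common to all blocks the block diagonal matrix is a Kronecker product, and the scalars rescale the
columns of `V`. -/
theorem hatUnfold_eq (hU : pinv U * U = 1) (hV : IsUnit V.det) (hK : ∀ b, IsUnit (K b).det)
    (hK' : ∀ b, IsUnit (K' b).det) (hw : ∀ b c, (V⁻¹ * V') b c ≠ 0) :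
    hatUnfold (U * idKron V * blockDiagonal K) (U * idKron V' * blockDiagonal K') =
      U * (K 0 ⊗ₖ rightFactor V V') := by
  set H := hatK (U * idKron V * blockDiagonal K) (U * idKron V' * blockDiagonal K') with hH
  have hHdet : IsUnit (blockDiagonal H).det :=
    isUnit_det_blockDiagonal (isUnit_det_hatK hU hV hK hK' hw)
  have h1 : (K 0 ⊗ₖ diagonal fun l => (V⁻¹ * V') l 0 / (V⁻¹ * V') 0 0) =
      blockDiagonal fun l => ((V⁻¹ * V') l 0 / (V⁻¹ * V') 0 0) • K 0 := by
    ext ⟨a, b⟩ ⟨c, e⟩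
    simp only [kroneckerMap_apply, diagonal_apply, blockDiagonal_apply, Matrix.smul_apply,
      smul_eq_mul]
    split_ifs
    · ring
    · ring
  have h2 : blockDiagonal K = (K 0 ⊗ₖ diagonal fun l => (V⁻¹ * V') l 0 / (V⁻¹ * V') 0 0) *
      blockDiagonal H := by
    rw [h1, ← blockDiagonal_mul]
    congr 1
    funext l
    rw [hH, hatK_eq hU hV hK hK' hw, Matrix.smul_mul, Matrix.mul_smul, smul_smul,
      ← Matrix.mul_assoc, Matrix.mul_nonsing_inv _ (hK 0), Matrix.one_mul,
      div_mul_div_cancel₀ (hw 0 0), div_self (hw l 0), one_smul]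
  have h3 : (K 0 ⊗ₖ rightFactor V V') = idKron V *
      (K 0 ⊗ₖ diagonal fun l => (V⁻¹ * V') l 0 / (V⁻¹ * V') 0 0) := by
    rw [← mul_kronecker_mul, Matrix.one_mul, rightFactor]
  rw [hatUnfold, ← hH, h3]
  nth_rewrite 1 [h2]
  rw [Matrix.mul_assoc _ _ (blockDiagonal H)⁻¹, Matrix.mul_assoc _ (blockDiagonal H),
    Matrix.mul_nonsing_inv _ hHdet, Matrix.mul_one, Matrix.mul_assoc]

end PairStep

/-! ### The recovered cores as two-sided multiples of the true cores -/

section Recovery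
variable {d : ℕ} [NeZero d] {n : Fin d → ℕ} {r : ℕ}

/-- The unfolding `⟨1⟩` of the `k`-th core. -/
def unfoldOne (Q : Cores n r) (k : Fin d) : Matrix (Fin (n k)) (Fin r × Fin r) ℂ :=
  Matrix.of fun α ab => Q k α ab.1 ab.2

omit [NeZero d] in
theorem unfoldOne_mul_kronecker (Q : Cores n r) (k : Fin d) (A B : Matrix (Fin r) (Fin r) ℂ)
    (α : Fin (n k)) (a b : Fin r) :
    (unfoldOne Q k * (Aᵀ ⊗ₖ B)) α (a, b) = (A * slice Q k α * B) a b := by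
  simp only [Matrix.mul_apply, Fintype.sum_prod_type, unfoldOne, slice, Matrix.of_apply,
    kroneckerMap_apply, transpose_apply, Finset.sum_mul]
  rw [Finset.sum_comm]
  exact Finset.sum_congr rfl fun _ _ => Finset.sum_congr rfl fun _ _ => by ring

omit [NeZero d] in
theorem unfoldSq_mul_kronecker (Q : Cores n r) (k : Fin d) (A B : Matrix (Fin r) (Fin r) ℂ)
    (α : Fin (n k)) (a b : Fin r) :
    (unfoldSq Q k * (B ⊗ₖ Aᵀ)) α (b, a) = (A * slice Q k α * B) a b := by
  simp only [Matrix.mul_apply, Fintype.sum_prod_type, unfoldSq, slice, Matrix.of_apply,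
    kroneckerMap_apply, transpose_apply, Finset.sum_mul]
  exact Finset.sum_congr rfl fun _ _ => Finset.sum_congr rfl fun _ _ => by ring

omit [NeZero d] in
theorem unfoldSq_eq_of_slice {Q Q' : Cores n r} {k : Fin d} {A B : Matrix (Fin r) (Fin r) ℂ}
    (h : ∀ α, slice Q' k α = A * slice Q k α * B) :
    unfoldSq Q' k = unfoldSq Q k * (B ⊗ₖ Aᵀ) := by
  ext α ⟨b, a⟩
  rw [unfoldSq_mul_kronecker, ← h]
  rfl

variable [∀ k, NeZero (n k)] [NeZero r]

omit [NeZero d] [∀ k, NeZero (n k)] in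
theorem slice_hatCore {Q : Cores n r} {E E' : Bases n r} {k : Fin d}
    {A B : Matrix (Fin r) (Fin r) ℂ}
    (h : hatUnfold (E k) (E' k) = unfoldOne Q k * (Aᵀ ⊗ₖ B)) (α : Fin (n k)) :
    slice (hatCore E E') k α = A * slice Q k α * B := by
  ext a b
  rw [← unfoldOne_mul_kronecker, ← h]
  rfl

/-- The pseudoinverse of `Q̂_{j+1}` cancels the unfolding of `Q_{j+1}` inside the probe matrix. Its
left factor `A` thereby reappears inverted on the right of `Q_j`, on the shared bond, which is what
matches neighbouring gauges. -/
theorem slice_tildeCore {Q : Cores n r} {ρ : ThreeBody n} {p : Probes n} {E E' : Bases n r}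
    {j : Fin d} {A B X : Matrix (Fin r) (Fin r) ℂ} (hA : IsUnit A.det) (hB : IsUnit B.det)
    (hU : pinv (unfoldOne Q (j + 1)) * unfoldOne Q (j + 1) = 1)
    (h : hatUnfold (E (j + 1)) (E' (j + 1)) = unfoldOne Q (j + 1) * (Aᵀ ⊗ₖ B))
    (hM : probeMatrix ρ j (j + 1) (p.site (j + 1) 0) (p.vec (j + 1) 0) =
      unfoldOne Q (j + 1) * idKron X * (unfoldSq Q j)ᵀ) (α : Fin (n j)) :
    slice (tildeCore ρ p E E') j α = B⁻¹ * X * slice Q j α * A⁻¹ := by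
  have hdet : IsUnit (Aᵀ ⊗ₖ B).det := by
    rw [det_kronecker, det_transpose]; exact (hA.pow _).mul (hB.pow _)
  have hinv : (Aᵀ ⊗ₖ B)⁻¹ = (A⁻¹)ᵀ ⊗ₖ B⁻¹ := by
    refine Matrix.inv_eq_left_inv ?_
    rw [← mul_kronecker_mul, ← transpose_mul, Matrix.mul_nonsing_inv _ hA,
      Matrix.nonsing_inv_mul _ hB, transpose_one, one_kronecker_one]
  have h1 : pinv (hatUnfold (E (j + 1)) (E' (j + 1))) *
      probeMatrix ρ j (j + 1) (p.site (j + 1) 0) (p.vec (j + 1) 0) =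
      ((A⁻¹)ᵀ ⊗ₖ (B⁻¹ * X)) * (unfoldSq Q j)ᵀ := by
    rw [h, hM, pinv_mul_right hU hdet, hinv]
    calc _ = ((A⁻¹)ᵀ ⊗ₖ B⁻¹) * ((pinv (unfoldOne Q (j + 1)) * unfoldOne Q (j + 1)) *
          (idKron X * (unfoldSq Q j)ᵀ)) := by simp only [Matrix.mul_assoc]
      _ = _ := by
        rw [hU, Matrix.one_mul, ← Matrix.mul_assoc, ← mul_kronecker_mul, Matrix.mul_one]
  have h2 : (((A⁻¹)ᵀ ⊗ₖ (B⁻¹ * X)) * (unfoldSq Q j)ᵀ)ᵀ =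
      unfoldSq Q j * (A⁻¹ ⊗ₖ (B⁻¹ * X)ᵀ) := by
    rw [transpose_mul, transpose_transpose, ← kroneckerMap_transpose, transpose_transpose]
  ext a b
  rw [← unfoldSq_mul_kronecker, ← h2, ← h1]
  rfl

/-- The data of a run of the algorithm: the recovered cores `Q̂`, `Q̃` are `Q` up to invertible
factors. -/
structure RunData (Q : Cores n r) (ρ : ThreeBody n) (p : Probes n) (E E' : Bases n r)
    (A B X : Fin d → Matrix (Fin r) (Fin r) ℂ) : Prop where
  unitA : ∀ k, IsUnit (A k).det
  unitB : ∀ k, IsUnit (B k).det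
  unitX : ∀ k, IsUnit (X k).det
  leftOne : ∀ k, pinv (unfoldOne Q k) * unfoldOne Q k = 1
  leftSq : ∀ k, pinv (unfoldSq Q k) * unfoldSq Q k = 1
  hat : ∀ k, hatUnfold (E k) (E' k) = unfoldOne Q k * ((A k)ᵀ ⊗ₖ B k)
  probe : ∀ j, probeMatrix ρ j (j + 1) (p.site (j + 1) 0) (p.vec (j + 1) 0) =
      unfoldOne Q (j + 1) * idKron (X (j + 1)) * (unfoldSq Q j)ᵀ

variable {Q : Cores n r} {ρ : ThreeBody n} {p : Probes n} {E E' : Bases n r}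
  {A B X : Fin d → Matrix (Fin r) (Fin r) ℂ}

/-- The two unfoldings at `k` differ by Kronecker factors, so the product is a single Kronecker
product and its top-left block is the corner entry of the first factor times the whole second
factor. -/
theorem RunData.matN_eq (h : RunData Q ρ p E E' A B X) (k : Fin d) :
    matN ρ p E E' k = (A (k + 1) * B k) 0 0 • (A k * ((B (k + 1))⁻¹ * X (k + 1))⁻¹)ᵀ := by
  set Y := (B (k + 1))⁻¹ * X (k + 1) with hY
  have hYdet : IsUnit Y.det := by
    rw [hY, det_mul]
    exact (Matrix.isUnit_nonsing_inv_det _ (h.unitB _)).mul (h.unitX _)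
  have hAdet := h.unitA (k + 1)
  have h1 := unfoldSq_eq_of_slice (slice_hatCore (h.hat k))
  have h2 : unfoldSq (tildeCore ρ p E E') k = unfoldSq Q k * ((A (k + 1))⁻¹ ⊗ₖ Yᵀ) :=
    unfoldSq_eq_of_slice (slice_tildeCore hAdet (h.unitB _) (h.leftOne _)
      (h.hat _) (h.probe k))
  have hdet : IsUnit ((A (k + 1))⁻¹ ⊗ₖ Yᵀ).det := by
    rw [det_kronecker, det_transpose]
    exact ((Matrix.isUnit_nonsing_inv_det _ hAdet).pow _).mul (hYdet.pow _)
  have hinv : ((A (k + 1))⁻¹ ⊗ₖ Yᵀ)⁻¹ = A (k + 1) ⊗ₖ (Y⁻¹)ᵀ := by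
    refine Matrix.inv_eq_left_inv ?_
    rw [← mul_kronecker_mul, ← transpose_mul, Matrix.mul_nonsing_inv _ hYdet,
      Matrix.mul_nonsing_inv _ hAdet, transpose_one, one_kronecker_one]
  have h3 : pinv (unfoldSq (tildeCore ρ p E E') k) * unfoldSq (hatCore E E') k =
      (A (k + 1) * B k) ⊗ₖ (A k * Y⁻¹)ᵀ := by
    rw [h1, h2, pinv_mul_right (h.leftSq k) hdet, hinv, Matrix.mul_assoc,
      ← Matrix.mul_assoc (pinv _), h.leftSq k, Matrix.one_mul, ← mul_kronecker_mul, transpose_mul]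
  ext a b
  rw [matN, Matrix.of_apply, h3]
  rfl

theorem RunData.isUnit_det_matN (h : RunData Q ρ p E E' A B X) (k : Fin d)
    (hs : (A (k + 1) * B k) 0 0 ≠ 0) : IsUnit (matN ρ p E E' k).det := by
  rw [h.matN_eq, det_smul, det_transpose, det_mul]
  refine (hs.isUnit.pow _).mul ((h.unitA k).mul (Matrix.isUnit_nonsing_inv_det _ ?_))
  rw [det_mul]
  exact (Matrix.isUnit_nonsing_inv_det _ (h.unitB _)).mul (h.unitX _)

/-- The transpose of `N_k` cancels the left factor of `Q̃_k` and puts `A k` in its place; the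
factors on each bond are then mutually inverse. -/
theorem RunData.slice_output (h : RunData Q ρ p E E' A B X) (hN : GaugeDefined ρ p E E') :
    ∃ σ : Fin d → ℂ, (∀ k, σ k ≠ 0) ∧ ∀ k α,
      slice (output ρ p E E') k α = σ k • (A k * slice Q k α * (A (k + 1))⁻¹) := by
  refine ⟨fun k => ((matN ρ p E E' k)⁻¹).det * (A (k + 1) * B k) 0 0, fun k => ?_, fun k α => ?_⟩
  -- If the corner entry were zero, `N_k` would be the zero matrix, contrary to its invertibility.
  · refine mul_ne_zero (Matrix.isUnit_nonsing_inv_det _ (hN k)).ne_zero fun h0 => ?_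
    have := (hN k).ne_zero
    rw [h.matN_eq, h0, zero_smul, det_zero] at this
    exact this rfl
  · have h1 : slice (output ρ p E E') k α = ((matN ρ p E E' k)⁻¹).det •
        ((matN ρ p E E' k)ᵀ * slice (tildeCore ρ p E E') k α) := rfl
    have hYdet : IsUnit ((B (k + 1))⁻¹ * X (k + 1)).det := by
      rw [det_mul]
      exact (Matrix.isUnit_nonsing_inv_det _ (h.unitB _)).mul (h.unitX _)
    rw [h1, slice_tildeCore (h.unitA _) (h.unitB _) (h.leftOne _) (h.hat _) (h.probe k),
      mul_smul]
    congr 1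
    rw [h.matN_eq, transpose_smul, transpose_transpose, Matrix.smul_mul]
    congr 1
    set Y := (B (k + 1))⁻¹ * X (k + 1)
    calc _ = A k * ((Y⁻¹ * Y) * (slice Q k α * (A (k + 1))⁻¹)) := by simp only [Matrix.mul_assoc]
      _ = _ := by rw [Matrix.nonsing_inv_mul _ hYdet, Matrix.one_mul, Matrix.mul_assoc]

end Recovery

/-! ### Gauge equivalence -/

section Gauge
variable {d : ℕ} [NeZero d] {n : Fin d → ℕ} {r : ℕ}

/-- The gauge is indexed by `ℕ` so that the induction meets no wrap-around; the ring closes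
afterwards, since reduction modulo `d` identifies the last gauge matrix with the one at `0`. -/
theorem prod_ofFn_telescope {R : Type*} [Monoid R] (m : ℕ) (g : Fin m → R) (L : ℕ → Rˣ) :
    (List.ofFn fun i : Fin m => ((L i)⁻¹ : Rˣ).val * g i * (L (i + 1)).val).prod =
      ((L 0)⁻¹ : Rˣ).val * (List.ofFn g).prod * (L m).val := by
  induction m with
  | zero => simp
  | succ m ih =>
    rw [List.ofFn_succ', List.ofFn_succ', List.concat_eq_append, List.concat_eq_append,
      List.prod_append, List.prod_append]
    have := ih fun i => g i.castSucc
    simp only [Fin.val_castSucc, List.prod_singleton, Fin.val_last] at this ⊢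
    rw [this]
    simp only [mul_assoc, Units.mul_inv_cancel_left]

theorem ringTensor_eq_of_gaugeEquiv {Q Q' : Cores n r} (h : GaugeEquiv Q Q') (α : Idx n) :
    ringTensor Q' α = ringTensor Q α := by
  obtain ⟨L, hL⟩ := h
  have h1 := prod_ofFn_telescope d (fun k => slice Q k (α k)) fun i => L (Fin.ofNat d i)
  have h2 : ∀ k : Fin d, Fin.ofNat d k = k := fun k => by
    ext; simp [Fin.ofNat, Nat.mod_eq_of_lt k.isLt]
  have h3 : ∀ k : Fin d, Fin.ofNat d (k + 1) = k + 1 := fun k => by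
    ext; simp [Fin.ofNat, Fin.val_add]
  have h4 : Fin.ofNat d d = 0 := by ext; simp [Fin.ofNat]
  have h5 : Fin.ofNat d 0 = 0 := by ext; simp [Fin.ofNat]
  simp only [h2, h3, h4, h5] at h1
  rw [ringTensor, ringTensor]
  simp only [hL]
  rw [h1, Matrix.trace_mul_comm, ← Matrix.mul_assoc, Units.mul_inv, Matrix.one_mul]

theorem ringTensor_scaleFirst (c : ℂ) (Q : Cores n r) (α : Idx n) :
    ringTensor (scaleFirst c Q) α = c * ringTensor Q α := by
  obtain ⟨D, rfl⟩ := Nat.exists_eq_succ_of_ne_zero (NeZero.ne d)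
  have h0 : slice (scaleFirst c Q) 0 (α 0) = c • slice Q 0 (α 0) := by
    ext a b; simp [slice, scaleFirst]
  have h1 : ∀ i : Fin D, slice (scaleFirst c Q) i.succ (α i.succ) = slice Q i.succ (α i.succ) := by
    intro i; ext a b; simp [slice, scaleFirst, Fin.succ_ne_zero]
  rw [ringTensor, ringTensor, List.ofFn_succ, List.ofFn_succ, List.prod_cons, List.prod_cons]
  simp only [h1]
  rw [h0, Matrix.smul_mul, trace_smul, smul_eq_mul]

/-- Scalars on the cores can be moved to the first core. -/
theorem exists_scaleFirst_gaugeEquiv {Q Q' : Cores n r} {A : Fin d → Matrix (Fin r) (Fin r) ℂ}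
    (hA : ∀ k, IsUnit (A k).det) {σ : Fin d → ℂ} (hσ : ∀ k, σ k ≠ 0)
    (h : ∀ k α, slice Q' k α = σ k • (A k * slice Q k α * (A (k + 1))⁻¹)) :
    ∃ c : ℂ, c ≠ 0 ∧ GaugeEquiv Q (scaleFirst c Q') := by
  -- With gauge matrices `t k • (A k)⁻¹` the scalars must satisfy `t (k + 1) = σ k * t k` for `k ≠
  -- 0`, which holds for the product of `(σ l)⁻¹` over `l ≥ k`. At `0` the value is `1`, the empty
  -- product left after the last site; the mismatch there is the factor `u 0 / σ 0`.
  set u : Fin d → ℂ := fun k => ∏ l ∈ Finset.Ioi k, (σ l)⁻¹ with hu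
  have hu0 : ∀ k, u k ≠ 0 := fun k =>
    Finset.prod_ne_zero_iff.2 fun l _ => inv_ne_zero (hσ l)
  set t : Fin d → ℂ := fun k => if k = 0 then 1 else (σ k)⁻¹ * u k with ht
  have ht0 : ∀ k, t k ≠ 0 := fun k => by
    rw [ht]; dsimp only; split_ifs
    · exact one_ne_zero
    · exact mul_ne_zero (inv_ne_zero (hσ k)) (hu0 k)
  have htu : ∀ k, t (k + 1) = u k := by
    intro k
    have hval : (k + 1 : Fin d).val = (k.val + 1) % d := by
      rw [Fin.val_add]; simp
    rw [ht]; dsimp only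
    split_ifs with h0
    · have h1 : (k.val + 1) % d = 0 := by rw [← hval, h0]; rfl
      have h2 : k.val + 1 = d := by
        have := Nat.le_of_dvd (Nat.succ_pos _) (Nat.dvd_of_mod_eq_zero h1)
        have := k.isLt
        omega
      rw [hu]; dsimp only
      rw [Finset.prod_eq_one]
      intro l hl
      have := Finset.mem_Ioi.1 hl
      have := l.isLt
      omega
    · have h2 : k.val + 1 < d := by
        by_contra hcon
        have h3 : k.val + 1 = d := by have := k.isLt; omega
        apply h0
        ext
        rw [hval, h3]; simp
      have hv : (k + 1 : Fin d).val = k.val + 1 := by rw [hval, Nat.mod_eq_of_lt h2]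
      have h4 : Finset.Ioi k = insert (k + 1) (Finset.Ioi (k + 1)) := by
        ext l
        simp only [Finset.mem_Ioi, Finset.mem_insert, Fin.lt_def, Fin.ext_iff, hv]
        omega
      rw [hu]; dsimp only
      rw [h4, Finset.prod_insert (by simp)]
  set L : Fin d → GL (Fin r) ℂ := fun k =>
    (Units.mk0 (t k) (ht0 k)) • (Matrix.nonsingInvUnit (A k) (hA k))⁻¹ with hL
  refine ⟨u 0 / σ 0, div_ne_zero (hu0 0) (hσ 0), L, fun k α => ?_⟩
  have h1 : slice (scaleFirst (u 0 / σ 0) Q') k α =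
      (if k = 0 then u 0 / σ 0 else 1) • slice Q' k α := by
    ext a b; simp [slice, scaleFirst]
  have h2 : (L (k + 1)).val = u k • (A (k + 1))⁻¹ := by
    rw [← htu]
    simp only [hL, Units.val_smul, Units.smul_def, Units.val_mk0, Matrix.coe_units_inv]
    rfl
  have h3 : ((L k)⁻¹ : GL (Fin r) ℂ).val = (t k)⁻¹ • A k := by
    refine left_inv_eq_right_inv (Units.inv_mul _) ?_
    rw [hL]
    simp only [Units.val_smul, Units.smul_def, Units.val_mk0, Matrix.coe_units_inv]
    rw [Matrix.smul_mul, Matrix.mul_smul, smul_smul, mul_inv_cancel₀ (ht0 k), one_smul]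
    exact Matrix.nonsing_inv_mul _ (hA k)
  rw [h1, h, h2, h3, smul_smul, Matrix.smul_mul, Matrix.mul_smul, Matrix.smul_mul, smul_smul]
  congr 1
  rw [ht]; dsimp only
  split_ifs with h0
  · subst h0
    rw [div_mul_cancel₀ _ (hσ 0), inv_one, mul_one]
  · rw [one_mul, mul_inv, inv_inv, mul_comm (σ k), ← mul_assoc, mul_inv_cancel₀ (hu0 k), one_mul]

omit [NeZero d] in
theorem exists_phase_of_ringTensor {Q Q' : Cores n r} {c : ℂ} (hc : c ≠ 0)
    (h : ∀ α, ringTensor Q' α = c * ringTensor Q α) :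
    ∃ z : ℂ, ‖z‖ = 1 ∧ ∀ α, mpsState Q' α = z * mpsState Q α := by
  have hn : (‖c‖ : ℂ) ≠ 0 := by exact_mod_cast norm_ne_zero_iff.2 hc
  refine ⟨c / ‖c‖, by simp [hc], fun α => ?_⟩
  have h1 : Real.sqrt (∑ β, ‖ringTensor Q' β‖ ^ 2) =
      ‖c‖ * Real.sqrt (∑ β, ‖ringTensor Q β‖ ^ 2) := by
    simp only [h, norm_mul, mul_pow]
    rw [← Finset.mul_sum, Real.sqrt_mul (by positivity), Real.sqrt_sq (norm_nonneg c)]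
  rw [mpsState, mpsState, h1, h α]
  push_cast
  rw [mul_inv]
  field_simp

omit [NeZero d] in
theorem sum_norm_mpsState {Q : Cores n r} {α : Idx n} (h : ringTensor Q α ≠ 0) :
    ∑ β, ‖mpsState Q β‖ ^ 2 = 1 := by
  have hpos : 0 < ∑ β, ‖ringTensor Q β‖ ^ 2 :=
    Finset.sum_pos' (fun _ _ => by positivity) ⟨α, Finset.mem_univ _, by positivity⟩
  simp only [mpsState, norm_mul, mul_pow]
  rw [← Finset.mul_sum, norm_inv, Complex.norm_real, Real.norm_eq_abs,
    abs_of_nonneg (Real.sqrt_nonneg _), inv_pow, Real.sq_sqrt hpos.le, inv_mul_cancel₀ hpos.ne']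

end Gauge

/-! ### The probed marginals of a matrix product state -/

section Probe
variable {d : ℕ} [NeZero d] {n : Fin d → ℕ} {r : ℕ}

/-- All the sites in cyclic order, starting with `k - 1`. -/
def cyclicSites (k : Fin d) : List (Fin d) := (List.finRange d).rotate (k - 1).val

/-- All the sites except `k - 1` and `k`, in cyclic order, starting with `k + 1`. -/
def restSites (k : Fin d) : List (Fin d) := (cyclicSites k).drop 2

theorem cyclicSites_eq (hd : 2 ≤ d) (k : Fin d) : cyclicSites k = (k - 1) :: k :: restSites k := by
  have hlen : (cyclicSites k).length = d := by simp [cyclicSites]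
  have h0 : (cyclicSites k)[0]'(by omega) = k - 1 := by
    ext
    simp [cyclicSites, List.getElem_rotate, Nat.mod_eq_of_lt (k - 1).isLt]
  have h1 : (cyclicSites k)[1]'(by omega) = k := by
    have h2 : k - 1 + 1 = k := sub_add_cancel k 1
    have h3 := congrArg Fin.val h2
    rw [Fin.val_add] at h3
    ext
    simp only [cyclicSites, List.getElem_rotate, List.length_finRange, List.getElem_finRange,
      Fin.val_cast]
    rw [add_comm, ← h3]
    simp
  rw [restSites, ← h0]
  conv_rhs => enter [2, 1]; rw [← h1]
  rw [← List.drop_eq_getElem_cons, ← List.drop_eq_getElem_cons, List.drop_zero]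

theorem cyclicSites_nodup (k : Fin d) : (cyclicSites k).Nodup :=
  List.nodup_rotate.2 (List.nodup_finRange d)

theorem mem_cyclicSites (k l : Fin d) : l ∈ cyclicSites k :=
  List.mem_rotate.2 (List.mem_finRange l)

theorem ne_of_mem_restSites (hd : 2 ≤ d) {k l : Fin d} (h : l ∈ restSites k) :
    l ≠ k - 1 ∧ l ≠ k := by
  have := cyclicSites_nodup k
  rw [cyclicSites_eq hd, List.nodup_cons, List.nodup_cons] at this
  exact ⟨fun e => this.1 (e ▸ List.mem_cons_of_mem _ h), fun e => this.2.1 (e ▸ h)⟩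

/-- The product of the slices at the sites other than `k - 1` and `k`. -/
noncomputable def restProd (Q : Cores n r) (k : Fin d) (α : Idx n) : Matrix (Fin r) (Fin r) ℂ :=
  ((restSites k).map fun l => slice Q l (α l)).prod

theorem restProd_congr (hd : 2 ≤ d) (Q : Cores n r) {k : Fin d} {α β : Idx n}
    (h : ∀ l, l ≠ k - 1 → l ≠ k → α l = β l) : restProd Q k α = restProd Q k β := by
  rw [restProd, restProd]
  congr 1
  refine List.map_congr_left fun l hl => ?_
  rw [h l (ne_of_mem_restSites hd hl).1 (ne_of_mem_restSites hd hl).2]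

theorem ringTensor_eq_trace_cyclic (Q : Cores n r) (k : Fin d) (α : Idx n) :
    ringTensor Q α = ((cyclicSites k).map fun l => slice Q l (α l)).prod.trace := by
  rw [ringTensor, List.ofFn_eq_map, cyclicSites, List.map_rotate, List.rotate_eq_drop_append_take_mod,
    List.prod_append, Matrix.trace_mul_comm, ← List.prod_append, List.take_append_drop]

theorem ringTensor_eq_trace (hd : 2 ≤ d) (Q : Cores n r) (k : Fin d) (α : Idx n) :
    ringTensor Q α =
      (slice Q (k - 1) (α (k - 1)) * slice Q k (α k) * restProd Q k α).trace := by
  rw [ringTensor_eq_trace_cyclic Q k, cyclicSites_eq hd, List.map_cons, List.map_cons,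
    List.prod_cons, List.prod_cons, Matrix.mul_assoc]
  rfl

omit [NeZero d] in
-- The column index of the unfoldings is a pair of bonds: one joins the two sites, the other closes
-- the ring through `X`.
theorem unfold_mul_idKron_mul (Q : Cores n r) (j k : Fin d) (X : Matrix (Fin r) (Fin r) ℂ)
    (x : Fin (n k)) (y : Fin (n j)) :
    (unfoldOne Q k * idKron X * (unfoldSq Q j)ᵀ) x y = (slice Q j y * slice Q k x * X).trace := by
  have h1 : ∀ a c, (unfoldOne Q k * idKron X) x (a, c) = (slice Q k x * X) a c := by
    intro a c
    have := unfoldOne_mul_kronecker Q k 1 X x a c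
    rwa [transpose_one, Matrix.one_mul] at this
  rw [Matrix.mul_assoc (slice Q j y), Matrix.mul_apply, Fintype.sum_prod_type, Matrix.trace, Finset.sum_comm]
  refine Finset.sum_congr rfl fun c _ => ?_
  rw [diag_apply, Matrix.mul_apply]
  refine Finset.sum_congr rfl fun a _ => ?_
  rw [h1, mul_comm]
  rfl

variable [∀ k, NeZero (n k)]

/-- The multi-index with the first index at `k - 1` and `k`, `s` at `h` and `c` elsewhere. -/
def probeIdx (k h : Fin d)
    (c : (l : {l : Fin d // l ∉ ({h, k - 1, k} : Finset (Fin d))}) → Fin (n l))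
    (s : Fin (n h)) : Idx n :=
  glue {h, k - 1, k} (fun l => idx3 (k - 1) k h 0 0 s l) c

/-- The product of the slices off `k - 1` and `k`, contracted with `v` at `h`. -/
noncomputable def restVec (Q : Cores n r) (k h : Fin d) (v : Fin (n h) → ℂ)
    (c : (l : {l : Fin d // l ∉ ({h, k - 1, k} : Finset (Fin d))}) → Fin (n l)) :
    Matrix (Fin r) (Fin r) ℂ :=
  ∑ s, v s • restProd Q k (probeIdx k h c s)

/-- The small matrix of the probe `(h, v)` at the pair `(k - 1, k)`, up to normalization. -/
noncomputable def probeCore (Q : Cores n r) (k h : Fin d) (v : Fin (n h) → ℂ) :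
    Matrix (Fin r) (Fin r) ℂ :=
  ∑ c, conj ((slice Q (k - 1) 0 * slice Q k 0 * restVec Q k h v c).trace) • restVec Q k h v c

/-- The rest of the ring does not see the indices at `k - 1` and `k`, so it may be evaluated with
these frozen at the first index. -/
theorem ringTensor_glue (hd : 3 ≤ d) (Q : Cores n r) {k h : Fin d} (h1 : h ≠ k - 1) (h2 : h ≠ k)
    (c : (l : {l : Fin d // l ∉ ({h, k - 1, k} : Finset (Fin d))}) → Fin (n l))
    (x : Fin (n k)) (y : Fin (n (k - 1))) (s : Fin (n h)) :
    ringTensor Q (glue {h, k - 1, k} (fun l => idx3 (k - 1) k h x y s l) c) =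
      (slice Q (k - 1) y * slice Q k x * restProd Q k (probeIdx k h c s)).trace := by
  have hjk : k - 1 ≠ k := by
    intro e
    have := congrArg Fin.val (sub_eq_self.1 e)
    rw [Fin.val_one', Fin.val_zero, Nat.mod_eq_of_lt (by omega)] at this
    omega
  rw [ringTensor_eq_trace (by omega) Q k]
  have e1 : glue {h, k - 1, k} (fun l => idx3 (k - 1) k h x y s l) c (k - 1) = y := by
    simp [glue, idx3, Function.update_of_ne h1.symm]
  have e2 : glue {h, k - 1, k} (fun l => idx3 (k - 1) k h x y s l) c k = x := by
    simp [glue, idx3, Function.update_of_ne h2.symm, Function.update_of_ne hjk.symm]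
  rw [e1, e2]
  congr 2
  refine restProd_congr (by omega) Q fun l hl1 hl2 => ?_
  rw [probeIdx, glue, glue]
  split_ifs with hl
  · dsimp only [idx3]
    by_cases hlh : l = h
    · subst hlh; simp
    · simp [Function.update_of_ne hlh, Function.update_of_ne hl1, Function.update_of_ne hl2]
  · rfl

/-- The squared norm of the tensor, inverted. -/
noncomputable def normFactor (Q : Cores n r) : ℂ :=
  ((Real.sqrt (∑ β, ‖ringTensor Q β‖ ^ 2) : ℝ) : ℂ)⁻¹ *
    ((Real.sqrt (∑ β, ‖ringTensor Q β‖ ^ 2) : ℝ) : ℂ)⁻¹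

/-- With the column index fixed, `x` and `y` enter only through `slice Q (k - 1) y * slice Q k x`.
The contraction at `h` and the partial trace act on the remaining factor and leave one matrix
independent of `x` and `y`. -/
theorem probeMatrix_eq (hd : 3 ≤ d) (Q : Cores n r) {k h : Fin d} (h1 : h ≠ k - 1) (h2 : h ≠ k)
    (v : Fin (n h) → ℂ) :
    probeMatrix (threeBody (mpsState Q)) (k - 1) k h v =
      unfoldOne Q k * idKron (normFactor Q • probeCore Q k h v) * (unfoldSq Q (k - 1))ᵀ := by
  ext x y
  rw [unfold_mul_idKron_mul, probeMatrix, Matrix.of_apply]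
  set P := slice Q (k - 1) y * slice Q k x with hP
  set P₀ := slice Q (k - 1) 0 * slice Q k 0 with hP₀
  set N := ((Real.sqrt (∑ β, ‖ringTensor Q β‖ ^ 2) : ℝ) : ℂ)⁻¹ with hN
  have hNc : conj N = N := by rw [hN, map_inv₀, Complex.conj_ofReal]
  have hψ : ∀ α, mpsState Q α = N * ringTensor Q α := fun α => rfl
  have hsum : ∀ M : Matrix (Fin r) (Fin r) ℂ, ∀ c, (M * restVec Q k h v c).trace =
      ∑ s, v s * (M * restProd Q k (probeIdx k h c s)).trace := by
    intro M c
    rw [restVec, Matrix.mul_sum, trace_sum]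
    simp only [Matrix.mul_smul, trace_smul, smul_eq_mul]
  have hR : (P * normFactor Q • probeCore Q k h v).trace = N * N * ∑ c,
      conj (∑ t, v t * (P₀ * restProd Q k (probeIdx k h c t)).trace) *
        ∑ s, v s * (P * restProd Q k (probeIdx k h c s)).trace := by
    rw [Matrix.mul_smul, trace_smul, smul_eq_mul, probeCore, Matrix.mul_sum, trace_sum]
    congr 1
    refine Finset.sum_congr rfl fun c _ => ?_
    rw [Matrix.mul_smul, trace_smul, smul_eq_mul, hsum, hsum]
  rw [hR]
  have hL : ∀ s t, threeBody (mpsState Q) {h, k - 1, k} Finset.card_le_three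
      (fun l => idx3 (k - 1) k h x y s l) (fun l => idx3 (k - 1) k h 0 0 t l) =
      ∑ c, N * (P * restProd Q k (probeIdx k h c s)).trace *
        (N * conj (P₀ * restProd Q k (probeIdx k h c t)).trace) := by
    intro s t
    rw [threeBody, marginal, Matrix.of_apply]
    refine Finset.sum_congr rfl fun c _ => ?_
    rw [hψ, hψ, ringTensor_glue hd Q h1 h2, ringTensor_glue hd Q h1 h2, map_mul, hNc]
  simp only [hL, Finset.mul_sum, map_sum, map_mul, Finset.sum_mul]
  rw [Finset.sum_comm]
  simp only [fun t => Finset.sum_comm (s := (Finset.univ : Finset (Fin (n h))))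
    (t := (Finset.univ : Finset ((l : {l : Fin d // l ∉ ({h, k - 1, k} : Finset (Fin d))}) → Fin (n l))))
    (f := fun s c => v s * conj (v t) * (N * (P * restProd Q k (probeIdx k h c s)).trace *
        (N * conj (P₀ * restProd Q k (probeIdx k h c t)).trace)))]
  rw [Finset.sum_comm]
  refine Finset.sum_congr rfl fun c _ => ?_
  rw [Finset.sum_comm]
  exact Finset.sum_congr rfl fun s _ => Finset.sum_congr rfl fun t _ => by ring

/-! ### Analytic dependence on the cores -/

omit [NeZero d] [∀ k, NeZero (n k)] in
theorem analyticMat_slice (k : Fin d) (α : Fin (n k)) :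
    AnalyticMat fun Q : Cores n r => slice Q k α := by
  intro i j
  have h : (fun Q : Cores n r => slice Q k α i j) =
      (ContinuousLinearMap.proj (R := ℝ) (φ := fun _ : Fin r => ℂ) j).comp
        ((ContinuousLinearMap.proj (R := ℝ) (φ := fun _ : Fin r => Fin r → ℂ) i).comp
          ((ContinuousLinearMap.proj (R := ℝ) (φ := fun _ : Fin (n k) => Fin r → Fin r → ℂ) α).comp
            (ContinuousLinearMap.proj (R := ℝ)
              (φ := fun k : Fin d => Fin (n k) → Fin r → Fin r → ℂ) k))) := rfl
  rw [h]
  exact ContinuousLinearMap.analyticOnNhd _ _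

omit [NeZero d] [∀ k, NeZero (n k)] in
theorem analyticMat_unfoldOne (k : Fin d) :
    AnalyticMat fun Q : Cores n r => unfoldOne Q k :=
  fun α ab => analyticMat_slice k α ab.1 ab.2

omit [∀ k, NeZero (n k)] in
theorem analyticMat_restProd (k : Fin d) (α : Idx n) :
    AnalyticMat fun Q : Cores n r => restProd Q k α :=
  AnalyticMat.list_prod _ fun l => analyticMat_slice l (α l)

theorem analyticMat_restVec (k h : Fin d) (v : Fin (n h) → ℂ)
    (c : (l : {l : Fin d // l ∉ ({h, k - 1, k} : Finset (Fin d))}) → Fin (n l)) :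
    AnalyticMat fun Q : Cores n r => restVec Q k h v c :=
  AnalyticMat.sum _ fun _ _ => AnalyticMat.smul analyticOnNhd_const (analyticMat_restProd k _)

/-- The conjugated amplitude makes the dependence on the cores real-analytic and not holomorphic. -/
theorem analyticMat_probeCore (k h : Fin d) (v : Fin (n h) → ℂ) :
    AnalyticMat fun Q : Cores n r => probeCore Q k h v :=
  AnalyticMat.sum _ fun c _ => AnalyticMat.smul
    (analytic_conj (((analyticMat_slice _ _).mul (analyticMat_slice _ _)).mul
      (analyticMat_restVec k h v c)).trace) (analyticMat_restVec k h v c)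

end Probe

/-! ### Polynomial conditions for simple spectra and for eigenvectors in general position -/

section Spectrum
variable {r : ℕ}

/-- The Hankel matrix of the power traces. -/
noncomputable def hankel (A : Matrix (Fin r) (Fin r) ℂ) : Matrix (Fin r) (Fin r) ℂ :=
  Matrix.of fun i j => (A ^ (i.val + j.val)).trace

/-- The words `A ^ j * A' ^ i`, as rows of a square matrix. -/
noncomputable def wordMatrix (A A' : Matrix (Fin r) (Fin r) ℂ) :
    Matrix (Fin r × Fin r) (Fin r × Fin r) ℂ :=
  Matrix.of fun ji ab => (A ^ ji.1.val * A' ^ ji.2.val) ab.1 ab.2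

/-- `r` times the trace-free part. -/
noncomputable def traceFree (A : Matrix (Fin r) (Fin r) ℂ) : Matrix (Fin r) (Fin r) ℂ :=
  (r : ℂ) • A - A.trace • (1 : Matrix (Fin r) (Fin r) ℂ)

/-- If `z` were a multiple root, let `p` be the characteristic polynomial divided by `X - z`. It
divides `p * p`, so `p(A)` squares to zero and every `A ^ i * p(A)` is nilpotent, hence trace-free.
The coefficients of `p` then form a kernel vector of the Hankel matrix, non-zero because `p` is
monic of degree `r - 1`. -/
theorem nodup_roots_charpoly {A : Matrix (Fin r) (Fin r) ℂ} (h : (hankel A).det ≠ 0) :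
    A.charpoly.roots.Nodup := by
  open Polynomial in
  rw [Multiset.nodup_iff_count_le_one]
  intro z
  by_contra hcon
  push Not at hcon
  rw [Polynomial.count_roots] at hcon
  have hmon := A.charpoly_monic
  obtain ⟨q, hq⟩ := (Polynomial.le_rootMultiplicity_iff hmon.ne_zero).1 hcon.nat_succ_le
  have hzmon : (X - C z : ℂ[X]).Monic := monic_X_sub_C z
  have hqmon : q.Monic := (hzmon.pow 2).of_mul_monic_left (hq ▸ hmon)
  set p : ℂ[X] := (X - C z) * q with hp
  have hpmon : p.Monic := hzmon.mul hqmon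
  have hpdeg : p.natDegree + 1 = r := by
    have h1 : A.charpoly = (X - C z) * p := by rw [hq, hp]; ring
    have h2 := A.charpoly_natDegree_eq_dim
    rw [h1, hzmon.natDegree_mul hpmon, natDegree_X_sub_C, Fintype.card_fin] at h2
    omega
  set N := aeval A p with hN
  have hNN : N * N = 0 := by
    have h1 : p * p = A.charpoly * q := by rw [hq, hp]; ring
    rw [hN, ← map_mul, h1, map_mul, Matrix.aeval_self_charpoly, zero_mul]
  have htr : ∀ i : ℕ, (A ^ i * N).trace = 0 := by
    intro i
    have hcomm : Commute (A ^ i) N := by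
      have : A ^ i = aeval A (X ^ i : ℂ[X]) := by simp
      rw [this, hN]
      exact (Commute.all (X ^ i : ℂ[X]) p).map (aeval A)
    have hnil : IsNilpotent (A ^ i * N) :=
      hcomm.isNilpotent_mul_left ⟨2, by rw [pow_two, hNN]⟩
    exact (Matrix.isNilpotent_trace_of_isNilpotent hnil).eq_zero
  have hker : hankel A *ᵥ (fun j => p.coeff j.val) = 0 := by
    funext i
    have h1 := htr i.val
    rw [hN, aeval_eq_sum_range' (n := r) (by omega), Matrix.mul_sum, trace_sum,
      Finset.sum_range] at h1
    rw [mulVec, dotProduct, Pi.zero_apply, ← h1]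
    refine Finset.sum_congr rfl fun j _ => ?_
    rw [Matrix.mul_smul, trace_smul, smul_eq_mul, ← pow_add, mul_comm]
    rfl
  have h0 := Matrix.eq_zero_of_mulVec_eq_zero h hker
  have h1 := congrFun h0 ⟨p.natDegree, by omega⟩
  rw [Pi.zero_apply] at h1
  exact one_ne_zero (hpmon.coeff_natDegree.symm.trans h1)

theorem exists_diagonalizes_of_hankel {A : Matrix (Fin r) (Fin r) ℂ} (h : (hankel A).det ≠ 0) :
    ∃ V lam, Diagonalizes V A lam := by
  have hcard : A.charpoly.roots.toFinset.card = r := by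
    rw [Multiset.toFinset_card_of_nodup (nodup_roots_charpoly h),
      ← (IsAlgClosed.splits A.charpoly).natDegree_eq_card_roots, A.charpoly_natDegree_eq_dim,
      Fintype.card_fin]
  let e := (A.charpoly.roots.toFinset.equivFinOfCardEq hcard).symm
  obtain ⟨V, hV⟩ := exists_diagonalizes (Y := A) (lam := fun b => (e b : ℂ))
    (fun a b hab => e.injective (Subtype.ext hab)) fun b => by
      have h1 := (e b).2
      rw [Multiset.mem_toFinset, Polynomial.mem_roots A.charpoly_monic.ne_zero] at h1
      rw [Module.End.hasEigenvalue_iff_isRoot_charpoly]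
      simpa using h1
  exact ⟨V, _, hV⟩

theorem hankel_smul (c : ℂ) (A : Matrix (Fin r) (Fin r) ℂ) :
    hankel (c • A) = diagonal (fun i : Fin r => c ^ i.val) * hankel A *
      diagonal (fun i : Fin r => c ^ i.val) := by
  ext i j
  rw [Matrix.mul_diagonal, Matrix.diagonal_mul, hankel, hankel, Matrix.of_apply, Matrix.of_apply,
    smul_pow, trace_smul, smul_eq_mul, pow_add]
  ring

/-- Invariance under scaling is what allows the factor `ε` to be dropped from the witnesses, and
likewise in `det_wordMatrix_smul_ne_zero`. -/
theorem det_hankel_smul_ne_zero {c : ℂ} (hc : c ≠ 0) {A : Matrix (Fin r) (Fin r) ℂ}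
    (h : (hankel A).det ≠ 0) : (hankel (c • A)).det ≠ 0 := by
  rw [hankel_smul, det_mul, det_mul, det_diagonal]
  have : ∏ i : Fin r, c ^ i.val ≠ 0 := Finset.prod_ne_zero_iff.2 fun _ _ => pow_ne_zero _ hc
  exact mul_ne_zero (mul_ne_zero this h) this

theorem det_hankel_diagonal_ne_zero {b : Fin r → ℂ} (hb : Function.Injective b) :
    (hankel (diagonal b)).det ≠ 0 := by
  have : hankel (diagonal b) = (vandermonde b)ᵀ * vandermonde b := by
    ext i j
    simp [hankel, Matrix.mul_apply, vandermonde_apply, diagonal_pow, trace, pow_add]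
  rw [this, det_mul, det_transpose]
  exact mul_ne_zero (det_vandermonde_ne_zero_iff.2 hb) (det_vandermonde_ne_zero_iff.2 hb)

theorem det_wordMatrix_smul_ne_zero {c c' : ℂ} (hc : c ≠ 0) (hc' : c' ≠ 0)
    {A A' : Matrix (Fin r) (Fin r) ℂ} (h : (wordMatrix A A').det ≠ 0) :
    (wordMatrix (c • A) (c' • A')).det ≠ 0 := by
  have h1 : wordMatrix (c • A) (c' • A') =
      diagonal (fun ji : Fin r × Fin r => c ^ ji.1.val * c' ^ ji.2.val) * wordMatrix A A' := by
    ext ji ab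
    rw [Matrix.diagonal_mul, wordMatrix, wordMatrix, Matrix.of_apply, Matrix.of_apply, smul_pow,
      smul_pow, Matrix.smul_mul, Matrix.mul_smul, smul_smul, Matrix.smul_apply, smul_eq_mul]
  rw [h1, det_mul, det_diagonal]
  exact mul_ne_zero (Finset.prod_ne_zero_iff.2 fun _ _ =>
    mul_ne_zero (pow_ne_zero _ hc) (pow_ne_zero _ hc')) h

/-- If the words span, no eigenvector of `A'` lies in a sum of eigenspaces of `A`. -/
theorem inv_mul_apply_ne_zero_of_wordMatrix {A A' V V' : Matrix (Fin r) (Fin r) ℂ}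
    {lam lam' : Fin r → ℂ} (h : (wordMatrix A A').det ≠ 0) (hV : Diagonalizes V A lam)
    (hV' : Diagonalizes V' A' lam') (b c : Fin r) : (V⁻¹ * V') b c ≠ 0 := by
  intro hw
  have hleft : ∀ j : ℕ, V⁻¹.row b ᵥ* (A ^ j) = lam b ^ j • V⁻¹.row b := by
    intro j
    induction j with
    | zero => simp
    | succ j ih =>
      have h1 : V⁻¹.row b ᵥ* A = lam b • V⁻¹.row b := by
        funext i
        have := congrFun (congrFun hV.inv_mul b) i
        rw [Matrix.diagonal_mul] at this
        simpa [vecMul, dotProduct, Matrix.mul_apply] using this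
      rw [pow_succ, ← vecMul_vecMul, ih, smul_vecMul, h1, smul_smul, pow_succ]
  have hright : ∀ i : ℕ, (A' ^ i) *ᵥ V'.col c = lam' c ^ i • V'.col c := by
    intro i
    induction i with
    | zero => simp
    | succ i ih =>
      rw [pow_succ, ← mulVec_mulVec, hV'.mulVec_col, mulVec_smul, ih, smul_smul, pow_succ, mul_comm]
  have hdot : V⁻¹.row b ⬝ᵥ V'.col c = 0 := by
    rw [← hw]; rfl
  -- The functional `X ↦ (row b of V⁻¹) X (column c of V')` multiplies by a scalar under `A` on the
  -- left and under `A'` on the right. If it vanishes at `1`, it vanishes on every word, yet it is a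
  -- non-zero functional of rank one.
  have hker : wordMatrix A A' *ᵥ (fun ab => V⁻¹ b ab.1 * V' ab.2 c) = 0 := by
    funext ji
    have h1 : V⁻¹.row b ⬝ᵥ ((A ^ ji.1.val * A' ^ ji.2.val) *ᵥ V'.col c) = 0 := by
      rw [← mulVec_mulVec, hright, mulVec_smul, dotProduct_smul, dotProduct_mulVec, hleft,
        smul_dotProduct, hdot, smul_zero, smul_zero]
    rw [Pi.zero_apply, ← h1]
    simp only [mulVec, dotProduct, Fintype.sum_prod_type, wordMatrix, Matrix.of_apply,
      Finset.mul_sum, row_apply, col_apply]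
    exact Finset.sum_congr rfl fun _ _ => Finset.sum_congr rfl fun _ _ => by ring
  have h0 := Matrix.eq_zero_of_mulVec_eq_zero h hker
  have hrow : ∃ a, V⁻¹ b a ≠ 0 := by
    by_contra hcon
    push Not at hcon
    exact (Matrix.isUnit_nonsing_inv_det _ hV.isUnit).ne_zero (det_eq_zero_of_row_eq_zero b hcon)
  have hcol : ∃ a, V' a c ≠ 0 := by
    by_contra hcon
    push Not at hcon
    exact hV'.isUnit.ne_zero (det_eq_zero_of_column_eq_zero c hcon)
  obtain ⟨a, ha⟩ := hrow
  obtain ⟨a', ha'⟩ := hcol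
  exact mul_ne_zero ha ha' (congrFun h0 (a, a'))

/-- The cyclic shift. -/
def shiftMatrix (r : ℕ) [NeZero r] : Matrix (Fin r) (Fin r) ℂ :=
  Matrix.of fun a c => if c = a + 1 then 1 else 0

theorem shiftMatrix_pow_apply [NeZero r] (i : ℕ) (a c : Fin r) :
    (shiftMatrix r ^ i) a c = if c = a + Fin.ofNat r i then 1 else 0 := by
  induction i generalizing a with
  | zero =>
    simp [Matrix.one_apply, eq_comm]
  | succ i ih =>
    have h1 : Fin.ofNat r (i + 1) = 1 + Fin.ofNat r i := by
      ext; simp [Fin.ofNat, Fin.val_add, add_comm]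
    have hs : ∀ a c, shiftMatrix r a c = if c = a + 1 then 1 else 0 := fun _ _ => rfl
    rw [pow_succ', Matrix.mul_apply]
    simp only [ih, hs, ite_mul, one_mul, zero_mul, Finset.sum_ite_eq',
      Finset.mem_univ, if_true, h1, add_assoc]

/-- Different powers of the shift are supported on different cyclic diagonals. A linear relation
between words therefore splits into one relation per diagonal, where the powers of the distinct `b
a` form a Vandermonde matrix. -/
theorem det_wordMatrix_diagonal_shift_ne_zero [NeZero r] {b : Fin r → ℂ}
    (hb : Function.Injective b) : (wordMatrix (diagonal b) (shiftMatrix r)).det ≠ 0 := by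
  intro h
  obtain ⟨ξ, hξ0, hξ⟩ := Matrix.exists_vecMul_eq_zero_iff.2 h
  apply hξ0
  have h1 : ∀ i : Fin r, (vandermonde b) *ᵥ (fun j => ξ (j, i)) = 0 := by
    intro i
    funext a
    have h2 := congrFun hξ (a, a + i)
    simp only [vecMul, dotProduct, Fintype.sum_prod_type, wordMatrix, Matrix.of_apply,
      diagonal_pow, Matrix.diagonal_mul, shiftMatrix_pow_apply, Pi.zero_apply, Pi.pow_apply] at h2
    have h3 : ∀ k : Fin r, (a + i = a + Fin.ofNat r k.val) ↔ k = i := by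
      intro k
      have : Fin.ofNat r k.val = k := by ext; simp [Fin.ofNat, Nat.mod_eq_of_lt k.isLt]
      rw [this, add_right_inj, eq_comm]
    simp only [h3, mul_ite, mul_one, mul_zero, Finset.sum_ite_eq', Finset.mem_univ, if_true] at h2
    rw [Pi.zero_apply, ← h2, mulVec, dotProduct]
    exact Finset.sum_congr rfl fun _ _ => by rw [vandermonde_apply, mul_comm]
  funext ji
  exact congrFun (Matrix.eq_zero_of_mulVec_eq_zero (det_vandermonde_ne_zero_iff.2 hb) (h1 ji.2)) ji.1

theorem traceFree_smul (c : ℂ) (A : Matrix (Fin r) (Fin r) ℂ) :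
    traceFree (c • A) = c • traceFree A := by
  rw [traceFree, traceFree, trace_smul, smul_sub, smul_smul, smul_smul, smul_smul, smul_eq_mul,
    mul_comm c, mul_comm c]

theorem traceFree_add (A B : Matrix (Fin r) (Fin r) ℂ) :
    traceFree (A + B) = traceFree A + traceFree B := by
  rw [traceFree, traceFree, traceFree, trace_add, smul_add, add_smul]
  abel

theorem traceFree_one : traceFree (1 : Matrix (Fin r) (Fin r) ℂ) = 0 := by
  rw [traceFree, trace_one, Fintype.card_fin, sub_self]

theorem traceFree_diagonal (b : Fin r → ℂ) :
    traceFree (diagonal b) = diagonal fun i => r * b i - ∑ j, b j := by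
  ext i j
  by_cases h : i = j
  · subst h; simp [traceFree, trace]
  · simp [traceFree, h]

theorem traceFree_shiftMatrix [NeZero r] (hr : 2 ≤ r) :
    traceFree (shiftMatrix r) = (r : ℂ) • shiftMatrix r := by
  have : (shiftMatrix r).trace = 0 := by
    refine Finset.sum_eq_zero fun i _ => ?_
    rw [diag_apply, shiftMatrix, Matrix.of_apply, if_neg]
    intro h
    have h1 := congrArg Fin.val (left_eq_add.1 h)
    rw [Fin.val_one', Fin.val_zero, Nat.mod_eq_of_lt (by omega)] at h1
    omega
  rw [traceFree, this, zero_smul, sub_zero]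

/-- An affine change of a matrix keeps its eigenvectors and the distinctness of its eigenvalues, so
spectral conditions may be imposed on trace-free parts. -/
theorem Diagonalizes.traceFree [NeZero r] {V A : Matrix (Fin r) (Fin r) ℂ} {lam : Fin r → ℂ}
    (h : Diagonalizes V A lam) :
    Diagonalizes V (traceFree A) fun b => r * lam b - A.trace := by
  have hr : (r : ℂ) ≠ 0 := Nat.cast_ne_zero.2 (NeZero.ne r)
  refine ⟨h.isUnit, fun a b hab => h.inj (mul_left_cancel₀ hr (sub_left_inj.1 hab)), ?_⟩
  rw [BlostrMPS.traceFree, Matrix.sub_mul, Matrix.smul_mul, h.mul_eq, Matrix.smul_mul,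
    Matrix.one_mul]
  ext i j
  simp only [Matrix.sub_apply, Matrix.smul_apply, Matrix.mul_diagonal, smul_eq_mul]
  ring

theorem Diagonalizes.of_traceFree [NeZero r] {V A : Matrix (Fin r) (Fin r) ℂ} {lam : Fin r → ℂ}
    (h : Diagonalizes V (BlostrMPS.traceFree A) lam) :
    Diagonalizes V A fun b => (lam b + A.trace) / r := by
  have hr : (r : ℂ) ≠ 0 := Nat.cast_ne_zero.2 (NeZero.ne r)
  refine ⟨h.isUnit, fun a b hab => h.inj (add_right_cancel ((div_left_inj' hr).1 hab)), ?_⟩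
  have h1 := h.mul_eq
  rw [BlostrMPS.traceFree, Matrix.sub_mul, Matrix.smul_mul, Matrix.smul_mul, Matrix.one_mul] at h1
  ext i j
  have h2 := congrFun (congrFun h1 i) j
  simp only [Matrix.sub_apply, Matrix.smul_apply, Matrix.mul_diagonal, smul_eq_mul] at h2 ⊢
  rw [← mul_right_inj' hr]
  field_simp
  linear_combination h2

theorem Diagonalizes.smul {V A : Matrix (Fin r) (Fin r) ℂ} {lam : Fin r → ℂ}
    (h : Diagonalizes V A lam) {c : ℂ} (hc : c ≠ 0) :
    Diagonalizes V (c • A) fun b => c * lam b := by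
  refine ⟨h.isUnit, fun a b hab => h.inj (mul_left_cancel₀ hc hab), ?_⟩
  rw [Matrix.smul_mul, h.mul_eq]
  ext i j
  simp only [Matrix.smul_apply, Matrix.mul_diagonal, smul_eq_mul]
  ring

theorem Diagonalizes.ne_zero {V A : Matrix (Fin r) (Fin r) ℂ} {lam : Fin r → ℂ}
    (h : Diagonalizes V A lam) (hA : IsUnit A.det) (b : Fin r) : lam b ≠ 0 := by
  have h1 := congrArg det h.mul_eq
  rw [det_mul, det_mul, det_diagonal, mul_comm V.det] at h1
  have h2 : ∏ b, lam b ≠ 0 := by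
    rw [← mul_right_cancel₀ h.isUnit.ne_zero h1]; exact hA.ne_zero
  exact Finset.prod_ne_zero_iff.1 h2 b (Finset.mem_univ b)

theorem mul_adjugate_eq_smul {X Y : Matrix (Fin r) (Fin r) ℂ} (hY : IsUnit Y.det) :
    X * Y.adjugate = Y.det • (X * Y⁻¹) := by
  rw [Matrix.inv_def, Matrix.mul_smul, smul_smul, Ring.mul_inverse_cancel _ hY, one_smul]

theorem AnalyticMat.hankel {E : Type*} [NormedAddCommGroup E] [NormedSpace ℝ E]
    {A : E → Matrix (Fin r) (Fin r) ℂ} (hA : AnalyticMat A) :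
    AnalyticMat fun x => hankel (A x) :=
  fun i j => (hA.pow (i.val + j.val)).trace

theorem AnalyticMat.wordMatrix {E : Type*} [NormedAddCommGroup E] [NormedSpace ℝ E]
    {A A' : E → Matrix (Fin r) (Fin r) ℂ} (hA : AnalyticMat A) (hA' : AnalyticMat A') :
    AnalyticMat fun x => wordMatrix (A x) (A' x) :=
  fun ji ab => ((hA.pow ji.1.val).mul (hA'.pow ji.2.val)) ab.1 ab.2

theorem AnalyticMat.traceFree {E : Type*} [NormedAddCommGroup E] [NormedSpace ℝ E]
    {A : E → Matrix (Fin r) (Fin r) ℂ} (hA : AnalyticMat A) :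
    AnalyticMat fun x => traceFree (A x) :=
  (AnalyticMat.smul analyticOnNhd_const hA).sub (AnalyticMat.smul hA.trace (AnalyticMat.const 1))

end Spectrum

/-! ### Functionals that separate the probes -/

section Functionals
variable {d : ℕ} {n : Fin d → ℕ}

/-- The bilinear pairing on the direct sum of the local spaces, as a functional. -/
def pairing (g : (l : Fin d) → Fin (n l) → ℂ) : ((l : Fin d) → Fin (n l) → ℂ) →ₗ[ℂ] ℂ where
  toFun w := ∑ l, g l ⬝ᵥ w l
  map_add' w w' := by simp [dotProduct_add, Finset.sum_add_distrib]
  map_smul' c w := by simp [dotProduct_smul, Finset.mul_sum]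

theorem pairing_single (g : (l : Fin d) → Fin (n l) → ℂ) (h : Fin d) (v : Fin (n h) → ℂ) :
    pairing g (Pi.single h v) = g h ⬝ᵥ v := by
  rw [pairing, LinearMap.coe_mk, AddHom.coe_mk, Finset.sum_eq_single h]
  · rw [Pi.single_eq_same]
  · intro l _ hl
    rw [Pi.single_eq_of_ne hl, dotProduct_zero]
  · simp

theorem exists_pairing_eq (S : ((l : Fin d) → Fin (n l) → ℂ) →ₗ[ℂ] ℂ) : ∃ g, S = pairing g := by
  refine ⟨fun l s => S (Pi.single l (Pi.single s 1)), ?_⟩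
  refine LinearMap.pi_ext' fun l => LinearMap.pi_ext' fun s => ?_
  ext
  change S (Pi.single l (Pi.single s 1)) = pairing _ (Pi.single l (Pi.single s 1))
  rw [pairing_single, dotProduct_single, mul_one]

/-- The conjugate of a vector of the direct sum. -/
def conjVec (x : (l : Fin d) → Fin (n l) → ℂ) : (l : Fin d) → Fin (n l) → ℂ :=
  fun l s => conj (x l s)

theorem conjVec_dotProduct_self_ne_zero {x : (l : Fin d) → Fin (n l) → ℂ} {l : Fin d}
    (h : x l ≠ 0) : conjVec x l ⬝ᵥ x l ≠ 0 := by
  have : conjVec x l ⬝ᵥ x l = star (x l) ⬝ᵥ x l := rfl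
  rw [this]
  open ComplexOrder in
  exact fun h0 => h (dotProduct_star_self_eq_zero.1 h0)

theorem pairing_conjVec_self_ne_zero {x : (l : Fin d) → Fin (n l) → ℂ}
    (h : x ≠ 0) : pairing (conjVec x) x ≠ 0 := by
  obtain ⟨l, hl⟩ := Function.ne_iff.1 h
  obtain ⟨s, hs⟩ := Function.ne_iff.1 hl
  have h1 : pairing (conjVec x) x = ((∑ l, ∑ s, ‖x l s‖ ^ 2 : ℝ) : ℂ) := by
    simp only [pairing, LinearMap.coe_mk, AddHom.coe_mk, dotProduct, conjVec]
    push_cast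
    exact Finset.sum_congr rfl fun l _ => Finset.sum_congr rfl fun s _ => by
      rw [mul_comm, Complex.mul_conj']
  rw [h1, Complex.ofReal_ne_zero]
  exact (Finset.sum_pos' (f := fun l => ∑ s, ‖x l s‖ ^ 2) (fun _ _ => Finset.sum_nonneg fun _ _ => sq_nonneg _)
    ⟨l, Finset.mem_univ _, Finset.sum_pos' (f := fun s => ‖x l s‖ ^ 2) (fun _ _ => sq_nonneg _)
      ⟨s, Finset.mem_univ _, pow_pos (norm_pos_iff.2 hs) 2⟩⟩).ne'

theorem pairing_conjVec_comm (x y : (l : Fin d) → Fin (n l) → ℂ) :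
    pairing (conjVec x) y = conj (pairing (conjVec y) x) := by
  simp only [pairing, LinearMap.coe_mk, AddHom.coe_mk, dotProduct, conjVec, map_sum, map_mul,
    Complex.conj_conj]
  exact Finset.sum_congr rfl fun _ _ => Finset.sum_congr rfl fun _ _ => mul_comm _ _

/-- Two different planes meet in at most a line. -/
theorem exists_inf_le_span_singleton {W : Type*} [AddCommGroup W] [Module ℂ W] [FiniteDimensional ℂ W]
    {a b c e : W} (h1 : LinearIndependent ℂ ![a, b]) (h2 : LinearIndependent ℂ ![c, e])
    (hne : Submodule.span ℂ {a, b} ≠ Submodule.span ℂ {c, e}) :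
    ∃ x : W, x ≠ 0 ∧ Submodule.span ℂ {a, b} ⊓ Submodule.span ℂ {c, e} ≤ Submodule.span ℂ {x} := by
  have hr1 : Module.finrank ℂ (Submodule.span ℂ {a, b}) = 2 := by
    have := finrank_span_eq_card h1
    rwa [Matrix.range_cons_cons_empty, Fintype.card_fin] at this
  have hr2 : Module.finrank ℂ (Submodule.span ℂ {c, e}) = 2 := by
    have := finrank_span_eq_card h2
    rwa [Matrix.range_cons_cons_empty, Fintype.card_fin] at this
  set I := Submodule.span ℂ {a, b} ⊓ Submodule.span ℂ {c, e} with hI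
  have hle : Module.finrank ℂ I ≤ 1 := by
    by_contra hcon
    push Not at hcon
    have e1 : I = Submodule.span ℂ {a, b} :=
      Submodule.eq_of_le_of_finrank_le inf_le_left (by omega)
    have e2 : I = Submodule.span ℂ {c, e} :=
      Submodule.eq_of_le_of_finrank_le inf_le_right (by omega)
    exact hne (e1.symm.trans e2)
  obtain ⟨x, hx⟩ := finrank_le_one_iff.1 hle
  by_cases hx0 : (x : W) = 0
  · refine ⟨a, h1.ne_zero 0, fun y hy => ?_⟩
    obtain ⟨t, ht⟩ := hx ⟨y, hy⟩
    have : y = 0 := by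
      have h3 := congrArg Subtype.val ht
      rw [Submodule.coe_smul, hx0, smul_zero] at h3
      exact h3.symm
    rw [this]; exact Submodule.zero_mem _
  · refine ⟨x, hx0, fun y hy => ?_⟩
    obtain ⟨t, ht⟩ := hx ⟨y, hy⟩
    exact Submodule.mem_span_singleton.2 ⟨t, congrArg Subtype.val ht⟩

variable {h : Fin 4 → Fin d} {v : (i : Fin 4) → Fin (n (h i)) → ℂ}

/-- The components of the probes at one site do not span the local space, unless all the probes
are on this site. -/
theorem span_components_ne_top (hn : ∀ l, 4 ≤ n l) {l : Fin d} {i : Fin 4} (hi : h i ≠ l) :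
    Submodule.span ℂ (Set.range fun j => (Pi.single (h j) (v j) : (l : Fin d) → Fin (n l) → ℂ) l) ≠
      ⊤ := by
  set w : Fin 4 → Fin (n l) → ℂ :=
    fun j => (Pi.single (h j) (v j) : (l : Fin d) → Fin (n l) → ℂ) l with hw
  -- A probe on another site has zero component here, so at most three vectors remain in a space of
  -- dimension at least four.
  have h0 : w i = 0 := by rw [hw]; exact Pi.single_eq_of_ne hi.symm _
  have h1 : Submodule.span ℂ (Set.range w) ≤
      Submodule.span ℂ (Set.range fun j : {j // j ≠ i} => w j) := by
    rw [Submodule.span_le]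
    rintro _ ⟨j, rfl⟩
    by_cases hj : j = i
    · rw [hj, h0]; exact Submodule.zero_mem _
    · exact Submodule.subset_span ⟨⟨j, hj⟩, rfl⟩
  intro htop
  have h2 := finrank_range_le_card (R := ℂ) (fun j : {j // j ≠ i} => w j)
  rw [htop, top_le_iff] at h1
  rw [Set.finrank, h1, finrank_top, Module.finrank_fin_fun] at h2
  have h3 : Fintype.card {j : Fin 4 // j ≠ i} = 3 := by
    rw [Fintype.card_subtype_compl, Fintype.card_fin, Fintype.card_subtype_eq]
  have := hn l
  omega

/-- Each condition says that `x` avoids a proper subspace, or follows from such conditions, and a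
complex vector space is not a finite union of proper subspaces. Conjugate symmetry of the pairing
turns conditions antilinear in `x` into linear ones. -/
theorem exists_generic_vector (hn : ∀ l, 4 ≤ n l)
    (h01 : LinearIndependent ℂ ![(Pi.single (h 0) (v 0) : (l : Fin d) → Fin (n l) → ℂ),
      Pi.single (h 1) (v 1)])
    (h23 : LinearIndependent ℂ ![(Pi.single (h 2) (v 2) : (l : Fin d) → Fin (n l) → ℂ),
      Pi.single (h 3) (v 3)])
    {e : (l : Fin d) → Fin (n l) → ℂ} (he : e ≠ 0) :
    ∃ x : (l : Fin d) → Fin (n l) → ℂ, (∀ i, conjVec x (h i) ⬝ᵥ v i ≠ 0) ∧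
      pairing (conjVec x) e ≠ 0 ∧ (∀ l, x l ≠ 0) ∧
      ∀ l i, h i ≠ l → x l ∉ Submodule.span ℂ
        (Set.range fun j => (Pi.single (h j) (v j) : (l : Fin d) → Fin (n l) → ℂ) l) := by
  set w : Fin 4 → (l : Fin d) → Fin (n l) → ℂ := fun i => Pi.single (h i) (v i) with hw
  have hw0 : ∀ i, w i ≠ 0 := by
    intro i
    fin_cases i
    · exact h01.ne_zero 0
    · exact h01.ne_zero 1
    · exact h23.ne_zero 0
    · exact h23.ne_zero 1
  let T : (Fin 4 ⊕ Unit) ⊕ {l : Fin d // ∃ i, h i ≠ l} → Submodule ℂ ((l : Fin d) → Fin (n l) → ℂ) :=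
    Sum.elim (Sum.elim (fun i => LinearMap.ker (pairing (conjVec (w i))))
      fun _ => LinearMap.ker (pairing (conjVec e)))
      fun l => (Submodule.span ℂ (Set.range fun j => w j l)).comap (LinearMap.proj l.1)
  have hker : ∀ y : (l : Fin d) → Fin (n l) → ℂ, y ≠ 0 →
      LinearMap.ker (pairing (conjVec y)) ≠ ⊤ := by
    intro y hy htop
    have : y ∈ LinearMap.ker (pairing (conjVec y)) := htop ▸ Submodule.mem_top
    exact pairing_conjVec_self_ne_zero hy this
  have hT : ∀ t, T t ≠ ⊤ := by
    rintro ((i | u) | ⟨l, i, hi⟩)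
    · exact hker _ (hw0 i)
    · exact hker _ he
    · intro htop
      apply span_components_ne_top (v := v) hn hi
      rw [eq_top_iff]
      intro y _
      have : (Pi.single l y : (l : Fin d) → Fin (n l) → ℂ) ∈ T (Sum.inr ⟨l, i, hi⟩) :=
        htop ▸ Submodule.mem_top
      have h1 := Submodule.mem_comap.1 this
      rwa [LinearMap.proj_apply, Pi.single_eq_same] at h1
  have hex : ∃ x, ∀ t, x ∉ T t := by
    by_contra hcon
    push Not at hcon
    obtain ⟨t, ht⟩ := Subspace.exists_eq_top_of_iUnion_eq_univ (k := ℂ) (p := T)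
      (Set.eq_univ_of_forall fun x => Set.mem_iUnion.2 (hcon x))
    exact hT t ht
  obtain ⟨x, hx⟩ := hex
  have hxw : ∀ i, conjVec x (h i) ⬝ᵥ v i ≠ 0 := by
    intro i h0
    rw [← pairing_single, pairing_conjVec_comm, map_eq_zero] at h0
    exact hx (Sum.inl (Sum.inl i)) h0
  have hxl : ∀ l i, h i ≠ l → x l ∉ Submodule.span ℂ (Set.range fun j => w j l) :=
    fun l i hi hmem => hx (Sum.inr ⟨l, i, hi⟩) hmem
  refine ⟨x, hxw, ?_, fun l h0 => ?_, hxl⟩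
  · intro h0
    rw [pairing_conjVec_comm, map_eq_zero] at h0
    exact hx (Sum.inl (Sum.inr ())) h0
  · by_cases hl : ∃ i, h i ≠ l
    · obtain ⟨i, hi⟩ := hl
      exact hxl l i hi (h0 ▸ Submodule.zero_mem _)
    · push Not at hl
      apply hxw 0
      have h1 : conjVec x (h 0) = 0 := by
        funext s
        have : x (h 0) = 0 := by rw [hl 0]; exact h0
        simp [conjVec, this]
      rw [h1, zero_dotProduct]

/-- Local functionals `f` and `g` for which the probes have prescribed differences of `g / f`,
with `g` orthogonal to `f` at every site. -/
theorem exists_separating_functionals (hn : ∀ l, 4 ≤ n l)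
    (h01 : LinearIndependent ℂ ![(Pi.single (h 0) (v 0) : (l : Fin d) → Fin (n l) → ℂ),
      Pi.single (h 1) (v 1)])
    (h23 : LinearIndependent ℂ ![(Pi.single (h 2) (v 2) : (l : Fin d) → Fin (n l) → ℂ),
      Pi.single (h 3) (v 3)])
    (hne : Submodule.span ℂ {(Pi.single (h 0) (v 0) : (l : Fin d) → Fin (n l) → ℂ),
      Pi.single (h 1) (v 1)} ≠ Submodule.span ℂ {(Pi.single (h 2) (v 2) :
        (l : Fin d) → Fin (n l) → ℂ), Pi.single (h 3) (v 3)}) :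
    ∃ f : (l : Fin d) → Fin (n l) → ℂ, (∀ i, f (h i) ⬝ᵥ v i ≠ 0) ∧ (∀ l, f l ≠ 0) ∧
      ∀ a b : ℂ, ∃ g : (l : Fin d) → Fin (n l) → ℂ, (∀ l, g l ⬝ᵥ conjVec f l = 0) ∧
        g (h 0) ⬝ᵥ v 0 / f (h 0) ⬝ᵥ v 0 - g (h 1) ⬝ᵥ v 1 / f (h 1) ⬝ᵥ v 1 = a ∧
        g (h 2) ⬝ᵥ v 2 / f (h 2) ⬝ᵥ v 2 - g (h 3) ⬝ᵥ v 3 / f (h 3) ⬝ᵥ v 3 = b := by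
  -- The line through `e` contains the intersection of the two probe planes. Requiring `x` to pair
  -- non-trivially with `e` lets the functional `f` detect vectors of this intersection.
  obtain ⟨e, he0, heI⟩ := exists_inf_le_span_singleton h01 h23 hne
  obtain ⟨x, hxv, hxe, hx0, hxV⟩ := exists_generic_vector hn h01 h23 he0
  set w : Fin 4 → (l : Fin d) → Fin (n l) → ℂ := fun i => Pi.single (h i) (v i) with hw
  set f := conjVec x with hf
  set N : Fin d → ℂ := fun l => f l ⬝ᵥ x l with hN
  have hN0 : ∀ l, N l ≠ 0 := fun l => conjVec_dotProduct_self_ne_zero (hx0 l)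
  set φ : Fin 4 → ℂ := fun i => f (h i) ⬝ᵥ v i with hφ
  have hφ0 : ∀ i, φ i ≠ 0 := hxv
  have hfw : ∀ i, pairing f (w i) = φ i := fun i => pairing_single _ _ _
  -- Projecting any `g'` off `f` at each site gives a `g` whose ratio `g / f` at the probe `i` is
  -- `g'` paired with `ŵ i`. The prescribed differences are thus attainable as soon as `ŵ 0 - ŵ 1`
  -- and `ŵ 2 - ŵ 3` are independent.
  set z : Fin 4 → (l : Fin d) → Fin (n l) → ℂ :=
    fun i => Pi.single (h i) ((N (h i))⁻¹ • x (h i)) with hz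
  set ŵ : Fin 4 → (l : Fin d) → Fin (n l) → ℂ := fun i => (φ i)⁻¹ • w i - z i with hŵ
  have hxf : ∀ l, conjVec f l = x l := fun l => by funext s; simp [hf, conjVec]
  have hind : ∀ α β : ℂ, α • (ŵ 0 - ŵ 1) + β • (ŵ 2 - ŵ 3) = 0 → α = 0 ∧ β = 0 := by
    intro α β hrel
    set y := α • ((φ 0)⁻¹ • w 0 - (φ 1)⁻¹ • w 1) + β • ((φ 2)⁻¹ • w 2 - (φ 3)⁻¹ • w 3) with hy
    have hyz : y = α • (z 0 - z 1) + β • (z 2 - z 3) := by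
      rw [← sub_eq_zero, ← hrel, hy]
      simp only [hŵ]
      module
    -- If all probes share a site, the `z i` coincide and cancel. Otherwise, at each site, `y l` is
    -- a multiple of `x l` lying in the span of the probe components, which `x l` avoids.
    have hy0 : y = 0 := by
      by_cases hall : ∃ l, ∀ i, h i = l
      · obtain ⟨l, hl⟩ := hall
        have hzz : ∀ i, z i = Pi.single l ((N l)⁻¹ • x l) := by
          intro i
          rw [hz]; dsimp only
          rw [hl i]
        rw [hyz, hzz, hzz, hzz, hzz]
        simp
      · push Not at hall
        funext l
        obtain ⟨i, hi⟩ := hall l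
        have hV := hxV l i hi
        have hzl : ∀ j, ∃ c : ℂ, z j l = c • x l := by
          intro j
          by_cases hj : h j = l
          · subst hj
            exact ⟨(N (h j))⁻¹, by rw [hz]; exact Pi.single_eq_same _ _⟩
          · exact ⟨0, by rw [zero_smul, hz]; exact Pi.single_eq_of_ne (Ne.symm hj) _⟩
        choose c hc using hzl
        have hyl : y l = (α * (c 0 - c 1) + β * (c 2 - c 3)) • x l := by
          rw [hyz]
          simp only [Pi.add_apply, Pi.smul_apply, Pi.sub_apply, hc]
          module
        have hmem : y l ∈ Submodule.span ℂ (Set.range fun j => w j l) := by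
          have hsub : ∀ j, w j l ∈ Submodule.span ℂ (Set.range fun j => w j l) :=
            fun j => Submodule.subset_span ⟨j, rfl⟩
          rw [hy]
          simp only [Pi.add_apply, Pi.smul_apply, Pi.sub_apply]
          exact Submodule.add_mem _
            (Submodule.smul_mem _ _ (Submodule.sub_mem _ (Submodule.smul_mem _ _ (hsub 0))
              (Submodule.smul_mem _ _ (hsub 1))))
            (Submodule.smul_mem _ _ (Submodule.sub_mem _ (Submodule.smul_mem _ _ (hsub 2))
              (Submodule.smul_mem _ _ (hsub 3))))
        by_contra hne0
        rw [hyl] at hmem hne0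
        refine hV ((Submodule.smul_mem_iff _ ?_).1 hmem)
        intro h0
        rw [h0, zero_smul] at hne0
        exact hne0 rfl
    set y₁ := α • ((φ 0)⁻¹ • w 0 - (φ 1)⁻¹ • w 1) with hy₁
    set y₂ := β • ((φ 2)⁻¹ • w 2 - (φ 3)⁻¹ • w 3) with hy₂
    have hm1 : y₁ ∈ Submodule.span ℂ {w 0, w 1} :=
      Submodule.smul_mem _ _ (Submodule.sub_mem _
        (Submodule.smul_mem _ _ (Submodule.subset_span (by simp)))
        (Submodule.smul_mem _ _ (Submodule.subset_span (by simp))))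
    have hm2 : y₂ ∈ Submodule.span ℂ {w 2, w 3} :=
      Submodule.smul_mem _ _ (Submodule.sub_mem _
        (Submodule.smul_mem _ _ (Submodule.subset_span (by simp)))
        (Submodule.smul_mem _ _ (Submodule.subset_span (by simp))))
    have h12 : y₁ = -y₂ := eq_neg_of_add_eq_zero_left hy0
    -- `y₁` lies in both planes, hence is a multiple of `e`; `f` kills `y₁` by the normalization of
    -- the probes but does not kill `e`.
    have hy₁0 : y₁ = 0 := by
      have hmem := heI ⟨hm1, h12 ▸ Submodule.neg_mem _ hm2⟩
      obtain ⟨c, hc⟩ := Submodule.mem_span_singleton.1 hmem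
      have h1 : pairing f y₁ = 0 := by
        rw [hy₁, map_smul, map_sub, map_smul, map_smul, hfw, hfw, smul_eq_mul, smul_eq_mul, smul_eq_mul,
          inv_mul_cancel₀ (hφ0 0), inv_mul_cancel₀ (hφ0 1), sub_self, mul_zero]
      rw [← hc, map_smul, smul_eq_mul] at h1
      rw [← hc, (mul_eq_zero.1 h1).resolve_right hxe, zero_smul]
    have hy₂0 : y₂ = 0 := by rw [hy₁0] at h12; exact neg_eq_zero.1 h12.symm
    constructor
    · have := LinearIndependent.pair_iff.1 h01 (α * (φ 0)⁻¹) (-(α * (φ 1)⁻¹)) (by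
        rw [← hy₁0, hy₁]; module)
      exact (mul_eq_zero.1 this.1).resolve_right (inv_ne_zero (hφ0 0))
    · have := LinearIndependent.pair_iff.1 h23 (β * (φ 2)⁻¹) (-(β * (φ 3)⁻¹)) (by
        rw [← hy₂0, hy₂]; module)
      exact (mul_eq_zero.1 this.1).resolve_right (inv_ne_zero (hφ0 2))
  refine ⟨f, hxv, fun l h0 => hN0 l (by rw [hN]; dsimp only; rw [h0, zero_dotProduct]), ?_⟩
  intro a b
  have hli : LinearIndependent ℂ ![ŵ 0 - ŵ 1, ŵ 2 - ŵ 3] := LinearIndependent.pair_iff.2 hind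
  obtain ⟨S, hS⟩ := LinearMap.exists_leftInverse_of_injective
    (Fintype.linearCombination ℂ ![ŵ 0 - ŵ 1, ŵ 2 - ŵ 3])
    (LinearMap.ker_eq_bot.2 (linearIndependent_iff_injective_fintypeLinearCombination.1 hli))
  have hS0 : S (ŵ 0 - ŵ 1) = ![1, 0] := by
    have := LinearMap.congr_fun hS ![1, 0]
    simpa [Fintype.linearCombination_apply] using this
  have hS1 : S (ŵ 2 - ŵ 3) = ![0, 1] := by
    have := LinearMap.congr_fun hS ![0, 1]
    simpa [Fintype.linearCombination_apply] using this
  obtain ⟨g', hg'⟩ := exists_pairing_eq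
    (a • (LinearMap.proj 0).comp S + b • (LinearMap.proj 1).comp S)
  have hga : pairing g' (ŵ 0 - ŵ 1) = a := by
    rw [← hg']; simp [hS0]
  have hgb : pairing g' (ŵ 2 - ŵ 3) = b := by
    rw [← hg']; simp [hS1]
  refine ⟨fun l => g' l - (g' l ⬝ᵥ x l / N l) • f l, fun l => ?_, ?_⟩
  · rw [hxf, sub_dotProduct, smul_dotProduct, smul_eq_mul, div_mul_cancel₀ _ (hN0 l), sub_self]
  · have hval : ∀ i, (g' (h i) - (g' (h i) ⬝ᵥ x (h i) / N (h i)) • f (h i)) ⬝ᵥ v i /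
        f (h i) ⬝ᵥ v i = pairing g' (ŵ i) := by
      intro i
      have h1 : pairing g' (ŵ i) = (φ i)⁻¹ * (g' (h i) ⬝ᵥ v i) -
          (N (h i))⁻¹ * (g' (h i) ⬝ᵥ x (h i)) := by
        rw [hŵ]; dsimp only
        rw [map_sub, map_smul, hw, hz]; dsimp only
        rw [pairing_single, pairing_single, dotProduct_smul, smul_eq_mul, smul_eq_mul]
      rw [h1, sub_dotProduct, smul_dotProduct, smul_eq_mul]
      have := hφ0 i
      have h2 : f (h i) ⬝ᵥ v i = φ i := rfl
      have := hN0 (h i)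
      rw [h2]
      field_simp
    rw [hval, hval, hval, hval, ← map_sub, ← map_sub]
    exact ⟨hga, hgb⟩

end Functionals

/-! ### First-order expansions around scalar matrices -/

section Expansion
variable {r : ℕ}

/-- `R ε` is a scalar matrix plus `ε` times a matrix, continuously in `ε`; at `ε = 0` the scalar
is `x₀` and the matrix is `G`. -/
def Expands (R : ℂ → Matrix (Fin r) (Fin r) ℂ) (x₀ : ℂ) (G : Matrix (Fin r) (Fin r) ℂ) : Prop :=
  ∃ (x : ℂ → ℂ) (Y : ℂ → Matrix (Fin r) (Fin r) ℂ), Continuous x ∧ Continuous Y ∧ x 0 = x₀ ∧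
    Y 0 = G ∧ ∀ ε, R ε = x ε • (1 : Matrix (Fin r) (Fin r) ℂ) + ε • Y ε

theorem Expands.congr {R R' : ℂ → Matrix (Fin r) (Fin r) ℂ} {x₀ x₀' : ℂ}
    {G G' : Matrix (Fin r) (Fin r) ℂ} (h : Expands R x₀ G) (hR : ∀ ε, R' ε = R ε) (hx : x₀' = x₀)
    (hG : G' = G) : Expands R' x₀' G' := by
  rw [funext hR, hx, hG]; exact h

theorem Expands.continuous {R : ℂ → Matrix (Fin r) (Fin r) ℂ} {x₀ : ℂ}
    {G : Matrix (Fin r) (Fin r) ℂ} (h : Expands R x₀ G) : Continuous R := by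
  obtain ⟨x, Y, hx, hY, -, -, hR⟩ := h
  rw [funext hR]
  fun_prop

theorem Expands.apply_zero {R : ℂ → Matrix (Fin r) (Fin r) ℂ} {x₀ : ℂ}
    {G : Matrix (Fin r) (Fin r) ℂ} (h : Expands R x₀ G) : R 0 = x₀ • 1 := by
  obtain ⟨x, Y, -, -, hx0, -, hR⟩ := h
  rw [hR, hx0, zero_smul, add_zero]

theorem Expands.one : Expands (fun _ => (1 : Matrix (Fin r) (Fin r) ℂ)) 1 0 :=
  ⟨fun _ => 1, fun _ => 0, continuous_const, continuous_const, rfl, rfl, fun ε => by simp⟩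

theorem Expands.affine (x₀ : ℂ) (G : Matrix (Fin r) (Fin r) ℂ) :
    Expands (fun ε => x₀ • (1 : Matrix (Fin r) (Fin r) ℂ) + ε • G) x₀ G :=
  ⟨fun _ => x₀, fun _ => G, continuous_const, continuous_const, rfl, rfl, fun _ => rfl⟩

theorem Expands.mul {R R' : ℂ → Matrix (Fin r) (Fin r) ℂ} {x₀ x₀' : ℂ}
    {G G' : Matrix (Fin r) (Fin r) ℂ} (h : Expands R x₀ G) (h' : Expands R' x₀' G') :
    Expands (fun ε => R ε * R' ε) (x₀ * x₀') (x₀ • G' + x₀' • G) := by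
  obtain ⟨x, Y, hx, hY, rfl, rfl, hR⟩ := h
  obtain ⟨x', Y', hx', hY', rfl, rfl, hR'⟩ := h'
  refine ⟨fun ε => x ε * x' ε, fun ε => x ε • Y' ε + x' ε • Y ε + ε • (Y ε * Y' ε), by fun_prop,
    by fun_prop, rfl, by simp, fun ε => ?_⟩
  dsimp only
  rw [hR, hR']
  simp only [Matrix.add_mul, Matrix.mul_add, Matrix.smul_mul, Matrix.mul_smul, Matrix.one_mul,
    Matrix.mul_one]
  module

/-- Continuity of `φ` is enough, since its variation only changes the scalar part. This admits
conjugated traces, which are not complex differentiable. -/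
theorem Expands.smul {φ : ℂ → ℂ} (hφ : Continuous φ) {R : ℂ → Matrix (Fin r) (Fin r) ℂ} {x₀ : ℂ}
    {G : Matrix (Fin r) (Fin r) ℂ} (h : Expands R x₀ G) :
    Expands (fun ε => φ ε • R ε) (φ 0 * x₀) (φ 0 • G) := by
  obtain ⟨x, Y, hx, hY, rfl, rfl, hR⟩ := h
  refine ⟨fun ε => φ ε * x ε, fun ε => φ ε • Y ε, by fun_prop, by fun_prop, rfl, rfl, fun ε => ?_⟩
  dsimp only
  rw [hR]
  module

theorem Expands.sum {ι : Type*} [Fintype ι] {R : ι → ℂ → Matrix (Fin r) (Fin r) ℂ} {x₀ : ι → ℂ}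
    {G : ι → Matrix (Fin r) (Fin r) ℂ} (h : ∀ i, Expands (R i) (x₀ i) (G i)) :
    Expands (fun ε => ∑ i, R i ε) (∑ i, x₀ i) (∑ i, G i) := by
  choose x Y hx hY hx0 hY0 hR using h
  refine ⟨fun ε => ∑ i, x i ε, fun ε => ∑ i, Y i ε, by fun_prop, by fun_prop, by simp [hx0],
    by simp [hY0], fun ε => ?_⟩
  simp only [hR, Finset.sum_add_distrib, Finset.sum_smul, Finset.smul_sum]

/-- The directional derivative of a product of scalars. -/
def prodDeriv {ι : Type*} [DecidableEq ι] (T : Finset ι) (a b : ι → ℂ) : ℂ :=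
  ∑ l ∈ T, ∏ l' ∈ T, if l' = l then b l' else a l'

theorem prodDeriv_insert {ι : Type*} [DecidableEq ι] {T : Finset ι} {i : ι} (hi : i ∉ T)
    (a b : ι → ℂ) :
    prodDeriv (insert i T) a b = b i * ∏ l ∈ T, a l + a i * prodDeriv T a b := by
  rw [prodDeriv, Finset.sum_insert hi, Finset.prod_insert hi, if_pos rfl, prodDeriv, Finset.mul_sum]
  congr 1
  · congr 1
    refine Finset.prod_congr rfl fun l hl => ?_
    rw [if_neg (ne_of_mem_of_not_mem hl hi)]
  · refine Finset.sum_congr rfl fun l hl => ?_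
    rw [Finset.prod_insert hi, if_neg (ne_of_mem_of_not_mem hl hi).symm]

/-- This is the Leibniz rule around scalars. The scalars commute with everything, so the order of
the factors is invisible to first order and products over finite sets suffice. -/
theorem Expands.list_prod {ι : Type*} [DecidableEq ι] (a b c : ι → ℂ)
    (B C : Matrix (Fin r) (Fin r) ℂ) {L : List ι} (hL : L.Nodup) :
    Expands (fun ε => (L.map fun l => a l • (1 : Matrix (Fin r) (Fin r) ℂ) +
        ε • (b l • B + c l • C)).prod) (∏ l ∈ L.toFinset, a l)
      (prodDeriv L.toFinset a b • B + prodDeriv L.toFinset a c • C) := by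
  induction L with
  | nil => simpa [prodDeriv] using Expands.one
  | cons i L ih =>
    rw [List.nodup_cons] at hL
    have hi : i ∉ L.toFinset := fun h => hL.1 (List.mem_toFinset.1 h)
    simp only [List.map_cons, List.prod_cons, List.toFinset_cons]
    rw [Finset.prod_insert hi, prodDeriv_insert hi, prodDeriv_insert hi]
    refine ((Expands.affine (a i) (b i • B + c i • C)).mul (ih hL.2)).congr (fun _ => rfl) rfl ?_
    module

-- To first order `R * R'⁻¹` is a scalar matrix plus a multiple of `ε • (G - G')`, and the adjugate
-- changes this by a determinant. The trace-free part kills the scalar, so `ε` can be factored out.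
open Filter Topology in
theorem Expands.traceFree_mul_adjugate {R R' : ℂ → Matrix (Fin r) (Fin r) ℂ} {x₀ x₀' : ℂ}
    {G G' : Matrix (Fin r) (Fin r) ℂ} (h : Expands R x₀ (x₀ • G)) (h' : Expands R' x₀' (x₀' • G'))
    (hx : x₀ ≠ 0) (hx' : x₀' ≠ 0) :
    ∃ (κ : ℂ) (Z : ℂ → Matrix (Fin r) (Fin r) ℂ), κ ≠ 0 ∧ ContinuousAt Z 0 ∧
      Z 0 = κ • traceFree (G - G') ∧
      ∀ᶠ ε in 𝓝 0, traceFree (R ε * (R' ε).adjugate) = ε • Z ε := by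
  have hR'c := h'.continuous
  have hR'0 := h'.apply_zero
  obtain ⟨x, Y, hxc, hYc, rfl, hY0, hR⟩ := h
  obtain ⟨x', Y', hxc', hYc', rfl, hY0', hR'⟩ := h'
  -- `δ` and `W` come from solving `adj(R') * (x' • 1 + ε • Y') = det R' • 1` for the adjugate.
  set δ : ℂ → ℂ := fun ε => (R' ε).det * (x' ε)⁻¹ with hδ
  set W : ℂ → Matrix (Fin r) (Fin r) ℂ := fun ε => -((x' ε)⁻¹ • ((R' ε).adjugate * Y' ε)) with hW
  have hinv : ContinuousAt (fun ε => (x' ε)⁻¹) 0 := hxc'.continuousAt.inv₀ hx'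
  have hδc : ContinuousAt δ 0 := (hR'c.matrix_det.continuousAt).mul hinv
  have hWc : ContinuousAt W 0 :=
    (hinv.smul (hR'c.matrix_adjugate.matrix_mul hYc').continuousAt).neg
  have hadj : ∀ ε, x' ε ≠ 0 → (R' ε).adjugate = δ ε • 1 + ε • W ε := by
    intro ε hε
    have h1 : (R' ε).adjugate * R' ε = (R' ε).det • 1 := Matrix.adjugate_mul _
    have h2 : (R' ε).adjugate * R' ε = x' ε • (R' ε).adjugate + ε • ((R' ε).adjugate * Y' ε) := by
      nth_rewrite 2 [hR']
      rw [Matrix.mul_add, Matrix.mul_smul, Matrix.mul_smul, Matrix.mul_one]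
    have h3 : x' ε • (R' ε).adjugate = (R' ε).det • 1 - ε • ((R' ε).adjugate * Y' ε) := by
      rw [← h1, h2]; abel
    have h4 : (R' ε).adjugate = (x' ε)⁻¹ • (x' ε • (R' ε).adjugate) := by
      rw [smul_smul, inv_mul_cancel₀ hε, one_smul]
    rw [h4, h3]
    simp only [hδ, hW]
    module
  have hdet0 : (R' 0).det ≠ 0 := by
    rw [hR'0, det_smul, det_one, mul_one]
    exact pow_ne_zero _ hx'
  have hδ0 : δ 0 ≠ 0 := mul_ne_zero hdet0 (inv_ne_zero hx')
  have htfc : Continuous fun A : Matrix (Fin r) (Fin r) ℂ => traceFree A := by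
    unfold traceFree; fun_prop
  refine ⟨δ 0 * x 0, fun ε => traceFree (x ε • W ε + δ ε • Y ε + ε • (Y ε * W ε)),
    mul_ne_zero hδ0 hx, ?_, ?_, ?_⟩
  · refine htfc.continuousAt.comp (f := fun ε => x ε • W ε + δ ε • Y ε + ε • (Y ε * W ε)) ?_
    exact ((hxc.continuousAt.smul hWc).add (hδc.smul hYc.continuousAt)).add
      (continuousAt_id.smul (hYc.continuousAt.mul hWc))
  · have hadj0 := hadj 0 hx'
    rw [zero_smul, add_zero] at hadj0
    have hW0 : W 0 = -(δ 0 • G') := by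
      rw [hW]; dsimp only
      rw [hadj0, hY0', Matrix.smul_mul, Matrix.one_mul, smul_smul, smul_smul,
        mul_comm (x' 0)⁻¹, mul_assoc, inv_mul_cancel₀ hx', mul_one]
    dsimp only
    rw [zero_smul, add_zero, hW0, hY0, ← traceFree_smul]
    congr 1
    module
  · filter_upwards [hxc'.continuousAt.eventually_ne hx'] with ε hε
    have h1 : R ε * (R' ε).adjugate =
        (x ε * δ ε) • (1 : Matrix (Fin r) (Fin r) ℂ) +
          ε • (x ε • W ε + δ ε • Y ε + ε • (Y ε * W ε)) := by
      rw [hR ε, hadj ε hε]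
      simp only [Matrix.add_mul, Matrix.mul_add, Matrix.smul_mul, Matrix.mul_smul, Matrix.one_mul,
        Matrix.mul_one]
      module
    rw [h1, traceFree_add, traceFree_smul, traceFree_smul, traceFree_one, smul_zero, zero_add]

end Expansion

/-! ### Cores that are close to product states -/

section Witness
variable {d : ℕ} [NeZero d] {n : Fin d → ℕ} [∀ k, NeZero (n k)] {r : ℕ}

/-- Identity slices at `k - 1` and `k`, and slices close to scalar matrices elsewhere. -/
def nearProduct (k : Fin d) (f g g' : (l : Fin d) → Fin (n l) → ℂ) (B C : Matrix (Fin r) (Fin r) ℂ)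
    (ε : ℂ) : Cores n r :=
  fun l s => if l = k - 1 ∨ l = k then (1 : Matrix (Fin r) (Fin r) ℂ) else
    f l s • (1 : Matrix (Fin r) (Fin r) ℂ) + ε • (g l s • B + g' l s • C)

omit [∀ k, NeZero (n k)] in
theorem slice_nearProduct_of_ne {k l : Fin d} (h1 : l ≠ k - 1) (h2 : l ≠ k)
    (f g g' : (l : Fin d) → Fin (n l) → ℂ) (B C : Matrix (Fin r) (Fin r) ℂ) (ε : ℂ)
    (s : Fin (n l)) : slice (nearProduct k f g g' B C ε) l s =
      f l s • (1 : Matrix (Fin r) (Fin r) ℂ) + ε • (g l s • B + g' l s • C) := by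
  have h : ¬(l = k - 1 ∨ l = k) := by tauto
  exact if_neg h

omit [∀ k, NeZero (n k)] in
theorem slice_nearProduct_of_eq {k l : Fin d} (h : l = k - 1 ∨ l = k)
    (f g g' : (l : Fin d) → Fin (n l) → ℂ) (B C : Matrix (Fin r) (Fin r) ℂ) (ε : ℂ)
    (s : Fin (n l)) : slice (nearProduct k f g g' B C ε) l s = 1 := by
  exact if_pos h

theorem mem_restSites_toFinset (hd : 2 ≤ d) (k l : Fin d) :
    l ∈ (restSites k).toFinset ↔ l ≠ k - 1 ∧ l ≠ k := by
  rw [List.mem_toFinset]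
  refine ⟨ne_of_mem_restSites hd, fun h => ?_⟩
  have := mem_cyclicSites k l
  rw [cyclicSites_eq hd, List.mem_cons, List.mem_cons] at this
  tauto

theorem restSites_nodup (k : Fin d) : (restSites k).Nodup :=
  (cyclicSites_nodup k).sublist (List.drop_sublist _ _)

theorem restSites_toFinset_eq_insert (hd : 2 ≤ d) {k h : Fin d} (h1 : h ≠ k - 1) (h2 : h ≠ k) :
    (restSites k).toFinset = insert h (({h, k - 1, k} : Finset (Fin d))ᶜ) := by
  ext l
  rw [mem_restSites_toFinset hd]
  simp only [Finset.mem_insert, Finset.mem_compl, Finset.mem_singleton]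
  by_cases hl : l = h
  · subst hl; tauto
  · tauto

theorem probeIdx_self {k h : Fin d} (c : (l : {l : Fin d // l ∉ ({h, k - 1, k} : Finset (Fin d))}) →
    Fin (n l)) (s : Fin (n h)) : probeIdx k h c s h = s := by
  simp [probeIdx, glue, idx3]

theorem probeIdx_of_notMem {k h : Fin d}
    (c : (l : {l : Fin d // l ∉ ({h, k - 1, k} : Finset (Fin d))}) → Fin (n l)) (s : Fin (n h))
    (l : {l : Fin d // l ∉ ({h, k - 1, k} : Finset (Fin d))}) : probeIdx k h c s l = c l := by
  rw [probeIdx, glue, dif_neg l.2]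

/-- Values of a family of local functionals at a multi-index off `{h, k - 1, k}`. -/
def offVal {k h : Fin d} (f : (l : Fin d) → Fin (n l) → ℂ)
    (c : (l : {l : Fin d // l ∉ ({h, k - 1, k} : Finset (Fin d))}) → Fin (n l))
    (l : {l : Fin d // l ∉ ({h, k - 1, k} : Finset (Fin d))}) : ℂ := f l (c l)

theorem prod_compl_probeIdx {k h : Fin d} (f : (l : Fin d) → Fin (n l) → ℂ)
    (c : (l : {l : Fin d // l ∉ ({h, k - 1, k} : Finset (Fin d))}) → Fin (n l)) (s : Fin (n h)) :
    ∏ l ∈ ({h, k - 1, k} : Finset (Fin d))ᶜ, f l (probeIdx k h c s l) = ∏ l, offVal f c l := by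
  rw [Finset.prod_subtype _ (p := fun l => l ∉ ({h, k - 1, k} : Finset (Fin d)))
    fun l => Finset.mem_compl]
  exact Finset.prod_congr rfl fun l _ => by rw [probeIdx_of_notMem, offVal]

theorem prodDeriv_compl_probeIdx {k h : Fin d} (f g : (l : Fin d) → Fin (n l) → ℂ)
    (c : (l : {l : Fin d // l ∉ ({h, k - 1, k} : Finset (Fin d))}) → Fin (n l)) (s : Fin (n h)) :
    prodDeriv (({h, k - 1, k} : Finset (Fin d))ᶜ) (fun l => f l (probeIdx k h c s l))
      (fun l => g l (probeIdx k h c s l)) = prodDeriv Finset.univ (offVal f c) (offVal g c) := by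
  rw [prodDeriv, Finset.sum_subtype _ (p := fun l => l ∉ ({h, k - 1, k} : Finset (Fin d)))
    fun l => Finset.mem_compl]
  refine Finset.sum_congr rfl fun l _ => ?_
  rw [Finset.prod_subtype _ (p := fun l => l ∉ ({h, k - 1, k} : Finset (Fin d)))
    fun l => Finset.mem_compl]
  refine Finset.prod_congr rfl fun l' _ => ?_
  simp only [probeIdx_of_notMem, offVal, Subtype.ext_iff]

omit [∀ k, NeZero (n k)] in
/-- Orthogonality at every site makes the first-order terms cancel. -/
theorem sum_conj_prod_mul_prodDeriv {k h : Fin d} {f g : (l : Fin d) → Fin (n l) → ℂ}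
    (hfg : ∀ l, g l ⬝ᵥ conjVec f l = 0) :
    ∑ c : (l : {l : Fin d // l ∉ ({h, k - 1, k} : Finset (Fin d))}) → Fin (n l),
      conj (∏ l, offVal f c l) * prodDeriv Finset.univ (offVal f c) (offVal g c) = 0 := by
  simp only [prodDeriv, Finset.mul_sum]
  rw [Finset.sum_comm]
  refine Finset.sum_eq_zero fun l _ => ?_
  have h1 : ∀ c : (l : {l : Fin d // l ∉ ({h, k - 1, k} : Finset (Fin d))}) → Fin (n l),
      conj (∏ l, offVal f c l) * ∏ l', (if l' = l then offVal g c l' else offVal f c l') =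
      ∏ l' : {l : Fin d // l ∉ ({h, k - 1, k} : Finset (Fin d))},
        (conj (f l' (c l')) * if l' = l then g l' (c l') else f l' (c l')) := by
    intro c
    rw [map_prod, ← Finset.prod_mul_distrib]
    rfl
  simp only [h1]
  -- The sum over multi-indices of a product over sites factorizes, and the factor at the
  -- differentiated site `l` is `g l ⬝ᵥ conjVec f l = 0`.
  rw [← Fintype.prod_sum (fun (l' : {l : Fin d // l ∉ ({h, k - 1, k} : Finset (Fin d))})
    (s : Fin (n l')) => conj (f l' s) * if l' = l then g l' s else f l' s)]
  refine Finset.prod_eq_zero (Finset.mem_univ l) ?_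
  simp only [if_true]
  rw [← hfg l]
  exact Finset.sum_congr rfl fun s _ => mul_comm _ _

omit [∀ k, NeZero (n k)] in
theorem sum_conj_prod_mul_prod_ne_zero {k h : Fin d} {f : (l : Fin d) → Fin (n l) → ℂ}
    (hf : ∀ l, f l ≠ 0) :
    ∑ c : (l : {l : Fin d // l ∉ ({h, k - 1, k} : Finset (Fin d))}) → Fin (n l),
      conj (∏ l, offVal f c l) * ∏ l, offVal f c l ≠ 0 := by
  have h1 : ∀ c : (l : {l : Fin d // l ∉ ({h, k - 1, k} : Finset (Fin d))}) → Fin (n l),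
      conj (∏ l, offVal f c l) * ∏ l, offVal f c l =
      ∏ l : {l : Fin d // l ∉ ({h, k - 1, k} : Finset (Fin d))},
        (conj (f l (c l)) * f l (c l)) := by
    intro c
    rw [map_prod, ← Finset.prod_mul_distrib]
    rfl
  simp only [h1]
  rw [← Fintype.prod_sum (fun (l : {l : Fin d // l ∉ ({h, k - 1, k} : Finset (Fin d))})
    (s : Fin (n l)) => conj (f l s) * f l s)]
  exact Finset.prod_ne_zero_iff.2 fun l _ => conjVec_dotProduct_self_ne_zero (hf l)

/-- The differentiated factor sits either at the probed site, giving `g h ⬝ᵥ v`, or at a traced-out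
site, giving the `prodDeriv` term. -/
theorem expands_restVec (hd : 2 ≤ d) {k h : Fin d} (h1 : h ≠ k - 1) (h2 : h ≠ k)
    (f g g' : (l : Fin d) → Fin (n l) → ℂ) (B C : Matrix (Fin r) (Fin r) ℂ) (v : Fin (n h) → ℂ)
    (c : (l : {l : Fin d // l ∉ ({h, k - 1, k} : Finset (Fin d))}) → Fin (n l)) :
    Expands (fun ε => restVec (nearProduct k f g g' B C ε) k h v c)
      (f h ⬝ᵥ v * ∏ l, offVal f c l)
      ((g h ⬝ᵥ v * ∏ l, offVal f c l +
          f h ⬝ᵥ v * prodDeriv Finset.univ (offVal f c) (offVal g c)) • B +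
        (g' h ⬝ᵥ v * ∏ l, offVal f c l +
          f h ⬝ᵥ v * prodDeriv Finset.univ (offVal f c) (offVal g' c)) • C) := by
  have hh : h ∉ ({h, k - 1, k} : Finset (Fin d))ᶜ := by simp
  have hprod : ∀ s, Expands (fun ε => restProd (nearProduct k f g g' B C ε) k (probeIdx k h c s))
      (f h s * ∏ l, offVal f c l)
      ((g h s * ∏ l, offVal f c l +
          f h s * prodDeriv Finset.univ (offVal f c) (offVal g c)) • B +
        (g' h s * ∏ l, offVal f c l +
          f h s * prodDeriv Finset.univ (offVal f c) (offVal g' c)) • C) := by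
    intro s
    have e := Expands.list_prod (fun l => f l (probeIdx k h c s l))
      (fun l => g l (probeIdx k h c s l)) (fun l => g' l (probeIdx k h c s l)) B C
      (restSites_nodup k)
    rw [restSites_toFinset_eq_insert hd h1 h2, Finset.prod_insert hh, prodDeriv_insert hh,
      prodDeriv_insert hh, prod_compl_probeIdx, prodDeriv_compl_probeIdx,
      prodDeriv_compl_probeIdx, probeIdx_self] at e
    refine e.congr (fun ε => ?_) rfl rfl
    rw [restProd]
    congr 1
    refine List.map_congr_left fun l hl => ?_
    exact slice_nearProduct_of_ne (ne_of_mem_restSites hd hl).1 (ne_of_mem_restSites hd hl).2 ..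
  refine (Expands.sum fun s => Expands.smul (continuous_const (y := v s)) (hprod s)).congr
    (fun _ => rfl) ?_ ?_
  · simp only [dotProduct, Finset.sum_mul]
    exact Finset.sum_congr rfl fun s _ => by ring
  · simp only [smul_add, smul_smul, Finset.sum_add_distrib, ← Finset.sum_smul, dotProduct,
      Finset.sum_mul, mul_add]
    congr 2
    · exact congrArg₂ _ (Finset.sum_congr rfl fun s _ => by ring)
        (Finset.sum_congr rfl fun s _ => by ring)
    · exact congrArg₂ _ (Finset.sum_congr rfl fun s _ => by ring)
        (Finset.sum_congr rfl fun s _ => by ring)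

/-- Summation over the traced-out sites removes the `prodDeriv` terms by orthogonality of `g` and
`g'` to `f`. Only the derivative at the probed site survives, and dividing by the scalar term leaves
the ratios `g / f` at the probe. -/
theorem expands_probeCore [NeZero r] (hd : 2 ≤ d) {k h : Fin d} (h1 : h ≠ k - 1) (h2 : h ≠ k)
    {f g g' : (l : Fin d) → Fin (n l) → ℂ} (hf : ∀ l, f l ≠ 0)
    (hfg : ∀ l, g l ⬝ᵥ conjVec f l = 0) (hfg' : ∀ l, g' l ⬝ᵥ conjVec f l = 0)
    (B C : Matrix (Fin r) (Fin r) ℂ) {v : Fin (n h) → ℂ} (hv : f h ⬝ᵥ v ≠ 0) :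
    ∃ x₀ : ℂ, x₀ ≠ 0 ∧ Expands (fun ε => probeCore (nearProduct k f g g' B C ε) k h v) x₀
      (x₀ • ((g h ⬝ᵥ v / f h ⬝ᵥ v) • B + (g' h ⬝ᵥ v / f h ⬝ᵥ v) • C)) := by
  set φ := f h ⬝ᵥ v with hφ
  set S := ∑ c : (l : {l : Fin d // l ∉ ({h, k - 1, k} : Finset (Fin d))}) → Fin (n l),
      conj (∏ l, offVal f c l) * ∏ l, offVal f c l with hS
  have hS0 : S ≠ 0 := sum_conj_prod_mul_prod_ne_zero hf
  have hr : (r : ℂ) ≠ 0 := Nat.cast_ne_zero.2 (NeZero.ne r)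
  have hcφ : conj φ ≠ 0 := (map_ne_zero _).2 hv
  have hvec := fun c => expands_restVec hd h1 h2 f g g' B C v c
  have hterm : ∀ c, Expands (fun ε => conj ((slice (nearProduct k f g g' B C ε) (k - 1) 0 *
      slice (nearProduct k f g g' B C ε) k 0 *
        restVec (nearProduct k f g g' B C ε) k h v c).trace) •
        restVec (nearProduct k f g g' B C ε) k h v c)
      (r * conj φ * φ * (conj (∏ l, offVal f c l) * ∏ l, offVal f c l))
      ((r * conj φ * (g h ⬝ᵥ v) * (conj (∏ l, offVal f c l) * ∏ l, offVal f c l) +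
          r * conj φ * φ * (conj (∏ l, offVal f c l) *
            prodDeriv Finset.univ (offVal f c) (offVal g c))) • B +
        (r * conj φ * (g' h ⬝ᵥ v) * (conj (∏ l, offVal f c l) * ∏ l, offVal f c l) +
          r * conj φ * φ * (conj (∏ l, offVal f c l) *
            prodDeriv Finset.univ (offVal f c) (offVal g' c))) • C) := by
    intro c
    have hcont : Continuous fun ε => conj ((restVec (nearProduct k f g g' B C ε) k h v c).trace) :=
      Complex.continuous_conj.comp (hvec c).continuous.matrix_trace
    have h0 : conj ((restVec (nearProduct k f g g' B C 0) k h v c).trace) =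
        r * conj φ * conj (∏ l, offVal f c l) := by
      have := (hvec c).apply_zero
      rw [this, trace_smul, trace_one, Fintype.card_fin, smul_eq_mul, map_mul, map_mul,
        Complex.conj_natCast]
      ring
    have e := Expands.smul hcont (hvec c)
    rw [h0] at e
    refine e.congr (fun ε => ?_) ?_ ?_
    · rw [slice_nearProduct_of_eq (Or.inl rfl), slice_nearProduct_of_eq (Or.inr rfl),
        Matrix.one_mul, Matrix.one_mul]
    · ring
    · rw [smul_add, smul_smul, smul_smul]
      congr 2
      · ring
      · ring
  refine ⟨r * conj φ * φ * S, mul_ne_zero (mul_ne_zero (mul_ne_zero hr hcφ) hv) hS0, ?_⟩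
  refine (Expands.sum hterm).congr (fun _ => rfl) ?_ ?_
  · rw [hS, Finset.mul_sum]
  · rw [Finset.sum_add_distrib, ← Finset.sum_smul, ← Finset.sum_smul, Finset.sum_add_distrib,
      Finset.sum_add_distrib, ← Finset.mul_sum, ← Finset.mul_sum, ← Finset.mul_sum,
      ← Finset.mul_sum, sum_conj_prod_mul_prodDeriv hfg, sum_conj_prod_mul_prodDeriv hfg',
      mul_zero, add_zero, add_zero, ← hS, smul_add, smul_smul, smul_smul]
    congr 2
    · field_simp
    · field_simp

end Witness

/-! ### Generic cores -/

section Generic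
variable {d : ℕ} [NeZero d] {n : Fin d → ℕ} [∀ k, NeZero (n k)] {r : ℕ}

/-- The small matrix of the `i`-th probe of the pair `(k - 1, k)`. -/
noncomputable def smallMatrix (p : Probes n) (Q : Cores n r) (k : Fin d) (i : Fin 4) :
    Matrix (Fin r) (Fin r) ℂ :=
  probeCore Q k (p.site k i) (p.vec k i)

/-- The trace-free part of a polynomial multiple of the quotient of two small matrices. -/
noncomputable def ratioMatrix (p : Probes n) (Q : Cores n r) (k : Fin d) (i j : Fin 4) :
    Matrix (Fin r) (Fin r) ℂ :=
  traceFree (smallMatrix p Q k i * (smallMatrix p Q k j).adjugate)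

/-- The algebraic conditions on the cores under which the algorithm works. -/
structure Generic (p : Probes n) (Q : Cores n r) : Prop where
  unfold : ∀ k, ((unfoldOne Q k)ᴴ * unfoldOne Q k).det ≠ 0
  small : ∀ k i, (smallMatrix p Q k i).det ≠ 0
  hankel_fst : ∀ k, (hankel (ratioMatrix p Q k 0 1)).det ≠ 0
  hankel_snd : ∀ k, (hankel (ratioMatrix p Q k 2 3)).det ≠ 0
  word : ∀ k, (wordMatrix (ratioMatrix p Q k 0 1) (ratioMatrix p Q k 2 3)).det ≠ 0

-- `g` and `g'` are taken with differences `(1, 0)` and `(0, 1)` over the two pairs of probes, which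
-- decouples `B` from `C` to first order.
open Filter Topology in
theorem exists_family_nearProduct [NeZero r] (hd : 2 ≤ d) (hn : ∀ k, 4 ≤ n k) {p : Probes n}
    (hp : p.Admissible) (k : Fin d) (B C : Matrix (Fin r) (Fin r) ℂ) :
    ∃ (Q : ℂ → Cores n r) (κ κ' : ℂ) (Z Z' : ℂ → Matrix (Fin r) (Fin r) ℂ), κ ≠ 0 ∧ κ' ≠ 0 ∧
      ContinuousAt Z 0 ∧ ContinuousAt Z' 0 ∧ Z 0 = κ • traceFree B ∧ Z' 0 = κ' • traceFree C ∧
      (∀ᶠ ε in 𝓝 0, ratioMatrix p (Q ε) k 0 1 = ε • Z ε) ∧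
      (∀ᶠ ε in 𝓝 0, ratioMatrix p (Q ε) k 2 3 = ε • Z' ε) ∧
      ∀ i, (smallMatrix p (Q 0) k i).det ≠ 0 := by
  obtain ⟨f, hfv, hf0, hsep⟩ := exists_separating_functionals (h := p.site k) (v := p.vec k) hn
    (hp.first k) (hp.second k) (hp.pairs k)
  obtain ⟨g, hg, hg01, hg23⟩ := hsep 1 0
  obtain ⟨g', hg', hg01', hg23'⟩ := hsep 0 1
  have hexp := fun i => expands_probeCore (r := r) hd (hp.ne_left k i) (hp.ne_right k i) hf0 hg hg'
    B C (hfv i)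
  choose x hx0 hx using hexp
  obtain ⟨κ, Z, hκ, hZc, hZ0, hZ⟩ := (hx 0).traceFree_mul_adjugate (hx 1) (hx0 0) (hx0 1)
  obtain ⟨κ', Z', hκ', hZc', hZ0', hZ'⟩ := (hx 2).traceFree_mul_adjugate (hx 3) (hx0 2) (hx0 3)
  refine ⟨nearProduct k f g g' B C, κ, κ', Z, Z', hκ, hκ', hZc, hZc', ?_, ?_, hZ, hZ', fun i => ?_⟩
  · rw [hZ0, add_sub_add_comm, ← sub_smul, ← sub_smul, hg01, hg01', one_smul, zero_smul, add_zero]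
  · rw [hZ0', add_sub_add_comm, ← sub_smul, ← sub_smul, hg23, hg23', one_smul, zero_smul, zero_add]
  · rw [smallMatrix, (hx i).apply_zero, det_smul, det_one, mul_one]
    exact pow_ne_zero _ (hx0 i)

-- Since `r ^ 2 ≤ n k`, the columns of the unfolding can be distinct standard basis vectors.
omit [NeZero d] [∀ k, NeZero (n k)] in
theorem exists_det_unfoldOne_ne_zero (hn : ∀ k, r ^ 2 ≤ n k) (k : Fin d) :
    ∃ Q : Cores n r, ((unfoldOne Q k)ᴴ * unfoldOne Q k).det ≠ 0 := by
  have hcard : Fintype.card (Fin r × Fin r) ≤ Fintype.card (Fin (n k)) := by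
    simpa [pow_two] using hn k
  obtain ⟨e⟩ := Function.Embedding.nonempty_of_card_le hcard
  -- Comparing values in `ℕ` defines all cores at once, although `e` takes values in the index type
  -- of site `k` only.
  let Q : Cores n r := fun l α a b => if α.val = (e (a, b)).val then 1 else 0
  refine ⟨Q, ?_⟩
  have : (unfoldOne Q k)ᴴ * unfoldOne Q k = 1 := by
    ext ab ab'
    rw [Matrix.mul_apply, Finset.sum_eq_single (e ab')]
    · rw [conjTranspose_apply]
      simp only [unfoldOne, Matrix.of_apply, Q, Prod.mk.eta, if_true, mul_one, Matrix.one_apply,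
        Fin.val_inj, e.injective.eq_iff, eq_comm (a := ab')]
      split_ifs <;> simp
    · intro α _ hα
      simp only [unfoldOne, Matrix.of_apply, Q, Prod.mk.eta, Fin.val_inj, if_neg hα, mul_zero]
    · simp
  rw [this, det_one]
  exact one_ne_zero

theorem injective_traceFree_diagonal [NeZero r] :
    Function.Injective fun i : Fin r => (r : ℂ) * (i.val : ℂ) - ∑ j : Fin r, (j.val : ℂ) := by
  intro i j hij
  have hr : (r : ℂ) ≠ 0 := Nat.cast_ne_zero.2 (NeZero.ne r)
  exact Fin.ext (Nat.cast_injective (mul_left_cancel₀ hr (sub_left_inj.1 hij)))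

theorem continuous_det_hankel :
    Continuous fun A : Matrix (Fin r) (Fin r) ℂ => (hankel A).det := by
  refine Continuous.matrix_det (continuous_matrix fun i j => ?_)
  exact (continuous_pow (i.val + j.val)).matrix_trace

theorem continuous_det_wordMatrix :
    Continuous fun A : Matrix (Fin r) (Fin r) ℂ × Matrix (Fin r) (Fin r) ℂ =>
      (wordMatrix A.1 A.2).det := by
  refine Continuous.matrix_det (continuous_matrix fun i j => ?_)
  exact Continuous.matrix_elem ((continuous_fst.pow i.1.val).matrix_mul
    (continuous_snd.pow i.2.val)) j.1 j.2

open Filter Topology in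
theorem exists_det_hankel_fst_ne_zero [NeZero r] (hd : 2 ≤ d) (hn : ∀ k, 4 ≤ n k) {p : Probes n}
    (hp : p.Admissible) (k : Fin d) :
    ∃ Q : Cores n r, (hankel (ratioMatrix p Q k 0 1)).det ≠ 0 := by
  obtain ⟨Q, κ, -, Z, -, hκ, -, hZc, -, hZ0, -, hZ, -, -⟩ := exists_family_nearProduct (r := r)
    hd hn hp k (diagonal fun i : Fin r => (i.val : ℂ)) 0
  have h0 : (hankel (Z 0)).det ≠ 0 := by
    rw [hZ0, traceFree_diagonal]
    exact det_hankel_smul_ne_zero hκ (det_hankel_diagonal_ne_zero injective_traceFree_diagonal)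
  have h1 := (continuous_det_hankel.continuousAt.comp hZc).eventually_ne h0
  -- `ε` has to be non-zero, because at `ε = 0` the trace-free quotient vanishes.
  obtain ⟨ε, ⟨h2, h3⟩, hε⟩ := (((h1.and hZ).filter_mono nhdsWithin_le_nhds).and
    (self_mem_nhdsWithin : {(0 : ℂ)}ᶜ ∈ 𝓝[≠] 0)).exists
  exact ⟨Q ε, by rw [h3]; exact det_hankel_smul_ne_zero hε h2⟩

open Filter Topology in
theorem exists_det_hankel_snd_ne_zero [NeZero r] (hd : 2 ≤ d) (hn : ∀ k, 4 ≤ n k) {p : Probes n}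
    (hp : p.Admissible) (k : Fin d) :
    ∃ Q : Cores n r, (hankel (ratioMatrix p Q k 2 3)).det ≠ 0 := by
  obtain ⟨Q, -, κ, -, Z, -, hκ, -, hZc, -, hZ0, -, hZ, -⟩ := exists_family_nearProduct (r := r)
    hd hn hp k 0 (diagonal fun i : Fin r => (i.val : ℂ))
  have h0 : (hankel (Z 0)).det ≠ 0 := by
    rw [hZ0, traceFree_diagonal]
    exact det_hankel_smul_ne_zero hκ (det_hankel_diagonal_ne_zero injective_traceFree_diagonal)
  have h1 := (continuous_det_hankel.continuousAt.comp hZc).eventually_ne h0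
  obtain ⟨ε, ⟨h2, h3⟩, hε⟩ := (((h1.and hZ).filter_mono nhdsWithin_le_nhds).and
    (self_mem_nhdsWithin : {(0 : ℂ)}ᶜ ∈ 𝓝[≠] 0)).exists
  exact ⟨Q ε, by rw [h3]; exact det_hankel_smul_ne_zero hε h2⟩

open Filter Topology in
theorem exists_det_wordMatrix_ne_zero [NeZero r] (hd : 2 ≤ d) (hr : 2 ≤ r) (hn : ∀ k, 4 ≤ n k)
    {p : Probes n} (hp : p.Admissible) (k : Fin d) :
    ∃ Q : Cores n r, (wordMatrix (ratioMatrix p Q k 0 1) (ratioMatrix p Q k 2 3)).det ≠ 0 := by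
  have hr0 : (r : ℂ) ≠ 0 := Nat.cast_ne_zero.2 (NeZero.ne r)
  obtain ⟨Q, κ, κ', Z, Z', hκ, hκ', hZc, hZc', hZ0, hZ0', hZ, hZ', -⟩ :=
    exists_family_nearProduct (r := r) hd hn hp k (diagonal fun i : Fin r => (i.val : ℂ))
      (shiftMatrix r)
  have h0 : (wordMatrix (Z 0) (Z' 0)).det ≠ 0 := by
    rw [hZ0, hZ0', traceFree_diagonal, traceFree_shiftMatrix hr, smul_smul]
    exact det_wordMatrix_smul_ne_zero hκ (mul_ne_zero hκ' hr0)
      (det_wordMatrix_diagonal_shift_ne_zero injective_traceFree_diagonal)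
  have h1 := (continuous_det_wordMatrix.continuousAt.comp (hZc.prodMk hZc')).eventually_ne h0
  obtain ⟨ε, ⟨⟨h2, h3⟩, h4⟩, hε⟩ := ((((h1.and hZ).and hZ').filter_mono nhdsWithin_le_nhds).and
    (self_mem_nhdsWithin : {(0 : ℂ)}ᶜ ∈ 𝓝[≠] 0)).exists
  exact ⟨Q ε, by rw [h3, h4]; exact det_wordMatrix_smul_ne_zero hε hε h2⟩

theorem analyticMat_smallMatrix (p : Probes n) (k : Fin d) (i : Fin 4) :
    AnalyticMat fun Q : Cores n r => smallMatrix p Q k i :=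
  analyticMat_probeCore _ _ _

theorem analyticMat_ratioMatrix (p : Probes n) (k : Fin d) (i j : Fin 4) :
    AnalyticMat fun Q : Cores n r => ratioMatrix p Q k i j :=
  ((analyticMat_smallMatrix p k i).mul (analyticMat_smallMatrix p k j).adjugate).traceFree

theorem isAddHaarMeasure_volume_function {ι : Type*} [Fintype ι] {E : ι → Type*}
    [∀ i, NormedAddCommGroup (E i)] [∀ i, NormedSpace ℝ (E i)] [∀ i, MeasureSpace (E i)]
    [∀ i, BorelSpace (E i)] [∀ i, FiniteDimensional ℝ (E i)]
    [∀ i, (volume : Measure (E i)).IsAddHaarMeasure] :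
    (volume : Measure (∀ i, E i)).IsAddHaarMeasure :=
  Measure.pi.isAddHaarMeasure _

instance isAddHaarMeasure_cores {d : ℕ} (n : Fin d → ℕ) (r : ℕ) :
    (volume : Measure (Cores n r)).IsAddHaarMeasure := by
  have h1 : (volume : Measure (Fin r → ℂ)).IsAddHaarMeasure := isAddHaarMeasure_volume_function
  have h2 : (volume : Measure (Fin r → Fin r → ℂ)).IsAddHaarMeasure :=
    isAddHaarMeasure_volume_function
  have h3 : ∀ k, (volume : Measure (Fin (n k) → Fin r → Fin r → ℂ)).IsAddHaarMeasure :=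
    fun _ => isAddHaarMeasure_volume_function
  exact isAddHaarMeasure_volume_function

/-- The basis changes of all eigenspaces are formally cores with `n k = r`, so the analytic lemmas
for slices apply to them too. -/
instance isAddHaarMeasure_rotations {d : ℕ} (r : ℕ) :
    (volume : Measure (Fin d → Fin r → Fin r → Fin r → ℂ)).IsAddHaarMeasure :=
  isAddHaarMeasure_cores (fun _ => r) r

theorem ae_generic [NeZero r] (hd : 2 ≤ d) (hr : 2 ≤ r) (hn : ∀ k, r ^ 2 ≤ n k)
    {p : Probes n} (hp : p.Admissible) :
    ∀ᵐ Q ∂(volume : Measure (Cores n r)), Generic p Q := by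
  have hn4 : ∀ k, 4 ≤ n k := fun k => (Nat.pow_le_pow_left hr 2).trans (hn k)
  have h1 : ∀ᵐ Q ∂(volume : Measure (Cores n r)), ∀ k,
      ((unfoldOne Q k)ᴴ * unfoldOne Q k).det ≠ 0 := ae_all_iff.2 fun k => by
    obtain ⟨Q, hQ⟩ := exists_det_unfoldOne_ne_zero hn k
    exact ae_ne_zero_of_analytic volume
      ((analyticMat_unfoldOne k).conjTranspose.mul (analyticMat_unfoldOne k)).det hQ
  have h2 : ∀ᵐ Q ∂(volume : Measure (Cores n r)), ∀ k i, (smallMatrix p Q k i).det ≠ 0 :=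
    ae_all_iff.2 fun k => ae_all_iff.2 fun i => by
      obtain ⟨Q, -, -, -, -, -, -, -, -, -, -, -, -, hQ⟩ :=
        exists_family_nearProduct (r := r) hd hn4 hp k 0 0
      exact ae_ne_zero_of_analytic volume (analyticMat_smallMatrix p k i).det (hQ i)
  have h3 : ∀ᵐ Q ∂(volume : Measure (Cores n r)), ∀ k,
      (hankel (ratioMatrix p Q k 0 1)).det ≠ 0 := ae_all_iff.2 fun k => by
    obtain ⟨Q, hQ⟩ := exists_det_hankel_fst_ne_zero (r := r) hd hn4 hp k
    exact ae_ne_zero_of_analytic volume (analyticMat_ratioMatrix p k 0 1).hankel.det hQ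
  have h4 : ∀ᵐ Q ∂(volume : Measure (Cores n r)), ∀ k,
      (hankel (ratioMatrix p Q k 2 3)).det ≠ 0 := ae_all_iff.2 fun k => by
    obtain ⟨Q, hQ⟩ := exists_det_hankel_snd_ne_zero (r := r) hd hn4 hp k
    exact ae_ne_zero_of_analytic volume (analyticMat_ratioMatrix p k 2 3).hankel.det hQ
  have h5 : ∀ᵐ Q ∂(volume : Measure (Cores n r)), ∀ k,
      (wordMatrix (ratioMatrix p Q k 0 1) (ratioMatrix p Q k 2 3)).det ≠ 0 :=
    ae_all_iff.2 fun k => by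
      obtain ⟨Q, hQ⟩ := exists_det_wordMatrix_ne_zero hd hr hn4 hp k
      exact ae_ne_zero_of_analytic volume ((analyticMat_ratioMatrix p k 0 1).wordMatrix
        (analyticMat_ratioMatrix p k 2 3)).det hQ
  filter_upwards [h1, h2, h3, h4, h5] with Q a b c e f
  exact ⟨a, b, c, e, f⟩

/-! ### The algorithm on generic cores -/

variable {p : Probes n} {Q : Cores n r}

theorem Generic.leftOne (hQ : Generic p Q) (k : Fin d) :
    pinv (unfoldOne Q k) * unfoldOne Q k = 1 :=
  pinv_mul_self (isUnit_iff_ne_zero.2 (hQ.unfold k))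

theorem Generic.leftSq (hQ : Generic p Q) (k : Fin d) :
    pinv (unfoldSq Q k) * unfoldSq Q k = 1 := by
  refine pinv_mul_self (isUnit_iff_ne_zero.2 ?_)
  -- The two unfoldings differ by a permutation of columns, so their Gram determinants agree.
  have h1 : (unfoldSq Q k)ᴴ * unfoldSq Q k = ((unfoldOne Q k)ᴴ * unfoldOne Q k).submatrix
      (Equiv.prodComm (Fin r) (Fin r)) (Equiv.prodComm (Fin r) (Fin r)) := rfl
  rw [h1, det_submatrix_equiv_self]
  exact hQ.unfold k

/-- A vanishing tensor would make every amplitude in `probeCore` zero, contradicting invertibility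
of a small matrix; pair `0` and probe `0` are an arbitrary choice. -/
theorem Generic.exists_ringTensor_ne_zero [NeZero r] (hd : 3 ≤ d) (hp : p.Admissible)
    (hQ : Generic p Q) : ∃ α, ringTensor Q α ≠ 0 := by
  by_contra hcon
  push Not at hcon
  apply hQ.small 0 0
  have : smallMatrix p Q 0 0 = 0 := by
    rw [smallMatrix, probeCore]
    refine Finset.sum_eq_zero fun c _ => ?_
    have h1 : (slice Q (0 - 1) 0 * slice Q 0 0 *
        restVec Q 0 (p.site 0 0) (p.vec 0 0) c).trace = 0 := by
      rw [restVec, Matrix.mul_sum, trace_sum]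
      refine Finset.sum_eq_zero fun s _ => ?_
      rw [Matrix.mul_smul, trace_smul,
        ← ringTensor_glue hd Q (hp.ne_left 0 0) (hp.ne_right 0 0), hcon, smul_zero]
    rw [h1, map_zero, zero_smul]
  rw [this, det_zero]

omit [NeZero d] [∀ k, NeZero (n k)] in
theorem normFactor_ne_zero {α : Idx n} (h : ringTensor Q α ≠ 0) : normFactor Q ≠ 0 := by
  have hpos : 0 < ∑ β, ‖ringTensor Q β‖ ^ 2 :=
    Finset.sum_pos' (fun _ _ => by positivity) ⟨α, Finset.mem_univ _, by positivity⟩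
  have h1 : ((Real.sqrt (∑ β, ‖ringTensor Q β‖ ^ 2) : ℝ) : ℂ) ≠ 0 :=
    Complex.ofReal_ne_zero.2 (Real.sqrt_pos.2 hpos).ne'
  exact mul_ne_zero (inv_ne_zero h1) (inv_ne_zero h1)

theorem probeMatrix_pair (hd : 3 ≤ d) (hp : p.Admissible) {j k : Fin d} (hjk : j = k - 1)
    (i : Fin 4) : probeMatrix (threeBody (mpsState Q)) j k (p.site k i) (p.vec k i) =
      unfoldOne Q k * idKron (normFactor Q • smallMatrix p Q k i) * (unfoldSq Q j)ᵀ := by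
  subst hjk
  exact probeMatrix_eq hd Q (hp.ne_left k i) (hp.ne_right k i) _

theorem Generic.isUnit_det_smul (hQ : Generic p Q) (hν : normFactor Q ≠ 0) (k : Fin d)
    (i : Fin 4) : IsUnit (normFactor Q • smallMatrix p Q k i).det := by
  rw [det_smul]
  exact isUnit_iff_ne_zero.2 (mul_ne_zero (pow_ne_zero _ hν) (hQ.small k i))

/-- The unfolding of the left neighbour and the normalization cancel between the two factors,
leaving only the core at `k` and the quotient of small matrices. -/
theorem Generic.probeMatrix_mul_pinv (hd : 3 ≤ d) (hp : p.Admissible) (hQ : Generic p Q)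
    (hν : normFactor Q ≠ 0) (k : Fin d) (i j : Fin 4) :
    probeMatrix (threeBody (mpsState Q)) (k - 1) k (p.site k i) (p.vec k i) *
      pinv (probeMatrix (threeBody (mpsState Q)) (k - 1) k (p.site k j) (p.vec k j)) =
    unfoldOne Q k * idKron (smallMatrix p Q k i * (smallMatrix p Q k j)⁻¹) *
      pinv (unfoldOne Q k) := by
  have hj := hQ.isUnit_det_smul hν k j
  have hW : (unfoldSq Q (k - 1))ᵀ * (pinv (unfoldSq Q (k - 1)))ᵀ = 1 := by
    rw [← transpose_mul, hQ.leftSq, transpose_one]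
  have hs : (normFactor Q • smallMatrix p Q k i) * (normFactor Q • smallMatrix p Q k j)⁻¹ =
      smallMatrix p Q k i * (smallMatrix p Q k j)⁻¹ := by
    have h1 : (normFactor Q • smallMatrix p Q k j)⁻¹ =
        (normFactor Q)⁻¹ • (smallMatrix p Q k j)⁻¹ := by
      refine Matrix.inv_eq_right_inv ?_
      rw [Matrix.smul_mul, Matrix.mul_smul, smul_smul, mul_inv_cancel₀ hν, one_smul,
        Matrix.mul_nonsing_inv _ (isUnit_iff_ne_zero.2 (hQ.small k j))]
    rw [h1, Matrix.smul_mul, Matrix.mul_smul, smul_smul, mul_inv_cancel₀ hν, one_smul]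
  rw [probeMatrix_pair hd hp rfl, probeMatrix_pair hd hp rfl,
    pinv_mul_mul_transpose (hQ.leftOne k) (hQ.leftSq (k - 1)) (isUnit_det_one_kronecker hj),
    idKron_inv hj]
  calc _ = unfoldOne Q k * (idKron (normFactor Q • smallMatrix p Q k i) *
        (((unfoldSq Q (k - 1))ᵀ * (pinv (unfoldSq Q (k - 1)))ᵀ) *
          idKron (normFactor Q • smallMatrix p Q k j)⁻¹)) * pinv (unfoldOne Q k) := by
        simp only [Matrix.mul_assoc]
    _ = _ := by
      rw [hW, Matrix.one_mul, ← mul_kronecker_mul, Matrix.one_mul, hs]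

theorem Generic.isUnit_det_quotient (hQ : Generic p Q) (k : Fin d) (i j : Fin 4) :
    IsUnit (smallMatrix p Q k i * (smallMatrix p Q k j)⁻¹).det := by
  rw [det_mul]
  exact (isUnit_iff_ne_zero.2 (hQ.small k i)).mul
    (Matrix.isUnit_nonsing_inv_det _ (isUnit_iff_ne_zero.2 (hQ.small k j)))

theorem Generic.exists_diagonalizes_quotient [NeZero r] (hQ : Generic p Q) {k : Fin d}
    {i j : Fin 4} (h : (hankel (ratioMatrix p Q k i j)).det ≠ 0) :
    ∃ V lam, Diagonalizes V (smallMatrix p Q k i * (smallMatrix p Q k j)⁻¹) lam := by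
  obtain ⟨V, lam, hV⟩ := exists_diagonalizes_of_hankel h
  have hj := hQ.small k j
  have h1 := (Diagonalizes.of_traceFree hV).smul (inv_ne_zero hj)
  rw [mul_adjugate_eq_smul (isUnit_iff_ne_zero.2 hj), smul_smul, inv_mul_cancel₀ hj, one_smul] at h1
  exact ⟨V, _, h1⟩

/-- The word condition concerns trace-free adjugate products; they have the same eigenvectors as the
true quotients, so it applies to `V` and `V'`. -/
theorem Generic.inv_mul_apply_ne_zero [NeZero r] (hQ : Generic p Q) {k : Fin d}
    {V V' : Matrix (Fin r) (Fin r) ℂ} {lam lam' : Fin r → ℂ}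
    (hV : Diagonalizes V (smallMatrix p Q k 0 * (smallMatrix p Q k 1)⁻¹) lam)
    (hV' : Diagonalizes V' (smallMatrix p Q k 2 * (smallMatrix p Q k 3)⁻¹) lam') (b c : Fin r) :
    (V⁻¹ * V') b c ≠ 0 := by
  have h1 := (hV.smul (hQ.small k 1)).traceFree
  have h2 := (hV'.smul (hQ.small k 3)).traceFree
  rw [← mul_adjugate_eq_smul (isUnit_iff_ne_zero.2 (hQ.small k _))] at h1 h2
  exact inv_mul_apply_ne_zero_of_wordMatrix (hQ.word k) h1 h2 b c

theorem Generic.exists_isEigenChoice [NeZero r] (hd : 3 ≤ d) (hp : p.Admissible)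
    (hQ : Generic p Q) (hν : normFactor Q ≠ 0) :
    ∃ E E' : Bases n r, IsEigenChoice (threeBody (mpsState Q)) p E E' := by
  choose V lam hV using fun k => hQ.exists_diagonalizes_quotient (hQ.hankel_fst k)
  choose V' lam' hV' using fun k => hQ.exists_diagonalizes_quotient (hQ.hankel_snd k)
  have h1 : ∀ b : Fin r, IsUnit ((fun _ => 1 : Fin r → Matrix (Fin r) (Fin r) ℂ) b).det := by simp
  refine ⟨fun k => unfoldOne Q k * idKron (V k) * blockDiagonal fun _ => 1,
    fun k => unfoldOne Q k * idKron (V' k) * blockDiagonal fun _ => 1, fun k => ⟨?_, ?_⟩⟩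
  · rw [hQ.probeMatrix_mul_pinv hd hp hν]
    exact isEigenbasis_of_diagonalizes (hQ.leftOne k) (hV k)
      ((hV k).ne_zero (hQ.isUnit_det_quotient k _ _)) h1
  · rw [hQ.probeMatrix_mul_pinv hd hp hν]
    exact isEigenbasis_of_diagonalizes (hQ.leftOne k) (hV' k)
      ((hV' k).ne_zero (hQ.isUnit_det_quotient k _ _)) h1

omit [NeZero d] [∀ k, NeZero (n k)] in
theorem rotate_eq {k : Fin d} (V : Matrix (Fin r) (Fin r) ℂ) (K : Fin r → Matrix (Fin r) (Fin r) ℂ)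
    (G : Fin r → Fin r → Fin r → ℂ) :
    rotate G (unfoldOne Q k * idKron V * blockDiagonal K) =
      unfoldOne Q k * idKron V * blockDiagonal fun b => K b * Matrix.of (G b) := by
  rw [rotate, Matrix.mul_assoc, ← blockDiagonal_mul]

/-- Eigenbases in factorized form. -/
structure Factorized (p : Probes n) (Q : Cores n r) (E E' : Bases n r)
    (V V' : Fin d → Matrix (Fin r) (Fin r) ℂ) (K K' : Fin d → Fin r → Matrix (Fin r) (Fin r) ℂ) :
    Prop where
  diag : ∀ k, ∃ lam, Diagonalizes (V k) (smallMatrix p Q k 0 * (smallMatrix p Q k 1)⁻¹) lam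
  diag' : ∀ k, ∃ lam, Diagonalizes (V' k) (smallMatrix p Q k 2 * (smallMatrix p Q k 3)⁻¹) lam
  unitK : ∀ k b, IsUnit (K k b).det
  unitK' : ∀ k b, IsUnit (K' k b).det
  eq : ∀ k, E k = unfoldOne Q k * idKron (V k) * blockDiagonal (K k)
  eq' : ∀ k, E' k = unfoldOne Q k * idKron (V' k) * blockDiagonal (K' k)

theorem Generic.exists_factorized [NeZero r] (hd : 3 ≤ d) (hp : p.Admissible) (hQ : Generic p Q)
    (hν : normFactor Q ≠ 0) {E E' : Bases n r}
    (h : IsEigenChoice (threeBody (mpsState Q)) p E E') :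
    ∃ V V' K K', Factorized p Q E E' V V' K K' := by
  have h1 : ∀ k, ∃ V lam, ∃ K : Fin r → Matrix (Fin r) (Fin r) ℂ, Diagonalizes V
      (smallMatrix p Q k 0 * (smallMatrix p Q k 1)⁻¹) lam ∧ (∀ b, lam b ≠ 0) ∧
      (∀ b, IsUnit (K b).det) ∧ E k = unfoldOne Q k * idKron V * blockDiagonal K := by
    intro k
    have := (h k).1
    rw [hQ.probeMatrix_mul_pinv hd hp hν] at this
    exact this.exists_diagonalizes (hQ.leftOne k)
  have h2 : ∀ k, ∃ V lam, ∃ K : Fin r → Matrix (Fin r) (Fin r) ℂ, Diagonalizes V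
      (smallMatrix p Q k 2 * (smallMatrix p Q k 3)⁻¹) lam ∧ (∀ b, lam b ≠ 0) ∧
      (∀ b, IsUnit (K b).det) ∧ E' k = unfoldOne Q k * idKron V * blockDiagonal K := by
    intro k
    have := (h k).2
    rw [hQ.probeMatrix_mul_pinv hd hp hν] at this
    exact this.exists_diagonalizes (hQ.leftOne k)
  choose V lam K a1 a2 a3 a4 using h1
  choose V' lam' K' b1 b2 b3 b4 using h2
  exact ⟨V, V', K, K', fun k => ⟨_, a1 k⟩, fun k => ⟨_, b1 k⟩, a3, b3, a4, b4⟩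

variable {E E' : Bases n r} {V V' : Fin d → Matrix (Fin r) (Fin r) ℂ}
  {K K' : Fin d → Fin r → Matrix (Fin r) (Fin r) ℂ}

theorem Factorized.weight_ne_zero [NeZero r] (h : Factorized p Q E E' V V' K K')
    (hQ : Generic p Q) (k : Fin d) (b c : Fin r) : ((V k)⁻¹ * V' k) b c ≠ 0 := by
  obtain ⟨lam, hV⟩ := h.diag k
  obtain ⟨lam', hV'⟩ := h.diag' k
  exact hQ.inv_mul_apply_ne_zero hV hV' b c

theorem Factorized.isUnitV (h : Factorized p Q E E' V V' K K') (k : Fin d) :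
    IsUnit (V k).det := (h.diag k).choose_spec.isUnit

theorem Factorized.hatDefined [NeZero r] (h : Factorized p Q E E' V V' K K') (hQ : Generic p Q) :
    HatDefined E E' := by
  intro k
  rw [h.eq, h.eq']
  exact ⟨fun l => isUnit_det_blockF (hQ.leftOne k) (h.isUnitV k) (h.unitK k) (h.unitK' k)
      (h.weight_ne_zero hQ k) l 0,
    isUnit_det_blockDiagonal (isUnit_det_hatK (hQ.leftOne k) (h.isUnitV k) (h.unitK k)
      (h.unitK' k) (h.weight_ne_zero hQ k))⟩

theorem Factorized.runData [NeZero r] (hd : 3 ≤ d) (hp : p.Admissible) (hQ : Generic p Q)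
    (hν : normFactor Q ≠ 0) (h : Factorized p Q E E' V V' K K') :
    RunData Q (threeBody (mpsState Q)) p E E' (fun k => (K k 0)ᵀ)
      (fun k => rightFactor (V k) (V' k)) (fun k => normFactor Q • smallMatrix p Q k 0) where
  unitA k := by rw [det_transpose]; exact h.unitK k 0
  unitB k := isUnit_det_rightFactor (h.isUnitV k) (h.weight_ne_zero hQ k)
  unitX k := hQ.isUnit_det_smul hν k 0
  leftOne := hQ.leftOne
  leftSq := hQ.leftSq
  hat k := by
    rw [h.eq, h.eq', transpose_transpose]
    exact hatUnfold_eq (hQ.leftOne k) (h.isUnitV k) (h.unitK k) (h.unitK' k)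
      (h.weight_ne_zero hQ k)
  probe j := probeMatrix_pair hd hp (add_sub_cancel_right j 1).symm 0

theorem Factorized.rotate (h : Factorized p Q E E' V V' K K')
    {G : Fin d → Fin r → Fin r → Fin r → ℂ} (hG : ∀ k b, (Matrix.of (G k b)).det ≠ 0) :
    Factorized p Q (fun k => rotate (G k) (E k)) E' V V'
      (fun k b => K k b * Matrix.of (G k b)) K' where
  diag := h.diag
  diag' := h.diag'
  unitK k b := by rw [det_mul]; exact (h.unitK k b).mul (isUnit_iff_ne_zero.2 (hG k b))
  unitK' := h.unitK'
  eq k := by rw [h.eq, rotate_eq]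
  eq' := h.eq'

theorem Factorized.isEigenChoice [NeZero r] (hd : 3 ≤ d) (hp : p.Admissible) (hQ : Generic p Q)
    (hν : normFactor Q ≠ 0) (h : Factorized p Q E E' V V' K K') :
    IsEigenChoice (threeBody (mpsState Q)) p E E' := by
  intro k
  obtain ⟨lam, hV⟩ := h.diag k
  obtain ⟨lam', hV'⟩ := h.diag' k
  rw [hQ.probeMatrix_mul_pinv hd hp hν, hQ.probeMatrix_mul_pinv hd hp hν, h.eq, h.eq']
  exact ⟨isEigenbasis_of_diagonalizes (hQ.leftOne k) hV
      (hV.ne_zero (hQ.isUnit_det_quotient k _ _)) (h.unitK k),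
    isEigenbasis_of_diagonalizes (hQ.leftOne k) hV'
      (hV'.ne_zero (hQ.isUnit_det_quotient k _ _)) (h.unitK' k)⟩

-- This corner entry is the scalar whose non-vanishing makes `N_k` invertible. As a function of the
-- rotation it is analytic, and the witness, which need not be invertible, picks out a non-zero
-- entry of the first column of `B`.
omit [NeZero d] in
theorem ae_rotation_ne_zero [NeZero r] (l : Fin d) {M B : Matrix (Fin r) (Fin r) ℂ}
    (hM : IsUnit M.det) (hB : IsUnit B.det) :
    ∀ᵐ G : Fin d → Fin r → Fin r → Fin r → ℂ,
      ((M * Matrix.of (G l 0))ᵀ * B) 0 0 ≠ 0 := by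
  have hcol : ∃ i, B i 0 ≠ 0 := by
    by_contra hcon
    push Not at hcon
    exact hB.ne_zero (det_eq_zero_of_column_eq_zero 0 hcon)
  obtain ⟨i, hi⟩ := hcol
  have han : AnalyticMat fun G : Fin d → Fin r → Fin r → Fin r → ℂ => Matrix.of (G l 0) :=
    analyticMat_slice (n := fun _ => r) l 0
  have han' : AnalyticMat fun G : Fin d → Fin r → Fin r → Fin r → ℂ =>
      (M * Matrix.of (G l 0))ᵀ * B :=
    AnalyticMat.mul (fun a b => ((AnalyticMat.const M).mul han) b a) (AnalyticMat.const B)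
  refine ae_ne_zero_of_analytic volume (han' 0 0) (x₀ := fun _ _ => M⁻¹ * Matrix.single i 0 1) ?_
  have h1 : M * Matrix.of (M⁻¹ * Matrix.single i 0 1) = Matrix.single i 0 (1 : ℂ) := by
    change M * (M⁻¹ * Matrix.single i 0 1) = _
    rw [← Matrix.mul_assoc, Matrix.mul_nonsing_inv _ hM, Matrix.one_mul]
  dsimp only
  rw [h1, Matrix.transpose_single]
  simpa using hi

omit [NeZero d] in
theorem ae_det_rotation_ne_zero (l : Fin d) (b : Fin r) :
    ∀ᵐ G : Fin d → Fin r → Fin r → Fin r → ℂ, (Matrix.of (G l b)).det ≠ 0 := by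
  have han : AnalyticMat fun G : Fin d → Fin r → Fin r → Fin r → ℂ => Matrix.of (G l b) :=
    analyticMat_slice (n := fun _ => r) l b
  refine ae_ne_zero_of_analytic volume han.det
    (x₀ := fun _ _ => (1 : Matrix (Fin r) (Fin r) ℂ)) ?_
  change (1 : Matrix (Fin r) (Fin r) ℂ).det ≠ 0
  rw [det_one]
  exact one_ne_zero

theorem Factorized.ae_rotate [NeZero r] (hd : 3 ≤ d) (hp : p.Admissible) (hQ : Generic p Q)
    (hν : normFactor Q ≠ 0) (h : Factorized p Q E E' V V' K K') :
    ∀ᵐ G : Fin d → Fin r → Fin r → Fin r → ℂ,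
      IsEigenChoice (threeBody (mpsState Q)) p (fun k => BlostrMPS.rotate (G k) (E k)) E' ∧
      GaugeDefined (threeBody (mpsState Q)) p (fun k => BlostrMPS.rotate (G k) (E k)) E' := by
  have h1 := ae_all_iff.2 fun k : Fin d => ae_all_iff.2 fun b : Fin r => ae_det_rotation_ne_zero k b
  have h2 := ae_all_iff.2 fun k : Fin d => ae_rotation_ne_zero (k + 1) (h.unitK (k + 1) 0)
    (isUnit_det_rightFactor (h.isUnitV k) (h.weight_ne_zero hQ k))
  filter_upwards [h1, h2] with G hG hG'
  have h3 := h.rotate hG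
  exact ⟨h3.isEigenChoice hd hp hQ hν, fun k => (h3.runData hd hp hQ hν).isUnit_det_matN k (hG' k)⟩

end Generic
end BlostrMPS

/-! ### The recovery theorem -/

theorem theorem3 (d r : ℕ) [NeZero d] [NeZero r] (hd : 3 ≤ d) (hr : 2 ≤ r)
    (n : Fin d → ℕ) [∀ k, NeZero (n k)] (hn : ∀ k, r ^ 2 ≤ n k)
    (p : BlostrMPS.Probes n) (hp : p.Admissible)
    (μ : Measure (BlostrMPS.Cores n r)) [IsProbabilityMeasure μ]
    (hμ : μ ≪ (volume : Measure (BlostrMPS.Cores n r))) :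
    ∀ᵐ Q ∂μ,
      -- the state is a unit vector
      (∑ α, ‖BlostrMPS.mpsState Q α‖ ^ 2 = 1) ∧
      -- the eigenbases requested by the algorithm exist
      (∃ E E' : BlostrMPS.Bases n r,
        BlostrMPS.IsEigenChoice (BlostrMPS.threeBody (BlostrMPS.mpsState Q)) p E E') ∧
      ∀ E E' : BlostrMPS.Bases n r,
        BlostrMPS.IsEigenChoice (BlostrMPS.threeBody (BlostrMPS.mpsState Q)) p E E' →
        BlostrMPS.HatDefined E E' ∧
        -- for generic bases of the eigenspaces the algorithm runs to the end
        (∀ᵐ G : Fin d → Fin r → Fin r → Fin r → ℂ,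
          BlostrMPS.IsEigenChoice (BlostrMPS.threeBody (BlostrMPS.mpsState Q)) p
            (fun k => BlostrMPS.rotate (G k) (E k)) E' ∧
          BlostrMPS.GaugeDefined (BlostrMPS.threeBody (BlostrMPS.mpsState Q)) p
            (fun k => BlostrMPS.rotate (G k) (E k)) E') ∧
        -- whenever it runs to the end, it recovers the cores and the state
        (BlostrMPS.GaugeDefined (BlostrMPS.threeBody (BlostrMPS.mpsState Q)) p E E' →
          (∃ c : ℂ, c ≠ 0 ∧ BlostrMPS.GaugeEquiv Q
            (BlostrMPS.scaleFirst c
              (BlostrMPS.output (BlostrMPS.threeBody (BlostrMPS.mpsState Q)) p E E'))) ∧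
          ∃ z : ℂ, ‖z‖ = 1 ∧ ∀ α,
            BlostrMPS.mpsState
              (BlostrMPS.output (BlostrMPS.threeBody (BlostrMPS.mpsState Q)) p E E') α =
              z * BlostrMPS.mpsState Q α) := by
  filter_upwards [hμ.ae_le (BlostrMPS.ae_generic (by omega) hr hn hp)] with Q hQ
  obtain ⟨α, hα⟩ := hQ.exists_ringTensor_ne_zero hd hp
  have hν := BlostrMPS.normFactor_ne_zero hα
  refine ⟨BlostrMPS.sum_norm_mpsState hα, hQ.exists_isEigenChoice hd hp hν, fun E E' hE => ?_⟩
  obtain ⟨V, V', K, K', h⟩ := hQ.exists_factorized hd hp hν hE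
  refine ⟨h.hatDefined hQ, h.ae_rotate hd hp hQ hν, fun hN => ?_⟩
  have hrun := h.runData hd hp hQ hν
  obtain ⟨σ, hσ, hout⟩ := hrun.slice_output hN
  obtain ⟨c, hc, hgauge⟩ := BlostrMPS.exists_scaleFirst_gaugeEquiv hrun.unitA hσ hout
  -- The gauge-equivalent core family is the output scaled by `c`, so the tensor of the output
  -- itself is `c⁻¹` times that of `Q`.
  refine ⟨⟨c, hc, hgauge⟩, BlostrMPS.exists_phase_of_ringTensor (inv_ne_zero hc) fun β => ?_⟩
  rw [← BlostrMPS.ringTensor_eq_of_gaugeEquiv hgauge, BlostrMPS.ringTensor_scaleFirst,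
    inv_mul_cancel_left₀ hc]
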